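/- Let $W$ be the group of order two. Let $dg\mathbb{Q}$-mod be the category of unbounded chain complexes of rational vector spaces and $dg\mathbb{Q}W$-mod the category of such complexes with a $W$-action; regard a $dg\mathbb{Q}$-module as a $dg\mathbb{Q}W$-module with trivial action. An object $V$ of the category $\mathcal{A}(\mathcal{D})$ consists of a $dg\mathbb{Q}$-module $V_\infty$, of $dg\mathbb{Q}W$-modules $V_k$ for $k\geq 1$, and of a map of $dg\mathbb{Q}W$-modules $\sigma_V\colon V_\infty\to \operatorname{colim}_n\prod_{k\geq n}V_k$. A map $f\colon V\to V'$ consists of a map $f_\infty\colon V_\infty\to V'_\infty$ of $dg\mathbb{Q}$-modules and maps $f_k\colon V_k\to V'_k$ of $dg\mathbb{Q}W$-modules with $\sigma_{V'}\circ f_\infty=(\operatorname{colim}_n\prod_{k\geq n}f_k)\circ\sigma_V$. The category is symmetric monoidal under the stalkwise tensor product over $\mathbb{Q}$: $(V\otimes V')_\infty=V_\infty\otimes V'_\infty$ and $(V\otimes V')_k=V_k\otimes V'_k$ (diagonal action), with the evident structure map and with the symmetry given by the Koszul sign rule. Let $c\colon dg\mathbb{Q}\text{-mod}\to\mathcal{A}(\mathcal{D})$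 be the functor with $(cM)_\infty=M$, $(cM)_k=M$ for all $k$, and structure map induced by the diagonal $M\to\prod_{k\geq1}M$. For $k\geq 1$ let $i_k\colon dg\mathbb{Q}W\text{-mod}\to\mathcal{A}(\mathcal{D})$ be the functor with $(i_kR)_k=R$, $(i_kR)_l=0$ for $l\neq k$, and $(i_kR)_\infty=0$. For $R=\mathbb{Q}$ or $R=\mathbb{Q}W$ let $S^nR$ be the complex with $R$ in degree $n$ and $0$ elsewhere, let $D^nR$ be the complex with $R$ in degrees $n$ and $n-1$, $0$ elsewhere, and the identity as differential, and put $I_R=\{S^{n-1}R\to D^nR : n\in\mathbb{Z}\}$ and $J_R=\{0\to D^nR : n\in\mathbb{Z}\}$. **Theorem.** Call a map $f$ of $\mathcal{A}(\mathcal{D})$ a weak equivalence (respectively a fibration) if $f_\infty$ and every $f_k$, $k\geq1$, is a homology isomorphism (respectively surjective in every degree), that is, a weak equivalence (respectively a fibration) in the projective model structure. Then: 1. These classes are the weak equivalences and the fibrations of a model structure on $\mathcal{A}(\mathcal{D})$ (all small limits and colimits exist, and the two factorizations can be chosen functorially). 2. With the stalkwise tensor product, this is a monoidal model category: the symmetric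 monoidal structure is closed; the pushout-product of two cofibrations is a cofibration, which is a weak equivalence if one of the two is; and if $Q\to\mathbb{1}$ is a weak equivalence to the unit with $Q$ cofibrant, then $Q\otimes X\to \mathbb{1}\otimes X$ and $X\otimes Q\to X\otimes\mathbb{1}$ are weak equivalences for every cofibrant $X$. 3. It is cofibrantly generated, with generating cofibrations $I=cI_{\mathbb{Q}}\cup\bigcup_{k\geq1}i_kI_{\mathbb{Q}W}$ and generating acyclic cofibrations $J=cJ_{\mathbb{Q}}\cup\bigcup_{k\geq1}i_kJ_{\mathbb{Q}W}$: the domains of the maps of $I$ (of $J$) are small relative to the transfinite compositions of pushouts of maps of $I$ (of $J$), the fibrations are the maps with the right lifting property with respect to $J$, and the acyclic fibrations are the maps with the right lifting property with respect to $I$. 4. It is proper: pushouts of weak equivalences along cofibrations, and pullbacks of weak equivalences along fibrations, are weak equivalences. 5. It satisfies the monoid axiom: every transfinite composition of pushouts of maps of the form $j\otimes Z$, with $j$ an acyclic cofibration and $Z$ an object of $\mathcal{A}(\mathcal{D})$, is a weak equivalence. -/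

import Mathlib

open CategoryTheory Limits
open scoped MonoidalCategory

noncomputable section

namespace DihedralModel

/-- Rational vector spaces. -/
abbrev VectQ := ModuleCat.{0} ℚ

namespace Koszul

open GradedObject.Monoidal

variable (X Y Z : GradedObject ℤ VectQ)

/-- The Koszul braiding `x ⊗ y ↦ (-1)^(|x||y|) y ⊗ x` of graded rational vector spaces. -/
def braid : tensorObj X Y ⟶ tensorObj Y X :=
  fun k ↦ tensorObjDesc fun i j hij ↦
    (i * j).negOnePow • ((β_ (X i) (Y j)).hom ≫ ιTensorObj Y X j i k (by rw [add_comm]; exact hij))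

lemma ι_braid (i j k : ℤ) (hij : i + j = k) :
    ιTensorObj X Y i j k hij ≫ braid X Y k = (i * j).negOnePow •
      ((β_ (X i) (Y j)).hom ≫ ιTensorObj Y X j i k (by rw [add_comm]; exact hij)) := by
  simp [braid]

lemma ι_braid' (i j k : ℤ) (hij : i + j = k) :
    ιTensorObj X Y i j k hij ≫ braid X Y k = (i * j).negOnePow •
      (ιTensorObj X Y i j k hij ≫ (braiding X Y).hom k) := by
  rw [ι_braid]
  simp [braiding]

variable {X Y Z} in
lemma braid_naturality {X' Y' : GradedObject ℤ VectQ} (f : X ⟶ X') (g : Y ⟶ Y') :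
    tensorHom f g ≫ braid X' Y' = braid X Y ≫ tensorHom g f := by
  funext k
  apply tensorObj_ext
  intro i j h
  rw [GradedObject.categoryOfGradedObjects_comp, GradedObject.categoryOfGradedObjects_comp,
    ι_tensorHom_assoc, ι_braid, ← Category.assoc (ιTensorObj X Y i j k h), ι_braid]
  simp only [Linear.comp_units_smul, Linear.units_smul_comp, Category.assoc,
    ι_tensorHom, BraidedCategory.braiding_naturality_assoc]

lemma braid_braid : braid X Y ≫ braid Y X = 𝟙 _ := by
  funext k
  apply tensorObj_ext
  intro i j hij
  rw [GradedObject.categoryOfGradedObjects_comp, ← Category.assoc, ι_braid]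
  simp only [Linear.comp_units_smul, Linear.units_smul_comp, Category.assoc, ι_braid]
  rw [← Category.assoc, SymmetricCategory.symmetry, smul_smul, mul_comm j i,
    Int.units_mul_self, one_smul]
  simp

lemma ι₃_braid (i₁ i₂ i₃ j : ℤ) (h : i₁ + i₂ + i₃ = j) :
    ιTensorObj₃ X Y Z i₁ i₂ i₃ j h ≫ braid X (tensorObj Y Z) j =
      (i₁ * (i₂ + i₃)).negOnePow • (ιTensorObj₃ X Y Z i₁ i₂ i₃ j h ≫
        (braiding X (tensorObj Y Z)).hom j) := by
  rw [ιTensorObj₃_eq X Y Z i₁ i₂ i₃ j h _ rfl, Category.assoc, ι_braid', Linear.comp_units_smul,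
    Category.assoc]

lemma ι₃'_whiskerRight_braid (i₁ i₂ i₃ j : ℤ) (h : i₁ + i₂ + i₃ = j) :
    ιTensorObj₃' X Y Z i₁ i₂ i₃ j h ≫ whiskerRight (braid X Y) Z j =
      (i₁ * i₂).negOnePow • (((β_ (X i₁) (Y i₂)).hom ▷ Z i₃) ≫
        ιTensorObj₃' Y X Z i₂ i₁ i₃ j (by rw [add_comm i₂ i₁, h])) := by
  rw [ιTensorObj₃'_eq X Y Z i₁ i₂ i₃ j h _ rfl,
    ιTensorObj₃'_eq Y X Z i₂ i₁ i₃ j _ (i₁ + i₂) (add_comm _ _), Category.assoc, ι_tensorHom,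
    GradedObject.categoryOfGradedObjects_id, MonoidalCategory.tensorHom_id, ← MonoidalCategory.comp_whiskerRight_assoc, ι_braid]
  have := ((MonoidalCategory.tensorRight (Z i₃)).map_units_smul (i₁ * i₂).negOnePow ((β_ (X i₁) (Y i₂)).hom ≫
    ιTensorObj Y X i₂ i₁ (i₁ + i₂) (add_comm _ _)))
  change _ ▷ _ = _ • (_ ▷ _) at this
  rw [this, Linear.units_smul_comp, MonoidalCategory.comp_whiskerRight, Category.assoc]

lemma ι₃_whiskerLeft_braid (i₁ i₂ i₃ j : ℤ) (h : i₁ + i₂ + i₃ = j) :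
    ιTensorObj₃ X Y Z i₁ i₂ i₃ j h ≫ whiskerLeft X (braid Y Z) j =
      (i₂ * i₃).negOnePow • ((X i₁ ◁ (β_ (Y i₂) (Z i₃)).hom) ≫
        ιTensorObj₃ X Z Y i₁ i₃ i₂ j (by lia)) := by
  rw [ιTensorObj₃_eq X Y Z i₁ i₂ i₃ j h _ rfl,
    ιTensorObj₃_eq X Z Y i₁ i₃ i₂ j _ (i₂ + i₃) (add_comm _ _), Category.assoc, ι_tensorHom,
    GradedObject.categoryOfGradedObjects_id, MonoidalCategory.id_tensorHom, ← MonoidalCategory.whiskerLeft_comp_assoc, ι_braid]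
  have := ((MonoidalCategory.tensorLeft (X i₁)).map_units_smul (i₂ * i₃).negOnePow ((β_ (Y i₂) (Z i₃)).hom ≫
    ιTensorObj Z Y i₃ i₂ (i₂ + i₃) (add_comm _ _)))
  change _ ◁ _ = _ • (_ ◁ _) at this
  rw [this, Linear.units_smul_comp, MonoidalCategory.whiskerLeft_comp, Category.assoc]

lemma hexagon :
    (associator X Y Z).hom ≫ braid X (tensorObj Y Z) ≫ (associator Y Z X).hom =
      whiskerRight (braid X Y) Z ≫ (associator Y X Z).hom ≫ whiskerLeft Y (braid X Z) := by
  funext j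
  apply tensorObj₃'_ext
  intro i₁ i₂ i₃ h
  simp only [GradedObject.categoryOfGradedObjects_comp]
  conv_lhs => rw [ιTensorObj₃'_associator_hom_assoc, ← Category.assoc (ιTensorObj₃ X Y Z i₁ i₂ i₃ j h),
    ι₃_braid, ιTensorObj₃_eq X Y Z i₁ i₂ i₃ j h _ rfl, Category.assoc]
  dsimp [braiding]
  conv_lhs => rw [
    ι_tensorObjDesc, ← MonoidalCategory.id_tensorHom,
    BraidedCategory.braiding_naturality_assoc,
    BraidedCategory.braiding_tensor_right_hom]
  simp only [Category.assoc, Linear.comp_units_smul, Linear.units_smul_comp, Iso.hom_inv_id_assoc]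
  conv_lhs => rw [
    MonoidalCategory.tensorHom_id,
    ← ιTensorObj₃'_eq_assoc Y Z X i₂ i₃ i₁ j (by rw [add_comm _ i₁, ← add_assoc, h]) _ rfl,
    ιTensorObj₃'_associator_hom, Iso.inv_hom_id_assoc]
  conv_rhs => rw [← Category.assoc, ι₃'_whiskerRight_braid, Linear.units_smul_comp, Category.assoc,
    ιTensorObj₃'_associator_hom_assoc, ι₃_whiskerLeft_braid]
  simp only [Linear.comp_units_smul, smul_smul]
  rw [mul_add, Int.negOnePow_add]

end Koszul

/-- The sign convention `d (x ⊗ y) = d x ⊗ y + (-1)^|x| x ⊗ d y` for chain complexes. -/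
instance : (ComplexShape.down ℤ).TensorSigns where
  ε' := MonoidHom.mk' (fun n : Multiplicative ℤ ↦ Int.negOnePow n.toAdd)
    fun a b ↦ Int.negOnePow_add a.toAdd b.toAdd
  rel_add p q r hpq := by
    have : q + 1 = p := hpq
    change q + r + 1 = p + r
    lia
  add_rel p q r hpq := by
    have : q + 1 = p := hpq
    change r + q + 1 = r + p
    lia
  ε'_succ p q hpq := by
    have : q + 1 = p := hpq
    subst this
    change Int.negOnePow q = - Int.negOnePow (q+1)
    rw [Int.negOnePow_succ, neg_neg]

/-- Differential graded rational vector spaces: unbounded chain complexes. The monoidal structure is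
Mathlib's tensor product of complexes. -/
abbrev DgQ := ChainComplex VectQ ℤ

namespace DgQ
open HomologicalComplex

variable (K L : DgQ)

/-- The Koszul braiding in degree `n`. -/
def braidX (n : ℤ) : (tensorObj K L).X n ⟶ (tensorObj L K).X n := Koszul.braid K.X L.X n

lemma ι_braidX (i j n : ℤ) (h : i + j = n) :
    ιTensorObj K L i j n h ≫ braidX K L n = (i * j).negOnePow •
      ((β_ (K.X i) (L.X j)).hom ≫ ιTensorObj L K j i n (by rw [add_comm]; exact h)) :=
  Koszul.ι_braid K.X L.X i j n h

lemma ι_d (i j p q : ℤ) (hpq : q + 1 = p) (h : i + j = p) :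
    ιTensorObj K L i j p h ≫ (tensorObj K L).d p q =
      (K.d i (i - 1) ▷ L.X j) ≫ ιTensorObj K L (i - 1) j q (by lia) +
      i.negOnePow • ((K.X i ◁ L.d j (j - 1)) ≫ ιTensorObj K L i (j - 1) q (by lia)) := by
  have h₁ : (ComplexShape.down ℤ).Rel i (i - 1) := by simp
  have h₂ : (ComplexShape.down ℤ).Rel j (j - 1) := by simp
  rw [mapBifunctor.d_eq, Preadditive.comp_add, mapBifunctor.ι_D₁, mapBifunctor.ι_D₂,
    mapBifunctor.d₁_eq K L _ _ h₁ j q (by change i - 1 + j = q; lia),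
    mapBifunctor.d₂_eq K L _ _ i h₂ q (by change i + (j - 1) = q; lia)]
  congr 1
  exact one_smul _ _

/-- The Koszul braiding of differential graded rational vector spaces. -/
def braidHom : tensorObj K L ⟶ tensorObj L K where
  f n := braidX K L n
  comm' p q hpq := by
    have hpq' : q + 1 = p := hpq
    apply mapBifunctor.hom_ext
    intro i j h
    change i + j = p at h
    rw [← Category.assoc, ← Category.assoc]
    change (ιTensorObj K L i j p h ≫ _) ≫ _ = (ιTensorObj K L i j p h ≫ _) ≫ _
    rw [ι_braidX, ι_d K L i j p q hpq' h, Linear.units_smul_comp, Category.assoc,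
      ι_d L K j i p q hpq' (by lia), Preadditive.add_comp, Linear.units_smul_comp,
      Category.assoc, Category.assoc, ι_braidX, ι_braidX]
    simp only [Preadditive.comp_add, Linear.comp_units_smul, smul_add, smul_smul,
      BraidedCategory.braiding_naturality_left_assoc,
      BraidedCategory.braiding_naturality_right_assoc]
    rw [add_comm]
    congr 2
    · rw [sub_mul, one_mul, Int.negOnePow_sub]
    · rw [mul_sub, mul_one, Int.negOnePow_sub, mul_comm i j, mul_left_comm,
        Int.units_mul_self, mul_one]

variable {K L} in
lemma braidHom_naturality {K' L' : DgQ} (f : K ⟶ K') (g : L ⟶ L') :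
    tensorHom f g ≫ braidHom K' L' = braidHom K L ≫ tensorHom g f := by
  ext n : 1
  exact congrFun (Koszul.braid_naturality f.f g.f) n

lemma braidHom_braidHom : braidHom K L ≫ braidHom L K = 𝟙 _ := by
  ext n : 1
  exact congrFun (Koszul.braid_braid K.X L.X) n

lemma hexagon (M : DgQ) :
    (associator K L M).hom ≫ braidHom K (tensorObj L M) ≫ (associator L M K).hom =
      tensorHom (braidHom K L) (𝟙 M) ≫ (associator L K M).hom ≫
        tensorHom (𝟙 L) (braidHom K M) := by
  ext n : 1
  exact congrFun (Koszul.hexagon K.X L.X M.X) n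

/-- The Koszul braiding as an isomorphism. -/
def braidIso : K ⊗ L ≅ L ⊗ K where
  hom := braidHom K L
  inv := braidHom L K
  hom_inv_id := braidHom_braidHom K L
  inv_hom_id := braidHom_braidHom L K

instance : SymmetricCategory DgQ where
  braiding := braidIso
  braiding_naturality_right X _ _ f := braidHom_naturality (𝟙 X) f
  braiding_naturality_left f Z := braidHom_naturality f (𝟙 Z)
  hexagon_forward := hexagon
  hexagon_reverse X Y Z := by
    have h : α_ Z X Y ≪≫ braidIso Z (X ⊗ Y) ≪≫ α_ X Y Z =
        MonoidalCategory.whiskerRightIso (braidIso Z X) Y ≪≫ α_ X Z Y ≪≫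
          MonoidalCategory.whiskerLeftIso X (braidIso Z Y) := Iso.ext (hexagon Z X Y)
    have h' := congrArg Iso.inv h
    simp only [Iso.trans_inv, Category.assoc] at h'
    exact h'
  symmetry := braidHom_braidHom

end DgQ

namespace DgQ

variable {J : Type} [SmallCategory J]

instance preservesColimits_tensorLeft (K : DgQ) :
    PreservesColimitsOfShape J (MonoidalCategory.tensorLeft K) := by
  refine HomologicalComplex.preservesColimitsOfShape_of_eval _ fun n ↦
    ⟨fun {F} ↦ ⟨fun {c} hc ↦ ⟨?_⟩⟩⟩
  have hc' (i j : ℤ) := isColimitOfPreserves (HomologicalComplex.eval VectQ _ j ⋙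
    MonoidalCategory.tensorLeft (K.X i)) hc
  have key {L L' : DgQ} (f : L ⟶ L') (i j : ℤ) (h : i + j = n) :
      HomologicalComplex.ιTensorObj K L i j n h ≫ (K ◁ f).f n =
        (K.X i ◁ f.f j) ≫ HomologicalComplex.ιTensorObj K L' i j n h := by
    refine (GradedObject.Monoidal.ι_tensorHom (𝟙 K.X) f.f i j n h).trans ?_
    rw [GradedObject.categoryOfGradedObjects_id, MonoidalCategory.id_tensorHom]
    rfl
  let t (s : Cocone (F ⋙ MonoidalCategory.tensorLeft K ⋙ HomologicalComplex.eval VectQ _ n))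
      (i j : ℤ) (h : i + j = n) : Cocone (F ⋙ HomologicalComplex.eval VectQ _ j ⋙
        MonoidalCategory.tensorLeft (K.X i)) :=
    ⟨s.pt, { app a := HomologicalComplex.ιTensorObj K (F.obj a) i j n h ≫ s.ι.app a
             naturality a b f := by
               have h₁ := key (F.map f) i j h
               have h₂ := s.w f
               change (K.X i ◁ (F.map f).f j) ≫ _ = _ ≫ 𝟙 _
               refine (Category.assoc _ _ _).symm.trans ?_
               refine (congrArg (· ≫ s.ι.app b) h₁.symm).trans ?_
               refine (Category.assoc _ _ _).trans ?_
               exact (congrArg (_ ≫ ·) h₂).trans (Category.comp_id _).symm }⟩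
  exact
    { desc s := GradedObject.Monoidal.tensorObjDesc fun i j h ↦ (hc' i j).desc (t s i j h)
      fac s a := by
        apply GradedObject.Monoidal.tensorObj_ext
        intro i j h
        refine (Category.assoc _ _ _).symm.trans ?_
        refine (congrArg (· ≫ _) (key (c.ι.app a) i j h)).trans ?_
        refine (Category.assoc _ _ _).trans ?_
        refine (congrArg (_ ≫ ·) (GradedObject.Monoidal.ι_tensorObjDesc _ i j h)).trans ?_
        exact (hc' i j).fac (t s i j h) a
      uniq s m hm := by
        apply GradedObject.Monoidal.tensorObj_ext
        intro i j h
        refine Eq.trans ?_ (GradedObject.Monoidal.ι_tensorObjDesc _ i j h).symm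
        refine (hc' i j).uniq (t s i j h) _ fun a ↦ ?_
        refine (Category.assoc _ _ _).symm.trans ?_
        refine (congrArg (· ≫ m) (key (c.ι.app a) i j h).symm).trans ?_
        refine (Category.assoc _ _ _).trans ?_
        exact congrArg (_ ≫ ·) (hm a) }

instance preservesColimits_tensorRight (K : DgQ) :
    PreservesColimitsOfShape J (MonoidalCategory.tensorRight K) :=
  preservesColimitsOfShape_of_natIso (BraidedCategory.tensorLeftIsoTensorRight K)
end DgQ

/-- The group `W` of order two. -/
abbrev W₂ := Multiplicative (ZMod 2)
/-- Differential graded `ℚ[W]`-modules, as chain complexes of rational vector spaces with an action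
of `W`. The tensor product is over `ℚ`, with diagonal action. -/
abbrev DgQW := Action DgQ W₂

namespace DgQW
variable {J : Type} [SmallCategory J]
instance preservesColimits_tensorLeft (K : DgQW) :
    PreservesColimitsOfShape J (MonoidalCategory.tensorLeft K) :=
  Action.preservesColimitsOfShape_of_preserves _
    (inferInstanceAs (PreservesColimitsOfShape J (Action.forget DgQ W₂ ⋙ MonoidalCategory.tensorLeft K.V)))

instance preservesColimits_tensorRight (K : DgQW) :
    PreservesColimitsOfShape J (MonoidalCategory.tensorRight K) :=
  preservesColimitsOfShape_of_natIso (BraidedCategory.tensorLeftIsoTensorRight K)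
end DgQW

section Colim

variable {D : Type*} [Category* D] [MonoidalCategory D] [HasColimitsOfShape ℕ+ D]

variable (D) in
/-- The canonical map `𝟙 ⟶ colim 𝟙`. -/
def colimEps : 𝟙_ D ⟶ colimit (𝟙_ (ℕ+ ⥤ D)) := colimit.ι (𝟙_ (ℕ+ ⥤ D)) 1

variable (D) in
lemma colimEps_eq (j : ℕ+) : colimEps D = colimit.ι (𝟙_ (ℕ+ ⥤ D)) j := by
  have h := colimit.w (𝟙_ (ℕ+ ⥤ D)) (homOfLE (one_le (a := j)))
  exact h.symm.trans (Category.id_comp _)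

variable [∀ X : D, PreservesColimitsOfShape ℕ+ (MonoidalCategory.tensorLeft X)]
  [∀ X : D, PreservesColimitsOfShape ℕ+ (MonoidalCategory.tensorRight X)]

/-- The canonical map `colim F ⊗ colim G ⟶ colim (F ⊗ G)`. -/
def colimMu (F G : ℕ+ ⥤ D) : colimit F ⊗ colimit G ⟶ colimit (F ⊗ G) :=
  ((colimit.isColimit F).tensor (colimit.isColimit G)).desc (colimit.cocone (F ⊗ G))

lemma ι_colimMu (F G : ℕ+ ⥤ D) (j : ℕ+) : (colimit.ι F j ⊗ₘ colimit.ι G j) ≫ colimMu F G =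
    colimit.ι (F ⊗ G) j :=
  ((colimit.isColimit F).tensor (colimit.isColimit G)).fac _ j

lemma ι_colimMu_assoc (F G : ℕ+ ⥤ D) (j : ℕ+) {Z : D} (h : colimit (F ⊗ G) ⟶ Z) :
    (colimit.ι F j ⊗ₘ colimit.ι G j) ≫ colimMu F G ≫ h = colimit.ι (F ⊗ G) j ≫ h := by
  rw [← Category.assoc, ι_colimMu]
  rfl

lemma colimTensor_ext {F G : ℕ+ ⥤ D} {Z : D} {f g : colimit F ⊗ colimit G ⟶ Z}
    (h : ∀ j, (colimit.ι F j ⊗ₘ colimit.ι G j) ≫ f = (colimit.ι F j ⊗ₘ colimit.ι G j) ≫ g) :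
    f = g :=
  ((colimit.isColimit F).tensor (colimit.isColimit G)).hom_ext h

lemma colimTensor₃_ext {F G H : ℕ+ ⥤ D} {Z : D} {f g : (colimit F ⊗ colimit G) ⊗ colimit H ⟶ Z}
    (h : ∀ j, ((colimit.ι F j ⊗ₘ colimit.ι G j) ⊗ₘ colimit.ι H j) ≫ f =
      ((colimit.ι F j ⊗ₘ colimit.ι G j) ⊗ₘ colimit.ι H j) ≫ g) : f = g :=
  (((colimit.isColimit F).tensor (colimit.isColimit G)).tensor (colimit.isColimit H)).hom_ext h

lemma colimMu_natural {F F' G G' : ℕ+ ⥤ D} (f : F ⟶ F') (g : G ⟶ G') :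
    (colimMap f ⊗ₘ colimMap g) ≫ colimMu F' G' = colimMu F G ≫ colimMap (f ⊗ₘ g) := by
  refine colimTensor_ext fun j ↦ ?_
  rw [MonoidalCategory.tensorHom_comp_tensorHom_assoc, ι_colimMu_assoc, ι_colimMap, ι_colimMap,
    ← MonoidalCategory.tensorHom_comp_tensorHom_assoc, ι_colimMu]
  exact (ι_colimMap (f ⊗ₘ g) j).symm

instance colimLaxMonoidal : (colim : (ℕ+ ⥤ D) ⥤ D).LaxMonoidal where
  ε := colimEps D
  μ := colimMu
  μ_natural_left f G := by
    have h := colimMu_natural f (𝟙 G)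
    simp only [MonoidalCategory.tensorHom_id] at h
    rw [← MonoidalCategory.tensorHom_id]
    exact (congrArg (· ≫ _) (congrArg (_ ⊗ₘ ·) (colim.map_id G).symm)).trans h
  μ_natural_right F f := by
    have h := colimMu_natural (𝟙 F) f
    simp only [MonoidalCategory.id_tensorHom] at h
    rw [← MonoidalCategory.id_tensorHom]
    exact (congrArg (· ≫ _) (congrArg (· ⊗ₘ _) (colim.map_id F).symm)).trans h
  associativity F G H := colimTensor₃_ext fun j ↦ by
    have e₁ : ((colimit.ι F j ⊗ₘ colimit.ι G j) ⊗ₘ colimit.ι H j) ≫ colimMu F G ▷ colimit H =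
        colimit.ι (F ⊗ G) j ⊗ₘ colimit.ι H j := by
      rw [← MonoidalCategory.tensorHom_id, MonoidalCategory.tensorHom_comp_tensorHom, ι_colimMu,
        Category.comp_id]
      rfl
    have e₂ : (colimit.ι F j ⊗ₘ colimit.ι G j ⊗ₘ colimit.ι H j) ≫ colimit F ◁ colimMu G H =
        colimit.ι F j ⊗ₘ colimit.ι (G ⊗ H) j := by
      rw [← MonoidalCategory.id_tensorHom, MonoidalCategory.tensorHom_comp_tensorHom, ι_colimMu,
        Category.comp_id]
      rfl
    change _ ≫ colimMu F G ▷ colimit H ≫ colimMu (F ⊗ G) H ≫ colimMap (α_ F G H).hom =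
      _ ≫ (α_ (colimit F) (colimit G) (colimit H)).hom ≫ colimit F ◁ colimMu G H ≫
        colimMu F (G ⊗ H)
    rw [reassoc_of% e₁, MonoidalCategory.associator_naturality_assoc, reassoc_of% e₂]
    refine (ι_colimMu_assoc (F ⊗ G) H j _).trans ?_
    refine (ι_colimMap _ _).trans ?_
    exact congrArg (_ ≫ ·) (ι_colimMu F (G ⊗ H) j).symm
  left_unitality F := by
    rw [← cancel_epi (λ_ _).inv, Iso.inv_hom_id]
    refine colimit.hom_ext fun j ↦ ?_
    change _ = colimit.ι F j ≫ (λ_ (colimit F)).inv ≫ colimEps D ▷ colimit F ≫ colimMu _ F ≫ colimMap (λ_ F).hom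
    rw [MonoidalCategory.leftUnitor_inv_naturality_assoc, colimEps_eq D j,
      ← MonoidalCategory.id_tensorHom, ← MonoidalCategory.tensorHom_id,
      MonoidalCategory.tensorHom_comp_tensorHom_assoc, Category.id_comp, Category.comp_id]
    refine Eq.trans ?_ (congrArg (_ ≫ ·) (ι_colimMu_assoc (𝟙_ _) F j _).symm)
    refine Eq.trans ?_ (congrArg (_ ≫ ·) (ι_colimMap (λ_ F).hom j).symm)
    refine (Category.comp_id _).trans ?_
    exact ((λ_ (F.obj j)).inv_hom_id_assoc _).symm
  right_unitality F := by
    rw [← cancel_epi (ρ_ _).inv, Iso.inv_hom_id]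
    refine colimit.hom_ext fun j ↦ ?_
    change _ = colimit.ι F j ≫ (ρ_ (colimit F)).inv ≫ colimit F ◁ colimEps D ≫ colimMu F _ ≫ colimMap (ρ_ F).hom
    rw [MonoidalCategory.rightUnitor_inv_naturality_assoc, colimEps_eq D j,
      ← MonoidalCategory.id_tensorHom, ← MonoidalCategory.tensorHom_id,
      MonoidalCategory.tensorHom_comp_tensorHom_assoc, Category.id_comp, Category.comp_id]
    refine Eq.trans ?_ (congrArg (_ ≫ ·) (ι_colimMu_assoc F (𝟙_ _) j _).symm)
    refine Eq.trans ?_ (congrArg (_ ≫ ·) (ι_colimMap (ρ_ F).hom j).symm)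
    refine (Category.comp_id _).trans ?_
    exact ((ρ_ (F.obj j)).inv_hom_id_assoc _).symm

lemma colimMu_braiding [BraidedCategory D] (F G : ℕ+ ⥤ D) :
    colimMu F G ≫ colimMap (β_ F G).hom =
      (β_ (colimit F) (colimit G)).hom ≫ colimMu G F := by
  refine colimTensor_ext fun j ↦ ?_
  rw [ι_colimMu_assoc, BraidedCategory.braiding_naturality_assoc, ι_colimMu]
  exact ι_colimMap (β_ F G).hom j

instance colimLaxBraided [BraidedCategory D] : (colim : (ℕ+ ⥤ D) ⥤ D).LaxBraided where
  braided F G := colimMu_braiding F G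

end Colim

section Tails

variable {D : Type*} [Category* D] [HasCountableProducts D]

/-- The product `∏_{k ≥ n} V k`. -/
def tailProd (V : ℕ+ → D) (n : ℕ+) : D := ∏ᶜ fun k : {k : ℕ+ // n ≤ k} ↦ V k.1

/-- The projection `∏_{k ≥ n} V k ⟶ V k`. -/
def tailπ (V : ℕ+ → D) (n : ℕ+) (k : {k : ℕ+ // n ≤ k}) : tailProd V n ⟶ V k.1 := Pi.π _ k

/-- Constructor for maps to `∏_{k ≥ n} V k`. -/
def tailLift {V : ℕ+ → D} {n : ℕ+} {X : D} (f : ∀ k : {k : ℕ+ // n ≤ k}, X ⟶ V k.1) :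
    X ⟶ tailProd V n := Pi.lift f

lemma tailLift_π {V : ℕ+ → D} {n : ℕ+} {X : D} (f : ∀ k : {k : ℕ+ // n ≤ k}, X ⟶ V k.1)
    (k : {k : ℕ+ // n ≤ k}) : tailLift f ≫ tailπ V n k = f k := Pi.lift_π _ _

lemma tailLift_π_assoc {V : ℕ+ → D} {n : ℕ+} {X : D} (f : ∀ k : {k : ℕ+ // n ≤ k}, X ⟶ V k.1)
    (k : {k : ℕ+ // n ≤ k}) {Z : D} (h : V k.1 ⟶ Z) :
    tailLift f ≫ tailπ V n k ≫ h = f k ≫ h := by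
  rw [← Category.assoc, tailLift_π]

lemma tail_ext {V : ℕ+ → D} {n : ℕ+} {X : D} {f g : X ⟶ tailProd V n}
    (h : ∀ k, f ≫ tailπ V n k = g ≫ tailπ V n k) : f = g := Pi.hom_ext _ _ h

/-- The map `∏_{k ≥ n} V k ⟶ ∏_{k ≥ n} V' k` induced by a family of maps. -/
def tailMap {V V' : ℕ+ → D} (f : ∀ k, V k ⟶ V' k) (n : ℕ+) : tailProd V n ⟶ tailProd V' n :=
  tailLift fun k ↦ tailπ V n k ≫ f k.1

lemma tailMap_π {V V' : ℕ+ → D} (f : ∀ k, V k ⟶ V' k) (n : ℕ+) (k : {k : ℕ+ // n ≤ k}) :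
    tailMap f n ≫ tailπ V' n k = tailπ V n k ≫ f k.1 := tailLift_π _ _

lemma tailMap_π_assoc {V V' : ℕ+ → D} (f : ∀ k, V k ⟶ V' k) (n : ℕ+) (k : {k : ℕ+ // n ≤ k})
    {Z : D} (h : V' k.1 ⟶ Z) :
    tailMap f n ≫ tailπ V' n k ≫ h = tailπ V n k ≫ f k.1 ≫ h := by
  rw [← Category.assoc, tailMap_π, Category.assoc]

/-- The projection `∏_{k ≥ n} V k ⟶ ∏_{k ≥ m} V k` for `n ≤ m`. -/
def tailRes (V : ℕ+ → D) {n m : ℕ+} (h : n ≤ m) : tailProd V n ⟶ tailProd V m :=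
  tailLift fun k ↦ tailπ V n ⟨k.1, h.trans k.2⟩

lemma tailRes_π (V : ℕ+ → D) {n m : ℕ+} (h : n ≤ m) (k : {k : ℕ+ // m ≤ k}) :
    tailRes V h ≫ tailπ V m k = tailπ V n ⟨k.1, h.trans k.2⟩ := tailLift_π _ _

lemma tailRes_π_assoc (V : ℕ+ → D) {n m : ℕ+} (h : n ≤ m) (k : {k : ℕ+ // m ≤ k})
    {Z : D} (g : V k.1 ⟶ Z) :
    tailRes V h ≫ tailπ V m k ≫ g = tailπ V n ⟨k.1, h.trans k.2⟩ ≫ g := by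
  rw [← Category.assoc, tailRes_π]

variable (D) in
/-- The functor sending `V` to the tower `n ↦ ∏_{k ≥ n} V k` with the projections. -/
def tails : (ℕ+ → D) ⥤ (ℕ+ ⥤ D) where
  obj V :=
    { obj n := tailProd V n
      map f := tailRes V (leOfHom f)
      map_id n := tail_ext fun k ↦ by simp [tailRes_π]
      map_comp f g := tail_ext fun k ↦ by simp [tailRes_π] }
  map f :=
    { app n := tailMap f n
      naturality n m g := tail_ext fun k ↦ by
        simp only [Category.assoc, tailMap_π, tailRes_π, tailRes_π_assoc] }
  map_id V := by
    ext n : 2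
    exact tail_ext fun k ↦ by simp [tailMap_π]
  map_comp f g := by
    ext n : 2
    exact tail_ext fun k ↦ by simp [tailMap_π, tailMap_π_assoc]

variable [MonoidalCategory D]

variable (D) in
/-- The diagonal map `𝟙 ⟶ ∏_{k ≥ n} 𝟙`. -/
def tailEps (n : ℕ+) : 𝟙_ D ⟶ tailProd (fun _ ↦ 𝟙_ D) n := tailLift fun _ ↦ 𝟙 _

/-- The map `(∏_{k ≥ n} V k) ⊗ (∏_{k ≥ n} V' k) ⟶ ∏_{k ≥ n} V k ⊗ V' k`. -/
def tailMu (V V' : ℕ+ → D) (n : ℕ+) :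
    tailProd V n ⊗ tailProd V' n ⟶ tailProd (fun k ↦ V k ⊗ V' k) n :=
  tailLift fun k ↦ tailπ V n k ⊗ₘ tailπ V' n k

lemma tailMu_π (V V' : ℕ+ → D) (n : ℕ+) (k : {k : ℕ+ // n ≤ k}) :
    tailMu V V' n ≫ tailπ (fun k ↦ V k ⊗ V' k) n k = tailπ V n k ⊗ₘ tailπ V' n k := tailLift_π _ _

lemma tailMu_π_assoc (V V' : ℕ+ → D) (n : ℕ+) (k : {k : ℕ+ // n ≤ k}) {Z : D}
    (h : V k.1 ⊗ V' k.1 ⟶ Z) :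
    tailMu V V' n ≫ tailπ (fun k ↦ V k ⊗ V' k) n k ≫ h = (tailπ V n k ⊗ₘ tailπ V' n k) ≫ h := by
  rw [← Category.assoc, tailMu_π]

open MonoidalCategory

instance tailsLaxMonoidal : (tails D).LaxMonoidal where
  ε :=
    { app n := tailEps D n
      naturality n m f := by
        refine (Category.id_comp (tailEps D m)).trans ?_
        change tailEps D m = tailEps D n ≫ tailRes (fun _ ↦ 𝟙_ D) (leOfHom f)
        exact tail_ext fun k ↦ by simp only [Category.assoc, tailEps, tailLift_π, tailRes_π] }
  μ V V' :=
    { app n := tailMu V V' n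
      naturality n m f := by
        change (tailRes V (leOfHom f) ⊗ₘ tailRes V' (leOfHom f)) ≫ tailMu V V' m =
          tailMu V V' n ≫ tailRes (fun k ↦ V k ⊗ V' k) (leOfHom f)
        exact tail_ext fun k ↦ by
          simp only [Category.assoc, tailMu_π, tailRes_π, tensorHom_comp_tensorHom] }
  μ_natural_left {V V'} f G := by
    ext n : 2
    change tailMap f n ▷ tailProd G n ≫ tailMu V' G n =
      tailMu V G n ≫ tailMap (fun k ↦ f k ▷ G k) n
    exact tail_ext fun k ↦ by
      simp only [Category.assoc, tailMu_π, tailMap_π, tailMu_π_assoc, ← tensorHom_id,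
        tensorHom_comp_tensorHom, Category.id_comp, Category.comp_id]
  μ_natural_right {V V'} G f := by
    ext n : 2
    change tailProd G n ◁ tailMap f n ≫ tailMu G V' n =
      tailMu G V n ≫ tailMap (fun k ↦ G k ◁ f k) n
    exact tail_ext fun k ↦ by
      simp only [Category.assoc, tailMu_π, tailMap_π, tailMu_π_assoc, ← id_tensorHom,
        tensorHom_comp_tensorHom, Category.id_comp, Category.comp_id]
  associativity F G H := by
    ext n : 2
    change tailMu F G n ▷ tailProd H n ≫ tailMu (fun k ↦ F k ⊗ G k) H n ≫
        tailMap (fun k ↦ (α_ (F k) (G k) (H k)).hom) n =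
      (α_ _ _ _).hom ≫ tailProd F n ◁ tailMu G H n ≫ tailMu F (fun k ↦ G k ⊗ H k) n
    exact tail_ext fun k ↦ by
      simp only [Category.assoc, tailMu_π, tailMap_π, tailMu_π_assoc, ← id_tensorHom,
        ← tensorHom_id, tensorHom_comp_tensorHom, tensorHom_comp_tensorHom_assoc,
        Category.id_comp, associator_naturality]
  left_unitality F := by
    ext n : 2
    change (λ_ (tailProd F n)).hom = tailEps D n ▷ tailProd F n ≫ tailMu (fun _ ↦ 𝟙_ D) F n ≫
      tailMap (fun k ↦ (λ_ (F k)).hom) n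
    exact tail_ext fun k ↦ by
      simp only [Category.assoc, tailMap_π, tailMu_π_assoc, ← tensorHom_id,
        tensorHom_comp_tensorHom_assoc, Category.id_comp, tailEps, tailLift_π]
      simp
  right_unitality F := by
    ext n : 2
    change (ρ_ (tailProd F n)).hom = tailProd F n ◁ tailEps D n ≫ tailMu F (fun _ ↦ 𝟙_ D) n ≫
      tailMap (fun k ↦ (ρ_ (F k)).hom) n
    exact tail_ext fun k ↦ by
      simp only [Category.assoc, tailMap_π, tailMu_π_assoc, ← id_tensorHom,
        tensorHom_comp_tensorHom_assoc, Category.id_comp, tailEps, tailLift_π]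
      simp

instance tailsLaxBraided [BraidedCategory D] : (tails D).LaxBraided where
  braided F G := by
    ext n : 2
    change tailMu F G n ≫ tailMap (fun k ↦ (β_ (F k) (G k)).hom) n =
      (β_ _ _).hom ≫ tailMu G F n
    exact tail_ext fun k ↦ by
      simp only [Category.assoc, tailMu_π, tailMap_π, tailMu_π_assoc,
        BraidedCategory.braiding_naturality]

end Tails

section CommaMonoidal

variable {A B T : Type*} [Category* A] [Category* B] [Category* T]
  [MonoidalCategory A] [MonoidalCategory B] [MonoidalCategory T]
  {L : A ⥤ T} {R : B ⥤ T} [L.OplaxMonoidal] [R.LaxMonoidal]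

open MonoidalCategory Functor.LaxMonoidal Functor.OplaxMonoidal

/-- The componentwise tensor product `(a, b, σ) ⊗ (a', b', σ') = (a ⊗ a', b ⊗ b', -)` with structure
map `L (a ⊗ a') ⟶ L a ⊗ L a' ⟶ R b ⊗ R b' ⟶ R (b ⊗ b')`. -/
abbrev commaTensor (X Y : Comma L R) : Comma L R where
  left := X.left ⊗ Y.left
  right := X.right ⊗ Y.right
  hom := δ L X.left Y.left ≫ (X.hom ⊗ₘ Y.hom) ≫ μ R X.right Y.right

/-- The tensor product of two maps in a comma category. -/
abbrev commaTensorHom {X X' Y Y' : Comma L R} (f : X ⟶ X') (g : Y ⟶ Y') :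
    commaTensor X Y ⟶ commaTensor X' Y' where
  left := f.left ⊗ₘ g.left
  right := f.right ⊗ₘ g.right
  w := by
    rw [← δ_natural_assoc, tensorHom_comp_tensorHom_assoc, f.w, g.w,
      ← tensorHom_comp_tensorHom_assoc, μ_natural, Category.assoc, Category.assoc]

/-- The componentwise associator. -/
abbrev commaAssociator (X Y Z : Comma L R) :
    commaTensor (commaTensor X Y) Z ≅ commaTensor X (commaTensor Y Z) :=
  Comma.isoMk (α_ _ _ _) (α_ _ _ _) (by
    have h₁ : ((δ L X.left Y.left ≫ (X.hom ⊗ₘ Y.hom) ≫ μ R X.right Y.right) ⊗ₘ Z.hom) =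
        δ L X.left Y.left ▷ _ ≫ ((X.hom ⊗ₘ Y.hom) ⊗ₘ Z.hom) ≫ μ R X.right Y.right ▷ _ := by
      simp only [← tensorHom_id, tensorHom_comp_tensorHom, Category.id_comp, Category.comp_id]
    have h₂ : (X.hom ⊗ₘ (δ L Y.left Z.left ≫ (Y.hom ⊗ₘ Z.hom) ≫ μ R Y.right Z.right)) =
        _ ◁ δ L Y.left Z.left ≫ (X.hom ⊗ₘ (Y.hom ⊗ₘ Z.hom)) ≫ _ ◁ μ R Y.right Z.right := by
      simp only [← id_tensorHom, tensorHom_comp_tensorHom, Category.id_comp, Category.comp_id]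
    dsimp only
    rw [h₁, h₂]
    simp only [Category.assoc]
    rw [Functor.LaxMonoidal.associativity, associator_naturality_assoc, Functor.OplaxMonoidal.associativity_assoc])

/-- The unit, with structure map `L 𝟙 ⟶ 𝟙 ⟶ R 𝟙`. -/
abbrev commaUnit : Comma L R where
  left := 𝟙_ A
  right := 𝟙_ B
  hom := η L ≫ ε R

/-- The componentwise left unitor. -/
abbrev commaLeftUnitor (X : Comma L R) : commaTensor commaUnit X ≅ X :=
  Comma.isoMk (λ_ _) (λ_ _) (by
    have h : ((η L ≫ ε R) ⊗ₘ X.hom) = η L ▷ _ ≫ _ ◁ X.hom ≫ ε R ▷ _ := by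
      rw [MonoidalCategory.tensorHom_def, comp_whiskerRight, Category.assoc, whisker_exchange]
    dsimp only
    rw [h]
    simp only [Category.assoc]
    rw [← Functor.LaxMonoidal.left_unitality, leftUnitor_naturality, ← Functor.OplaxMonoidal.left_unitality_hom]
    simp only [Category.assoc])

/-- The componentwise right unitor. -/
abbrev commaRightUnitor (X : Comma L R) : commaTensor X commaUnit ≅ X :=
  Comma.isoMk (ρ_ _) (ρ_ _) (by
    have h : (X.hom ⊗ₘ (η L ≫ ε R)) = _ ◁ η L ≫ X.hom ▷ _ ≫ _ ◁ ε R := by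
      rw [MonoidalCategory.tensorHom_def', whiskerLeft_comp, Category.assoc, whisker_exchange]
    dsimp only
    rw [h]
    simp only [Category.assoc]
    rw [← Functor.LaxMonoidal.right_unitality, rightUnitor_naturality, ← Functor.OplaxMonoidal.right_unitality_hom]
    simp only [Category.assoc])

variable (L R)

/-- The componentwise tensor product on a comma category. -/
abbrev commaMonoidal : MonoidalCategory (Comma L R) where
  tensorObj := commaTensor
  tensorHom := commaTensorHom
  whiskerLeft X Y Y' f :=
    { left := X.left ◁ f.left
      right := X.right ◁ f.right
      w := by simpa using (commaTensorHom (𝟙 X) f).w }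
  whiskerRight f Y :=
    { left := f.left ▷ Y.left
      right := f.right ▷ Y.right
      w := by simpa using (commaTensorHom f (𝟙 Y)).w }
  tensorUnit := commaUnit
  associator := commaAssociator
  leftUnitor := commaLeftUnitor
  rightUnitor := commaRightUnitor
  tensorHom_def f g := by ext <;> simp [MonoidalCategory.tensorHom_def]
  id_tensorHom_id _ _ := by ext <;> simp
  tensorHom_comp_tensorHom _ _ _ _ := by ext <;> simp
  whiskerLeft_id _ _ := by ext <;> simp
  id_whiskerRight _ _ := by ext <;> simp
  associator_naturality _ _ _ := by ext <;> simp
  leftUnitor_naturality _ := by ext <;> simp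
  rightUnitor_naturality _ := by ext <;> simp
  pentagon _ _ _ _ := by ext <;> simp
  triangle _ _ := by ext <;> simp

variable [SymmetricCategory A] [SymmetricCategory B] [SymmetricCategory T]

/-- The componentwise symmetry on a comma category. -/
abbrev commaSymmetric
    (hL : ∀ X Y, δ L X Y ≫ (β_ (L.obj X) (L.obj Y)).hom = L.map (β_ X Y).hom ≫ δ L Y X)
    (hR : ∀ X Y, μ R X Y ≫ R.map (β_ X Y).hom = (β_ (R.obj X) (R.obj Y)).hom ≫ μ R Y X) :
    letI := commaMonoidal L R
    SymmetricCategory (Comma L R) :=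
  letI := commaMonoidal L R
  { braiding X Y := Comma.isoMk (β_ X.left Y.left) (β_ X.right Y.right) (by
      change L.map (β_ X.left Y.left).hom ≫
          δ L Y.left X.left ≫ (Y.hom ⊗ₘ X.hom) ≫ μ R Y.right X.right =
        (δ L X.left Y.left ≫ (X.hom ⊗ₘ Y.hom) ≫ μ R X.right Y.right) ≫
          R.map (β_ X.right Y.right).hom
      rw [Category.assoc, Category.assoc, hR X.right Y.right,
        BraidedCategory.braiding_naturality_assoc, ← Category.assoc, ← hL, Category.assoc])
    braiding_naturality_right X _ _ f := CommaMorphism.ext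
      (BraidedCategory.braiding_naturality_right X.left f.left)
      (BraidedCategory.braiding_naturality_right X.right f.right)
    braiding_naturality_left f X := CommaMorphism.ext
      (BraidedCategory.braiding_naturality_left f.left X.left)
      (BraidedCategory.braiding_naturality_left f.right X.right)
    hexagon_forward X Y Z := CommaMorphism.ext
      (BraidedCategory.hexagon_forward X.left Y.left Z.left)
      (BraidedCategory.hexagon_forward X.right Y.right Z.right)
    hexagon_reverse X Y Z := CommaMorphism.ext
      (BraidedCategory.hexagon_reverse X.left Y.left Z.left)
      (BraidedCategory.hexagon_reverse X.right Y.right Z.right)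
    symmetry X Y := CommaMorphism.ext
      (SymmetricCategory.symmetry X.left Y.left)
      (SymmetricCategory.symmetry X.right Y.right) }

end CommaMonoidal

/-- The inclusion of dg rational vector spaces as dg `ℚ[W]`-modules with trivial action. -/
@[simps]
def trivW : DgQ ⥤ DgQW where
  obj M := Action.trivial W₂ M
  map f := { hom := f }

instance : MonoidalCategory DgQW := inferInstance
instance : SymmetricCategory DgQW := inferInstance
instance : MonoidalCategory (ℕ+ → DgQW) := Pi.monoidalCategory
instance : SymmetricCategory (ℕ+ → DgQW) := Pi.symmetricCategory

instance : trivW.OplaxMonoidal where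
  η := { hom := 𝟙 _ }
  δ X Y :=
    { hom := 𝟙 _
      comm g := by
        change 𝟙 _ ≫ 𝟙 _ = 𝟙 _ ≫ (𝟙 X ⊗ₘ 𝟙 Y)
        simp }
  δ_natural_left f Z := Action.Hom.ext ((Category.id_comp _).trans (Category.comp_id _).symm)
  δ_natural_right f Z := Action.Hom.ext ((Category.id_comp _).trans (Category.comp_id _).symm)
  oplax_associativity X Y Z := Action.Hom.ext (by
    simp only [Action.comp_hom, Action.associator_hom_hom, Action.whiskerLeft_hom,
      Action.whiskerRight_hom]
    change 𝟙 _ ≫ 𝟙 _ ▷ Z ≫ (α_ X Y Z).hom = (α_ X Y Z).hom ≫ 𝟙 _ ≫ X ◁ 𝟙 _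
    simp)
  oplax_left_unitality X := Action.Hom.ext (by
    rw [Action.leftUnitor_inv_hom, Action.comp_hom, Action.comp_hom, Action.whiskerRight_hom]
    change (λ_ X).inv = (λ_ X).inv ≫ 𝟙 _ ≫ 𝟙 _ ▷ X
    simp)
  oplax_right_unitality X := Action.Hom.ext (by
    rw [Action.rightUnitor_inv_hom, Action.comp_hom, Action.comp_hom, Action.whiskerLeft_hom]
    change (ρ_ X).inv = (ρ_ X).inv ≫ 𝟙 _ ≫ X ◁ 𝟙 _
    simp)

/-- `V ↦ colim_n ∏_{k ≥ n} V k`. -/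
def germs : (ℕ+ → DgQW) ⥤ DgQW := tails DgQW ⋙ colim

instance : (colim : (ℕ+ ⥤ DgQW) ⥤ DgQW).LaxMonoidal := colimLaxMonoidal
instance : (tails DgQW).LaxMonoidal := tailsLaxMonoidal
instance : germs.LaxMonoidal := inferInstanceAs (tails DgQW ⋙ colim).LaxMonoidal
instance : germs.LaxBraided := inferInstanceAs (tails DgQW ⋙ colim).LaxBraided

/-- The category `𝒜(𝒟)`: an object `V` consists of `V.left = V_∞`, of `V.right k = V_k` for `k ≥ 1`
and of `V.hom = σ_V : V_∞ ⟶ colim_n ∏_{k ≥ n} V_k`; a map consists of maps `f_∞` and `f_k`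
commuting with the structure maps. -/
abbrev AD := Comma trivW germs

/-- The stalkwise tensor product on `𝒜(𝒟)`. -/
instance : MonoidalCategory AD := commaMonoidal trivW germs

instance : SymmetricCategory AD := commaSymmetric trivW germs
  (fun _ _ ↦ Action.Hom.ext ((Category.id_comp _).trans (Category.comp_id _).symm))
  (fun X Y ↦ Functor.LaxBraided.braided X Y)

section Generators

open ZeroObject HomologicalComplex

lemma down_rel (n : ℤ) : (ComplexShape.down ℤ).Rel n (n - 1) := sub_add_cancel n 1

lemma ne_sub_one (n : ℤ) : n ≠ n - 1 := by lia

/-- `S^n M`: the complex with `M` in degree `n` and `0` elsewhere. -/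
abbrev sphere (n : ℤ) : VectQ ⥤ DgQ := single VectQ (ComplexShape.down ℤ) n

/-- `D^n M`: the complex with `M` in degrees `n` and `n - 1` and `0` elsewhere, the differential
from degree `n` to degree `n - 1` being the identity. -/
def disc (n : ℤ) : VectQ ⥤ DgQ where
  obj M := double (𝟙 M) (down_rel n)
  map {M N} f := mkHomFromDouble (down_rel n) (ne_sub_one n)
    (f ≫ (doubleXIso₀ (𝟙 N) (down_rel n)).inv)
    (f ≫ (doubleXIso₁ (𝟙 N) (down_rel n) (ne_sub_one n)).inv)
    (by simp [double_d _ _ (ne_sub_one n)])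
    (fun k _ ↦ by rw [double_d_eq_zero₀ _ _ _ _ (ne_sub_one n).symm, comp_zero])
  map_id M := by ext <;> simp
  map_comp f g := by ext <;> simp

/-- The inclusion `S^{n-1} M ⟶ D^n M`. -/
def sphereToDiscApp (n : ℤ) (M : VectQ) :
    (sphere (n - 1)).obj M ⟶ double (𝟙 M) (down_rel n) :=
  mkHomFromSingle (doubleXIso₁ (𝟙 M) (down_rel n) (ne_sub_one n)).inv
    (fun k _ ↦ by rw [double_d_eq_zero₀ _ _ _ _ (ne_sub_one n).symm, comp_zero])

/-- The inclusions `S^{n-1} M ⟶ D^n M` are natural in `M`. -/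
def sphereToDisc (n : ℤ) : sphere (n - 1) ⟶ disc n where
  app M := sphereToDiscApp n M
  naturality M N f := by
    apply from_single_hom_ext
    simp [disc, sphereToDiscApp, mkHomFromSingle_f, single_map_f_self]

/-- The elements `S^{n-1} ℚ ⟶ D^n ℚ` of `I_ℚ`. -/
def genCofQ (n : ℤ) :
    (sphere (n - 1)).obj (ModuleCat.of ℚ ℚ) ⟶ (disc n).obj (ModuleCat.of ℚ ℚ) :=
  (sphereToDisc n).app _

/-- The elements `0 ⟶ D^n ℚ` of `J_ℚ`. -/
def genTrivCofQ (n : ℤ) : (0 : DgQ) ⟶ (disc n).obj (ModuleCat.of ℚ ℚ) := 0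

/-- The group ring `ℚ[W]`, as a `ℚ[W]`-module. -/
def groupRingQW : Action VectQ W₂ :=
  ((ModuleCat.free ℚ).mapAction W₂).obj (Action.leftRegular W₂)

/-- The elements `S^{n-1} ℚ[W] ⟶ D^n ℚ[W]` of `I_{ℚ[W]}`. -/
def genCofQW (n : ℤ) :
    ((sphere (n - 1)).mapAction W₂).obj groupRingQW ⟶ ((disc n).mapAction W₂).obj groupRingQW where
  hom := (sphereToDisc n).app _
  comm g := (sphereToDisc n).naturality (groupRingQW.ρ g)

/-- The elements `0 ⟶ D^n ℚ[W]` of `J_{ℚ[W]}`. -/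
def genTrivCofQW (n : ℤ) : (0 : DgQW) ⟶ ((disc n).mapAction W₂).obj groupRingQW := 0

/-- The canonical map `∏_{k ≥ n} V k ⟶ colim_n ∏_{k ≥ n} V k`. -/
def toGerms (V : ℕ+ → DgQW) (n : ℕ+) : tailProd V n ⟶ germs.obj V :=
  colimit.ι ((tails DgQW).obj V) n

lemma toGerms_naturality {V V' : ℕ+ → DgQW} (f : V ⟶ V') (n : ℕ+) :
    tailMap f n ≫ toGerms V' n = toGerms V n ≫ germs.map f :=
  (ι_colimMap ((tails DgQW).map f) n).symm

/-- The map `M ⟶ ∏_{k ≥ 1} M ⟶ colim_n ∏_{k ≥ n} M` induced by the diagonal. -/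
def diagGerm (M : DgQ) : trivW.obj M ⟶ germs.obj (fun _ ↦ trivW.obj M) :=
  tailLift (V := fun _ ↦ trivW.obj M) (n := 1) (fun _ ↦ 𝟙 (trivW.obj M)) ≫
    toGerms (fun _ ↦ trivW.obj M) 1

lemma diagGerm_naturality {M N : DgQ} (f : M ⟶ N) :
    trivW.map f ≫ diagGerm N = diagGerm M ≫ germs.map (X := fun _ ↦ trivW.obj M)
      (Y := fun _ ↦ trivW.obj N) (fun _ ↦ trivW.map f) := by
  have h : trivW.map f ≫ tailLift (V := fun _ ↦ trivW.obj N) (n := 1) (fun _ ↦ 𝟙 (trivW.obj N)) =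
      tailLift (V := fun _ ↦ trivW.obj M) (n := 1) (fun _ ↦ 𝟙 (trivW.obj M)) ≫
        tailMap (fun _ ↦ trivW.map f) 1 := tail_ext fun k ↦ by
    simp only [Category.assoc, tailMap_π, tailLift_π, tailLift_π_assoc, Category.comp_id,
      Category.id_comp]
  unfold diagGerm
  rw [reassoc_of% h, Category.assoc]
  exact congrArg (_ ≫ ·) (toGerms_naturality (V := fun _ ↦ trivW.obj M)
    (V' := fun _ ↦ trivW.obj N) (fun _ ↦ trivW.map f) 1)

/-- The constant object functor `c`: `(c M)_∞ = M`, `(c M)_k = M`, with structure map induced by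
the diagonal. -/
def constAD : DgQ ⥤ AD where
  obj M :=
    { left := M
      right := fun _ ↦ trivW.obj M
      hom := diagGerm M }
  map f :=
    { left := f
      right := fun _ ↦ trivW.map f
      w := diagGerm_naturality f }

/-- The functor `i_k`: `(i_k R)_k = R`, and `(i_k R)_l = 0` for `l ≠ k`, including `l = ∞`. -/
def skyAD (k : ℕ+) : DgQW ⥤ AD where
  obj R :=
    { left := 0
      right := (GradedObject.single k).obj R
      hom := 0 }
  map f :=
    { left := 0
      right := (GradedObject.single k).map f
      w := by simp }

/-- The set `I = c I_ℚ ∪ ⋃_k i_k I_{ℚ[W]}`. -/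
def genCof : MorphismProperty AD :=
  MorphismProperty.ofHoms (fun n : ℤ ↦ constAD.map (genCofQ n)) ⊔
    MorphismProperty.ofHoms (fun p : ℕ+ × ℤ ↦ (skyAD p.1).map (genCofQW p.2))

/-- The set `J = c J_ℚ ∪ ⋃_k i_k J_{ℚ[W]}`. -/
def genTrivCof : MorphismProperty AD :=
  MorphismProperty.ofHoms (fun n : ℤ ↦ constAD.map (genTrivCofQ n)) ⊔
    MorphismProperty.ofHoms (fun p : ℕ+ × ℤ ↦ (skyAD p.1).map (genTrivCofQW p.2))

end Generators

/-- Weak equivalences of the projective model structure on dg `ℚ`-modules. -/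
def weqQ : MorphismProperty DgQ := fun _ _ f ↦ QuasiIso f

/-- Fibrations of the projective model structure on dg `ℚ`-modules: degreewise surjections. -/
def fibQ : MorphismProperty DgQ := fun _ _ f ↦ ∀ n : ℤ, Function.Surjective (f.f n)

/-- Weak equivalences of the projective model structure on dg `ℚ[W]`-modules. -/
def weqQW : MorphismProperty DgQW := fun _ _ f ↦ weqQ f.hom

/-- Fibrations of the projective model structure on dg `ℚ[W]`-modules. -/
def fibQW : MorphismProperty DgQW := fun _ _ f ↦ fibQ f.hom

/-- Stalkwise weak equivalences. -/
def stalkWeq : MorphismProperty AD := fun _ _ f ↦ weqQ f.left ∧ ∀ k : ℕ+, weqQW (f.right k)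

/-- Stalkwise fibrations. -/
def stalkFib : MorphismProperty AD := fun _ _ f ↦ fibQ f.left ∧ ∀ k : ℕ+, fibQW (f.right k)

section ModelPredicates

open HomotopicalAlgebra MonoidalCategory

universe u

variable (C : Type u) [Category.{0} C]

variable {C} in
/-- `I`-cell: transfinite compositions of pushouts of maps in `I`. -/
def relCell (I : MorphismProperty C) : MorphismProperty C :=
  MorphismProperty.transfiniteCompositions.{0} I.pushouts

variable {C} in
/-- `A` is small relative to `P`: for some cardinal `κ`, mapping out of `A` commutes with the
colimits of all `λ`-sequences of maps in `P`, for all `κ`-filtered limit ordinals `λ`. Ordinals are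
represented by well-ordered types. -/
def IsSmallRel (A : C) (P : MorphismProperty C) : Prop :=
  ∃ κ : Cardinal.{0}, ∀ (J : Type) [LinearOrder J] [SuccOrder J] [OrderBot J] [WellFoundedLT J]
    [NoMaxOrder J], (∀ S : Set J, Cardinal.mk S ≤ κ → BddAbove S) →
    ∀ (X Y : C) (f : X ⟶ Y) (h : P.TransfiniteCompositionOfShape J f),
      PreservesColimit h.F (coyoneda.obj (Opposite.op A))

variable [ModelCategory C]

/-- All small limits and colimits exist, and the factorizations can be chosen functorially. -/
structure IsCompleteFunctorial : Prop where
  hasLimits : HasLimitsOfSize.{0, 0} C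
  hasColimits : HasColimitsOfSize.{0, 0} C
  factor_cof : MorphismProperty.HasFunctorialFactorization (cofibrations C) (trivialFibrations C)
  factor_trivCof :
    MorphismProperty.HasFunctorialFactorization (trivialCofibrations C) (fibrations C)

variable {C} in
/-- The model category `C` is cofibrantly generated, with generating cofibrations `I` and
generating trivial cofibrations `J`. -/
structure IsCofibrantlyGeneratedBy (I J : MorphismProperty C) : Prop where
  isSmall_cof : MorphismProperty.IsSmall.{0} I
  isSmall_trivCof : MorphismProperty.IsSmall.{0} J
  small_cof : ∀ ⦃A B : C⦄ (f : A ⟶ B), I f → IsSmallRel A (relCell I)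
  small_trivCof : ∀ ⦃A B : C⦄ (f : A ⟶ B), J f → IsSmallRel A (relCell J)
  fibrations_eq : fibrations C = J.rlp
  trivialFibrations_eq : trivialFibrations C = I.rlp

/-- Left and right properness. -/
structure IsProperModel : Prop where
  left : ∀ ⦃X Y X' Y' : C⦄ (f : X ⟶ Y) (i : X ⟶ X') (i' : Y ⟶ Y') (f' : X' ⟶ Y'),
    IsPushout f i i' f' → WeakEquivalence f → Cofibration i → WeakEquivalence f'
  right : ∀ ⦃X Y X' Y' : C⦄ (f' : X' ⟶ Y') (p' : X' ⟶ X) (p : Y' ⟶ Y) (f : X ⟶ Y),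
    IsPullback f' p' p f → WeakEquivalence f → Fibration p → WeakEquivalence f'

variable [MonoidalCategory C] [SymmetricCategory C]

/-- The (symmetric) monoidal model category axioms: the monoidal structure is closed, the
pushout-product axiom holds, and tensoring a cofibrant object with a cofibrant replacement of the
unit is a weak equivalence. -/
structure IsMonoidalModel : Prop where
  closed : Nonempty (MonoidalClosed C)
  pushoutProduct_cof : ∀ ⦃X₁ X₂ Y₁ Y₂ : C⦄ (i : X₁ ⟶ X₂) (j : Y₁ ⟶ Y₂)
    (sq : (curriedTensor C).PushoutObjObj i j), Cofibration i → Cofibration j → Cofibration sq.ι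
  pushoutProduct_weq : ∀ ⦃X₁ X₂ Y₁ Y₂ : C⦄ (i : X₁ ⟶ X₂) (j : Y₁ ⟶ Y₂)
    (sq : (curriedTensor C).PushoutObjObj i j), Cofibration i → Cofibration j →
      WeakEquivalence i ∨ WeakEquivalence j → WeakEquivalence sq.ι
  unit_left : ∀ ⦃Q : C⦄ (q : Q ⟶ 𝟙_ C) (X : C), IsCofibrant Q → WeakEquivalence q →
    IsCofibrant X → WeakEquivalence (q ▷ X)
  unit_right : ∀ ⦃Q : C⦄ (q : Q ⟶ 𝟙_ C) (X : C), IsCofibrant Q → WeakEquivalence q →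
    IsCofibrant X → WeakEquivalence (X ◁ q)

/-- The class of maps `j ⊗ Z` with `j` a trivial cofibration and `Z` any object. -/
inductive trivCofTensor : MorphismProperty C
  | whiskerRight {X Y : C} (j : X ⟶ Y) (Z : C) (hj : trivialCofibrations C j) :
    trivCofTensor (j ▷ Z)

/-- The monoid axiom: transfinite compositions of pushouts of maps `j ⊗ Z`, with `j` a trivial
cofibration, are weak equivalences. -/
def MonoidAxiom : Prop := relCell (trivCofTensor C) ≤ weakEquivalences C

end ModelPredicates

end DihedralModel

end

/-! The argument works on stalks, where linear algebra over `ℚ` makes everything split, and then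
controls how the stalk at `∞` interacts with almost all the other stalks.

On stalks: an injection of complexes of rational vector spaces lifts against every surjective
quasi-isomorphism (`DgQ.hasLiftingProperty_of_mono`), because linear maps can be chosen on cycles
and then extended. An injective quasi-isomorphism is a retract of some `A ⟶ A ⊞ P` with `P`
contractible (`DgQ.retractArrowPath`), hence lifts against surjections and stays a quasi-isomorphism
after tensoring. Since `2` is invertible, averaging over `W` turns lifts of complexes into
equivariant lifts.

Gluing: a map from `c M` to `X` is a family of maps on stalks subject to one condition on germs. If
`M` is finitely presentable, its maps to germs are represented on a tail. So a lift chosen at `∞`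
prescribes lifts at almost all `k`, and the finitely many other `k` are free
(`hasLiftingProperty_constAD`); conversely, any lifting problem at `∞` extends to one for constant
objects (`hasLiftingProperty_left`). Skyscrapers are handled by the adjunction of `i_k` with the
stalk at `k`. This gives `genCof_rlp` and `genTrivCof_rlp`.

Model structure: the domains of `I` and `J` are `ℵ₁`-presentable, as a map out of a constant object
has countably many components, so the small object argument applies. Stalks are left adjoint to
functors preserving fibrations and acyclic fibrations; hence cofibrations are injective on stalks,
and maps generated by `J` are stalkwise quasi-isomorphisms. The retract argument then gives
`genTrivCof_rlp_llp`.

Germs do not preserve infinite limits, so limits and internal homs of `AD` come from a special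
adjoint functor theorem, fed by a small separating and a small codetecting set. The pushout-product
axiom is checked on generators for cofibrations and on stalks for weak equivalences. Properness and
the monoid axiom are also stalkwise statements about injections, surjections and flat complexes. -/

open CategoryTheory Limits
open scoped MonoidalCategory

noncomputable section

namespace DihedralModel

/-! ### Linear choices over `ℚ` -/

section LinearAlgebra

variable {A B C : Type*} [AddCommGroup A] [AddCommGroup B] [AddCommGroup C]
  [Module ℚ A] [Module ℚ B] [Module ℚ C]

/-- A linear map between vector spaces lifts along any map that hits its values. -/
lemma exists_linear_lift (φ : B →ₗ[ℚ] C) (ψ : A →ₗ[ℚ] C) (h : ∀ a, ∃ b, φ b = ψ a) :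
    ∃ g : A →ₗ[ℚ] B, ∀ a, φ (g a) = ψ a := by
  have h' : ∀ a, ψ a ∈ LinearMap.range φ := fun a ↦ h a
  obtain ⟨g, hg⟩ := Module.projective_lifting_property φ.rangeRestrict (ψ.codRestrict _ h')
    φ.surjective_rangeRestrict
  exact ⟨g, fun a ↦ congrArg Subtype.val (LinearMap.congr_fun hg a)⟩

end LinearAlgebra

/-! ### Homology and lifting in terms of elements -/

namespace DgQ

open HomologicalComplex

variable {K L : DgQ} (f : K ⟶ L)

lemma prev_eq {i j : ℤ} (h : j + 1 = i) : (ComplexShape.down ℤ).prev j = i :=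
  (ComplexShape.down ℤ).prev_eq' h

lemma next_eq {i j : ℤ} (h : j + 1 = i) : (ComplexShape.down ℤ).next i = j :=
  (ComplexShape.down ℤ).next_eq' h

lemma d_d_apply (i j k : ℤ) (x : K.X i) : K.d j k (K.d i j x) = 0 := by
  rw [← ModuleCat.comp_apply, K.d_comp_d]; rfl

lemma f_d_apply (i j : ℤ) (x : K.X i) : f.f j (K.d i j x) = L.d i j (f.f i x) := by
  rw [← ModuleCat.comp_apply, ← ModuleCat.comp_apply, f.comm]

/-- A vector of a rational vector space, as a map from `ℚ`. -/
abbrev vec {M : VectQ} (x : M) : ModuleCat.of ℚ ℚ ⟶ M :=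
  ModuleCat.ofHom (LinearMap.toSpanSingleton ℚ M x)

lemma vec_one {M : VectQ} (x : M) : vec x (1 : ℚ) = x := by
  change LinearMap.toSpanSingleton ℚ M x 1 = x
  simp

lemma vec_ext {M : VectQ} {f g : ModuleCat.of ℚ ℚ ⟶ M} (h : f (1 : ℚ) = g (1 : ℚ)) : f = g := by
  apply ModuleCat.hom_ext
  exact LinearMap.ext_ring h

/-- Exactness up to refinements becomes a statement about elements: testing on `ℚ` extracts
elements, and conversely primitives can be chosen linearly, so that the identity serves as
refinement. -/
lemma mono_homologyMap_iff {i j k : ℤ} (hi : j + 1 = i) (hk : k + 1 = j) :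
    Mono (homologyMap f j) ↔ ∀ (x : K.X j) (y : L.X i), K.d j k x = 0 → f.f j x = L.d i j y →
      ∃ z : K.X i, K.d i j z = x := by
  rw [mono_homologyMap_iff_up_to_refinements f i j k (prev_eq hi) (next_eq hk)]
  constructor
  · intro h x y hx hy
    obtain ⟨A', π, hπ, x₁, hx₁⟩ := h (vec x)
      (vec_ext (by rw [ModuleCat.comp_apply, vec_one, hx]; rfl)) (vec y)
      (vec_ext (by rw [ModuleCat.comp_apply, ModuleCat.comp_apply, vec_one, vec_one, hy]))
    obtain ⟨a, ha⟩ := (ModuleCat.epi_iff_surjective π).1 hπ (1 : ℚ)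
    refine ⟨x₁ a, ?_⟩
    have := congrArg (fun φ ↦ φ a) hx₁
    simp only [ModuleCat.comp_apply] at this
    rw [← this]
    exact (congrArg _ ha).trans (vec_one x)
  · intro h A x₂ hx₂ y₁ hy₁
    obtain ⟨g, hg⟩ := exists_linear_lift (K.d i j).hom x₂.hom fun a ↦
      h (x₂ a) (y₁ a) (by rw [← ModuleCat.comp_apply, hx₂]; rfl)
        (by rw [← ModuleCat.comp_apply, hy₁]; rfl)
    exact ⟨A, 𝟙 A, inferInstance, ModuleCat.ofHom g, by
      ext a
      exact (hg a).symm⟩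

lemma epi_homologyMap_iff {i j k : ℤ} (hi : j + 1 = i) (hk : k + 1 = j) :
    Epi (homologyMap f j) ↔ ∀ (y : L.X j), L.d j k y = 0 →
      ∃ (x : K.X j) (w : L.X i), K.d j k x = 0 ∧ f.f j x + L.d i j w = y := by
  rw [epi_homologyMap_iff_up_to_refinements f i j k (prev_eq hi) (next_eq hk)]
  constructor
  · intro h y hy
    obtain ⟨A', π, hπ, x₂, hx₂, y₁, hy₁⟩ := h (vec y)
      (vec_ext (by rw [ModuleCat.comp_apply, vec_one, hy]; rfl))
    obtain ⟨a, ha⟩ := (ModuleCat.epi_iff_surjective π).1 hπ (1 : ℚ)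
    refine ⟨x₂ a, y₁ a, ?_, ?_⟩
    · rw [← ModuleCat.comp_apply, hx₂]; rfl
    · have := congrArg (fun φ ↦ φ a) hy₁
      refine this.symm.trans ?_
      rw [ModuleCat.comp_apply, ha]
      exact vec_one y
  · intro h A y₂ hy₂
    have hy (a : A) : L.d j k (y₂ a) = 0 := by rw [← ModuleCat.comp_apply, hy₂]; rfl
    -- The cycle and the chain bounding the difference are chosen together, as one linear lift along
    -- `φ`.
    let φ : (LinearMap.ker (K.d j k).hom × L.X i) →ₗ[ℚ] L.X j :=
      LinearMap.coprod ((f.f j).hom ∘ₗ Submodule.subtype _) (L.d i j).hom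
    obtain ⟨g, hg⟩ := exists_linear_lift φ y₂.hom fun a ↦ by
      obtain ⟨x, w, hx, hw⟩ := h (y₂ a) (hy a)
      exact ⟨(⟨x, hx⟩, w), hw⟩
    refine ⟨A, 𝟙 A, inferInstance,
      ModuleCat.ofHom (Submodule.subtype _ ∘ₗ LinearMap.fst ℚ _ _ ∘ₗ g), ?_,
      ModuleCat.ofHom (LinearMap.snd ℚ _ _ ∘ₗ g), ?_⟩
    · ext a
      exact (g a).1.2
    · ext a
      exact (hg a).symm

/-- The elementwise form of the right lifting property with respect to `S^{n-1} ⟶ D^n`. -/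
def HasElementLifts : Prop :=
  ∀ (i j : ℤ), j + 1 = i → ∀ (x : K.X j) (y : L.X i), (∀ k, K.d j k x = 0) →
    f.f j x = L.d i j y → ∃ z : K.X i, K.d i j z = x ∧ f.f i z = y

lemma d_eq_zero_of {j k : ℤ} (h : k + 1 = j) {x : K.X j} (hx : K.d j k x = 0) (l : ℤ) :
    K.d j l x = 0 := by
  by_cases hl : l + 1 = j
  · obtain rfl : l = k := by lia
    exact hx
  · rw [K.shape j l hl]; rfl

variable {f}

/-- This is the case `x = 0` of the lifting property. -/
lemma HasElementLifts.cycle (h : HasElementLifts f) {j : ℤ} (y : L.X j)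
    (hy : ∀ k, L.d j k y = 0) : ∃ x : K.X j, (∀ k, K.d j k x = 0) ∧ f.f j x = y := by
  obtain ⟨z, hz, hz'⟩ := h j (j - 1) (by lia) 0 y (fun _ ↦ map_zero _)
    (by rw [map_zero, hy])
  exact ⟨z, fun k ↦ d_eq_zero_of (k := j - 1) (by lia) hz k, hz'⟩

/-- The boundary of `y` is a cycle, so it lifts to a cycle `x`; then `y` lifts to a chain with
boundary `x`. -/
lemma HasElementLifts.fibQ (h : HasElementLifts f) : fibQ f := fun i y ↦ by
  obtain ⟨x, hx, hx'⟩ := h.cycle (L.d i (i - 1) y) (fun k ↦ d_d_apply _ _ _ _)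
  obtain ⟨z, -, hz⟩ := h i (i - 1) (by lia) x y hx hx'
  exact ⟨z, hz⟩

lemma HasElementLifts.weqQ (h : HasElementLifts f) : weqQ f := by
  refine ⟨fun j ↦ ?_⟩
  rw [quasiIsoAt_iff_isIso_homologyMap]
  have : Mono (homologyMap f j) := by
    rw [mono_homologyMap_iff (i := j + 1) (k := j - 1) f (by lia) (by lia)]
    intro x y hx hy
    obtain ⟨z, hz, -⟩ := h (j + 1) j rfl x y
      (fun k ↦ d_eq_zero_of (k := j - 1) (by lia) hx k) hy
    exact ⟨z, hz⟩
  have : Epi (homologyMap f j) := by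
    rw [epi_homologyMap_iff (i := j + 1) (k := j - 1) f (by lia) (by lia)]
    intro y hy
    obtain ⟨x, hx, hx'⟩ := h.cycle y (fun k ↦ d_eq_zero_of (k := j - 1) (by lia) hy k)
    exact ⟨x, 0, hx _, by rw [hx', map_zero, add_zero]⟩
  exact isIso_of_mono_of_epi _

/-- Injectivity on homology gives some `z₀` with boundary `x`. The defect `y - f z₀` is a cycle;
surjectivity on homology writes it as the image of a cycle `c` plus a boundary `d w`, and `w` lifts
because `f` is surjective. -/
lemma hasElementLifts_of (h₁ : DihedralModel.fibQ f) (h₂ : DihedralModel.weqQ f) :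
    HasElementLifts f := by
  have h₃ (j : ℤ) : IsIso (homologyMap f j) := by
    rw [← quasiIsoAt_iff_isIso_homologyMap]
    exact h₂.quasiIsoAt j
  rintro i j hij x y hx hy
  obtain ⟨z₀, hz₀⟩ := (mono_homologyMap_iff (i := i) (k := j - 1) f hij (by lia)).1
    inferInstance x y (hx _) hy
  obtain ⟨c, w, hc, hw⟩ := (epi_homologyMap_iff (i := i + 1) (k := j) f rfl hij).1
    inferInstance (y - f.f i z₀) (by rw [map_sub, ← f_d_apply, hz₀, hy, sub_self])
  obtain ⟨w', rfl⟩ := h₁ _ w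
  refine ⟨z₀ + c + K.d (i + 1) i w', ?_, ?_⟩
  · rw [map_add, map_add, hc, d_d_apply, hz₀, add_zero, add_zero]
  · rw [map_add, map_add, f_d_apply, add_assoc, hw, add_sub_cancel]

lemma mono_iff {f : K ⟶ L} : Mono f ↔ ∀ n, Function.Injective (f.f n) := by
  simp only [← ModuleCat.mono_iff_injective]
  exact ⟨fun _ n ↦ inferInstanceAs (Mono ((eval VectQ _ n).map f)),
    fun h ↦ mono_of_mono_f _ h⟩

lemma epi_iff {f : K ⟶ L} : Epi f ↔ DihedralModel.fibQ f := by
  simp only [DihedralModel.fibQ, ← ModuleCat.epi_iff_surjective]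
  exact ⟨fun _ n ↦ inferInstanceAs (Epi ((eval VectQ _ n).map f)),
    fun h ↦ epi_of_epi_f _ h⟩

/-- The cycles in degree `n`, as a subspace. -/
def cyc (K : DgQ) (n : ℤ) : Submodule ℚ (K.X n) := LinearMap.ker (K.d n (n - 1)).hom

lemma mem_cyc {n : ℤ} {x : K.X n} : x ∈ cyc K n ↔ K.d n (n - 1) x = 0 := Iff.rfl

lemma d_mem_cyc (m n : ℤ) (x : K.X m) : K.d m n x ∈ cyc K n := d_d_apply _ _ _ _

lemma cyc_d_eq_zero {n : ℤ} {x : K.X n} (hx : x ∈ cyc K n) (k : ℤ) : K.d n k x = 0 :=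
  d_eq_zero_of (k := n - 1) (by lia) hx k

end DgQ

/-! ### Injections lift against surjective quasi-isomorphisms -/

section LinearAlgebra

variable {A B C : Type*} [AddCommGroup A] [AddCommGroup B] [AddCommGroup C]
  [Module ℚ A] [Module ℚ B] [Module ℚ C]

/-- Extension of a linear map from a subspace, subject to a condition given by linear maps. -/
lemma exists_linear_extension (S : Submodule ℚ A) (φ : B →ₗ[ℚ] C) (ψ : A →ₗ[ℚ] C)
    (u : S →ₗ[ℚ] B) (hu : ∀ s, φ (u s) = ψ s) (h : ∀ a, ∃ b, φ b = ψ a) :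
    ∃ g : A →ₗ[ℚ] B, (∀ a, φ (g a) = ψ a) ∧ ∀ s : S, g s = u s := by
  obtain ⟨g₀, hg₀⟩ := exists_linear_lift φ ψ h
  obtain ⟨T, hT⟩ := S.exists_isCompl
  obtain ⟨p, hp⟩ : ∃ p : A →ₗ[ℚ] S, ∀ s : S, p s = s :=
    ⟨S.projectionOnto T hT, fun s ↦ Submodule.projectionOnto_apply_left hT s⟩
  -- Use `u` on `S` and an arbitrary solution `g₀` on a complement.
  refine ⟨u ∘ₗ p + g₀ ∘ₗ (LinearMap.id - S.subtype ∘ₗ p), fun a ↦ ?_, fun s ↦ ?_⟩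
  · simp [hu, hg₀]
  · simp [hp]

end LinearAlgebra

namespace DgQ

open HomologicalComplex

/-- Over `ℚ`, injections have the left lifting property with respect to surjective
quasi-isomorphisms. -/
theorem hasLiftingProperty_of_mono {A B K L : DgQ} (i : A ⟶ B) (p : K ⟶ L) [Mono i]
    (hp : HasElementLifts p) : HasLiftingProperty i p := by
  have hi := mono_iff.1 (inferInstance : Mono i)
  refine ⟨fun {u v} sq ↦ ?_⟩
  have w (n : ℤ) (a : A.X n) : p.f n (u.f n a) = v.f n (i.f n a) := by
    have := congrArg (fun φ ↦ φ.f n a) sq.w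
    exact this
  -- the lift on cycles
  have h₁ (n : ℤ) : ∃ g : cyc B n →ₗ[ℚ] cyc K n, (∀ b, p.f n (g b) = v.f n b) ∧
      ∀ (a : A.X n) (ha : i.f n a ∈ cyc B n), (g ⟨_, ha⟩ : K.X n) = u.f n a := by
    -- The cycles of `B` coming from `A`, where the lift is forced by `u`.
    let S : Submodule ℚ (cyc B n) :=
      (LinearMap.range (i.f n).hom).comap (cyc B n).subtype
    have hS (s : S) : ∃ a : A.X n, i.f n a = s.1.1 := s.2
    obtain ⟨r, hr⟩ := exists_linear_lift (i.f n).hom ((cyc B n).subtype ∘ₗ S.subtype) hS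
    have hc (s : S) : u.f n (r s) ∈ cyc K n := by
      rw [mem_cyc, ← f_d_apply]
      have : A.d n (n - 1) (r s) = 0 := hi _ (by
        rw [f_d_apply, map_zero]
        exact (congrArg _ (hr s)).trans s.1.2)
      rw [this, map_zero]
    obtain ⟨g, hg, hg'⟩ := exists_linear_extension S ((p.f n).hom ∘ₗ (cyc K n).subtype)
      ((v.f n).hom ∘ₗ (cyc B n).subtype) (((u.f n).hom ∘ₗ r).codRestrict _ hc)
      (fun s ↦ (w n (r s)).trans (congrArg _ (hr s))) (fun b ↦ by
        obtain ⟨x, hx, hx'⟩ := hp.cycle (v.f n b.1) (fun k ↦ by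
          rw [← f_d_apply, cyc_d_eq_zero b.2, map_zero])
        exact ⟨⟨x, hx _⟩, hx'⟩)
    refine ⟨g, hg, fun a ha ↦ ?_⟩
    have := congrArg Subtype.val (hg' ⟨⟨_, ha⟩, ⟨a, rfl⟩⟩)
    refine this.trans ?_
    change u.f n (r _) = _
    congr 1
    exact hi _ (hr _)
  choose g hg hg' using h₁
  -- the lift in each degree
  have h₂ (n : ℤ) : ∃ h : B.X n →ₗ[ℚ] K.X n, (∀ b, p.f n (h b) = v.f n b) ∧
      (∀ b, K.d n (n - 1) (h b) = g (n - 1) ⟨B.d n (n - 1) b, d_mem_cyc _ _ _⟩) ∧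
      (∀ a, h (i.f n a) = u.f n a) ∧ ∀ b : cyc B n, h b = g n b := by
    -- On `S` the lift is forced by `u` on the image of `A` and by `g` on cycles. The two
    -- requirements `p h = v` and `d h = g d` are encoded as the single linear equation `φ h = ψ`.
    let S : Submodule ℚ (B.X n) := LinearMap.range (i.f n).hom ⊔ cyc B n
    let D : B.X n →ₗ[ℚ] K.X (n - 1) := (cyc K (n - 1)).subtype ∘ₗ g (n - 1) ∘ₗ
      (B.d n (n - 1)).hom.codRestrict _ (d_mem_cyc n (n - 1))
    let φ : K.X n →ₗ[ℚ] L.X n × K.X (n - 1) := (p.f n).hom.prod (K.d n (n - 1)).hom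
    let ψ : B.X n →ₗ[ℚ] L.X n × K.X (n - 1) := (v.f n).hom.prod D
    have hD (a : A.X n) : D (i.f n a) = K.d n (n - 1) (u.f n a) := by
      have e : B.d n (n - 1) (i.f n a) = i.f (n - 1) (A.d n (n - 1) a) := (f_d_apply i _ _ a).symm
      have : (⟨B.d n (n - 1) (i.f n a), d_mem_cyc _ _ _⟩ : cyc B (n - 1)) =
          ⟨i.f (n - 1) (A.d n (n - 1) a), e ▸ d_mem_cyc _ _ _⟩ := Subtype.ext e
      change (g (n - 1) ⟨B.d n (n - 1) (i.f n a), d_mem_cyc _ _ _⟩ : K.X (n - 1)) = _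
      rw [this, hg' (n - 1), f_d_apply]
    have hD' (b : cyc B n) : D b = 0 := by
      have : (⟨B.d n (n - 1) b, d_mem_cyc _ _ _⟩ : cyc B (n - 1)) = 0 := Subtype.ext b.2
      change (g (n - 1) ⟨B.d n (n - 1) b, d_mem_cyc _ _ _⟩ : K.X (n - 1)) = 0
      rw [this, map_zero]; rfl
    -- the values on `S` given by `u` and `g`
    let q : A.X n × cyc B n →ₗ[ℚ] B.X n := LinearMap.coprod (i.f n).hom (cyc B n).subtype
    have hq (s : S) : ∃ t, q t = s.1 := by
      obtain ⟨y, ⟨a, rfl⟩, z, hz, h⟩ := Submodule.mem_sup.1 s.2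
      exact ⟨(a, ⟨z, hz⟩), h⟩
    obtain ⟨r, hr⟩ := exists_linear_lift q S.subtype hq
    let U : A.X n × cyc B n →ₗ[ℚ] K.X n :=
      LinearMap.coprod (u.f n).hom ((cyc K n).subtype ∘ₗ g n)
    -- The prescribed values agree on the overlap, since `g` equals `u` on the cycles that come from
    -- `A`.
    have hU (t t' : A.X n × cyc B n) (h : q t = q t') : U t = U t' := by
      rw [← sub_eq_zero, ← map_sub] at h ⊢
      obtain ⟨⟨a, b⟩, ht⟩ : ∃ s, s = t - t' := ⟨_, rfl⟩
      rw [← ht] at h ⊢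
      have h' : i.f n a + b.1 = 0 := h
      have hb : i.f n (-a) = b.1 := by rw [map_neg]; exact (neg_eq_of_add_eq_zero_right h')
      have := hg' n (-a) (hb ▸ b.2)
      have e : (⟨i.f n (-a), hb ▸ b.2⟩ : cyc B n) = b := Subtype.ext hb
      rw [e] at this
      change u.f n a + (g n b : K.X n) = 0
      rw [this, map_neg, add_neg_cancel]
    have hUφ (t) : φ (U t) = ψ (q t) := by
      obtain ⟨a, b⟩ := t
      change (p.f n (u.f n a + (g n b : K.X n)), K.d n (n - 1) (u.f n a + (g n b : K.X n))) =
        (v.f n (i.f n a + b.1), D (i.f n a + b.1))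
      rw [map_add, map_add, map_add, map_add, hD, hD', w, hg]
      have : K.d n (n - 1) (g n b : K.X n) = 0 := (g n b).2
      rw [this]
    obtain ⟨h, hh, hh'⟩ := exists_linear_extension S φ ψ (U ∘ₗ r)
      (fun s ↦ (hUφ (r s)).trans (congrArg ψ (hr s))) (fun b ↦ by
        obtain ⟨z, hz, hz'⟩ := hp n (n - 1) (by lia) (D b) (v.f n b)
          (fun k ↦ cyc_d_eq_zero (g (n - 1) _).2 k) (by
            rw [← f_d_apply]
            exact hg (n - 1) ⟨B.d n (n - 1) b, d_mem_cyc _ _ _⟩)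
        exact ⟨z, Prod.ext hz' hz⟩)
    refine ⟨h, fun b ↦ congrArg Prod.fst (hh b), fun b ↦ congrArg Prod.snd (hh b),
      fun a ↦ ?_, fun b ↦ ?_⟩
    · have hs : i.f n a ∈ S := Submodule.mem_sup_left ⟨a, rfl⟩
      refine (hh' ⟨_, hs⟩).trans ?_
      refine (hU (r ⟨_, hs⟩) (a, 0) ((hr _).trans ?_)).trans ?_
      · change _ = i.f n a + 0
        rw [add_zero]; rfl
      · change u.f n a + (g n 0 : K.X n) = _
        rw [map_zero]; exact add_zero _
    · have hs : b.1 ∈ S := Submodule.mem_sup_right b.2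
      refine (hh' ⟨_, hs⟩).trans ?_
      refine (hU (r ⟨_, hs⟩) (0, b) ((hr _).trans ?_)).trans ?_
      · change _ = i.f n 0 + b.1
        rw [map_zero, zero_add]; rfl
      · change u.f n 0 + (g n b : K.X n) = _
        rw [map_zero, zero_add]
  choose h hv hd hu hc using h₂
  refine ⟨⟨⟨{ f := fun n ↦ ModuleCat.ofHom (h n), comm' := ?_ }, ?_, ?_⟩⟩⟩
  · rintro m n hmn
    obtain rfl : n = m - 1 := by
      have : n + 1 = m := hmn
      lia
    ext b
    change K.d m (m - 1) (h m b) = h (m - 1) (B.d m (m - 1) b)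
    rw [hd]
    -- A boundary is a cycle, and on cycles `h` is `g`; so `d h = g d` says that `h` is a chain map.
    exact (hc (m - 1) ⟨_, d_mem_cyc _ _ _⟩).symm
  · ext n a
    exact hu n a
  · ext n b
    exact hv n b

end DgQ

end DihedralModel

end

/-! ### Averaging over `W` -/

open CategoryTheory Limits
open scoped MonoidalCategory

noncomputable section

namespace DihedralModel

namespace DgQW

variable {A B : DgQW}

/-- The average of a map over the action of `W`. -/
def average (h : A.V ⟶ B.V) : A ⟶ B where
  hom := (1 / 2 : ℚ) • ∑ g : W₂, A.ρ g⁻¹ ≫ h ≫ B.ρ g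
  comm k := by
    rw [Linear.comp_smul, Linear.smul_comp, Preadditive.comp_sum, Preadditive.sum_comp]
    congr 1
    refine Fintype.sum_equiv (Equiv.mulLeft k⁻¹) _ _ fun g ↦ ?_
    have h₁ : A.ρ k ≫ A.ρ g⁻¹ = A.ρ (k⁻¹ * g)⁻¹ := by
      rw [mul_inv_rev, inv_inv, map_mul]; rfl
    have h₂ : B.ρ (k⁻¹ * g) ≫ B.ρ k = B.ρ g := by
      change B.ρ k * B.ρ (k⁻¹ * g) = _
      rw [← map_mul, mul_inv_cancel_left]
    simp only [Equiv.coe_mulLeft, Category.assoc]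
    rw [h₂, reassoc_of% h₁]

lemma average_hom (f : A ⟶ B) : average f.hom = f := by
  ext : 1
  change (1 / 2 : ℚ) • ∑ g : W₂, A.ρ g⁻¹ ≫ f.hom ≫ B.ρ g = f.hom
  have h (g : W₂) : A.ρ g⁻¹ ≫ f.hom ≫ B.ρ g = f.hom := by
    rw [← f.comm g, ← Category.assoc]
    have : A.ρ g⁻¹ ≫ A.ρ g = 𝟙 _ := by
      change A.ρ g * A.ρ g⁻¹ = 𝟙 _
      rw [← map_mul, mul_inv_cancel, map_one]; rfl
    rw [this, Category.id_comp]
  simp only [h, Finset.sum_const, Finset.card_univ]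
  rw [show Fintype.card W₂ = 2 from rfl, ← Nat.cast_smul_eq_nsmul ℚ, smul_smul]
  norm_num

lemma comp_average {A' : DgQW} (f : A' ⟶ A) (h : A.V ⟶ B.V) :
    f ≫ average h = average (f.hom ≫ h) := by
  ext : 1
  change f.hom ≫ ((1 / 2 : ℚ) • ∑ g : W₂, _) = (1 / 2 : ℚ) • ∑ g : W₂, _
  rw [Linear.comp_smul, Preadditive.comp_sum]
  simp only [Category.assoc, ← Action.Hom.comm_assoc]

lemma average_comp {B' : DgQW} (h : A.V ⟶ B.V) (f : B ⟶ B') :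
    average h ≫ f = average (h ≫ f.hom) := by
  ext : 1
  change ((1 / 2 : ℚ) • ∑ g : W₂, _) ≫ f.hom = (1 / 2 : ℚ) • ∑ g : W₂, _
  rw [Linear.smul_comp, Preadditive.sum_comp]
  simp only [Category.assoc, Action.Hom.comm]

/-- The average of a non-equivariant lift is still a lift: averaging commutes with composition with
equivariant maps and fixes them. -/
lemma hasLiftingProperty_of_hom {A B X Y : DgQW} (i : A ⟶ B) (p : X ⟶ Y)
    [HasLiftingProperty i.hom p.hom] : HasLiftingProperty i p where
  sq_hasLift {u v} sq := by
    have sq' : CommSq u.hom i.hom p.hom v.hom := ⟨congrArg Action.Hom.hom sq.w⟩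
    exact ⟨⟨⟨average sq'.lift, by rw [comp_average, sq'.fac_left, average_hom],
      by rw [average_comp, sq'.fac_right, average_hom]⟩⟩⟩

lemma mono_iff {i : A ⟶ B} : Mono i ↔ Mono i.hom :=
  ⟨fun _ ↦ inferInstanceAs (Mono ((Action.forget DgQ W₂).map i)),
    fun h ↦ (Action.forget DgQ W₂).mono_of_mono_map h⟩

lemma epi_iff {i : A ⟶ B} : Epi i ↔ fibQW i := by
  refine Iff.trans ?_ DgQ.epi_iff
  exact ⟨fun _ ↦ inferInstanceAs (Epi ((Action.forget DgQ W₂).map i)),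
    fun h ↦ (Action.forget DgQ W₂).epi_of_epi_map h⟩

lemma hasLiftingProperty_of_mono {A B X Y : DgQW} (i : A ⟶ B) (p : X ⟶ Y) [Mono i]
    (hp : DgQ.HasElementLifts p.hom) : HasLiftingProperty i p := by
  have := mono_iff.1 (inferInstance : Mono i)
  have := DgQ.hasLiftingProperty_of_mono i.hom p.hom hp
  exact hasLiftingProperty_of_hom i p

end DgQW

/-! ### Contractible complexes -/

namespace DgQ

open HomologicalComplex

/-- Contractible complexes. -/
def Contractible (K : DgQ) : Prop := Nonempty (Homotopy (𝟙 K) 0)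

/-- Choose a linear section `s` of `d` over the cycles. Then `π x = x - s (d x)` projects onto the
cycles and `s ∘ π` is a contracting homotopy. -/
lemma contractible_of_exact {K : DgQ}
    (h : ∀ i j : ℤ, j + 1 = i → ∀ x : K.X j, (∀ k, K.d j k x = 0) → ∃ z, K.d i j z = x) :
    Contractible K := by
  have h₁ (i j : ℤ) (hij : j + 1 = i) : ∃ s : cyc K j →ₗ[ℚ] K.X i, ∀ x, K.d i j (s x) = x :=
    exists_linear_lift (K.d i j).hom (cyc K j).subtype
      fun x ↦ h i j hij x (fun k ↦ cyc_d_eq_zero x.2 k)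
  choose s hs using h₁
  let π (i j : ℤ) (hij : j + 1 = i) : K.X i →ₗ[ℚ] cyc K i :=
    (LinearMap.id - s i j hij ∘ₗ (K.d i j).hom.codRestrict _ (d_mem_cyc i j)).codRestrict _ (by
      intro x
      rw [mem_cyc]
      obtain rfl : j = i - 1 := by lia
      change K.d i (i - 1) (x - s i (i - 1) hij _) = 0
      rw [map_sub, hs]
      exact sub_self _)
  let t (j i : ℤ) (hij : (ComplexShape.down ℤ).Rel i j) : K.X j ⟶ K.X i :=
    ModuleCat.ofHom (s i j hij ∘ₗ π j (j - 1) (by lia))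
  have : Homotopy.nullHomotopicMap' t = 𝟙 K := by
    ext n x
    rw [Homotopy.nullHomotopicMap'_f (k₂ := n + 1) (k₁ := n) (k₀ := n - 1) rfl (down_rel n)]
    change s n (n - 1) _ (π (n - 1) (n - 1 - 1) _ (K.d n (n - 1) x)) +
      K.d (n + 1) n (s (n + 1) n _ (π n (n - 1) _ x)) = x
    rw [hs]
    have e : π (n - 1) (n - 1 - 1) (by lia) (K.d n (n - 1) x) =
        ⟨K.d n (n - 1) x, d_mem_cyc _ _ _⟩ := by
      apply Subtype.ext
      change K.d n (n - 1) x - s (n - 1) (n - 1 - 1) _ ⟨K.d (n - 1) (n - 1 - 1) _, _⟩ = _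
      have : (⟨K.d (n - 1) (n - 1 - 1) (K.d n (n - 1) x), d_mem_cyc _ _ _⟩ : cyc K (n - 1 - 1)) = 0 :=
        Subtype.ext (d_d_apply _ _ _ _)
      rw [this, map_zero, sub_zero]
    rw [e]
    change s n (n - 1) _ _ + (x - s n (n - 1) _ ⟨K.d n (n - 1) x, _⟩) = x
    abel
  exact ⟨(Homotopy.ofEq this.symm).trans (Homotopy.nullHomotopy' t)⟩

/-- Maps from contractible complexes lift along surjections. -/
lemma Contractible.exists_lift {P K L : DgQ} (hP : Contractible P) (p : K ⟶ L) (hp : fibQ p)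
    (v : P ⟶ L) : ∃ h : P ⟶ K, h ≫ p = v := by
  obtain ⟨H⟩ := hP
  have hg (n : ℤ) : ∃ g : P.X n ⟶ K.X n, g ≫ p.f n = v.f n := by
    obtain ⟨g, hg⟩ := exists_linear_lift (p.f n).hom (v.f n).hom fun x ↦ hp n (v.f n x)
    exact ⟨ModuleCat.ofHom g, by ext x; exact hg x⟩
  choose g hg using hg
  -- The `g n` lift `v` only degreewise. The null-homotopic map built from `H` followed by `g` is a
  -- chain map, and its composite with `p` is `(d H + H d)` followed by `v`, that is, `v`.
  refine ⟨Homotopy.nullHomotopicMap fun i j ↦ H.hom i j ≫ g j, ?_⟩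
  rw [Homotopy.nullHomotopicMap_comp]
  simp only [Category.assoc, hg]
  rw [← Homotopy.nullHomotopicMap_comp]
  have : Homotopy.nullHomotopicMap H.hom = 𝟙 P := by
    ext n : 1
    have := H.comm n
    rw [zero_f, add_zero] at this
    exact this.symm
  rw [this, Category.id_comp]

lemma Contractible.tensor_left {K : DgQ} (hK : Contractible K) (X : DgQ) :
    Contractible (K ⊗ X) := by
  obtain ⟨H⟩ := hK
  have h := mapBifunctorMapHomotopy₁ H (𝟙 X) (MonoidalCategory.curriedTensor VectQ)
    (ComplexShape.down ℤ)
  refine ⟨(Homotopy.ofEq ?_).trans (h.trans (Homotopy.ofEq ?_))⟩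
  · exact (MonoidalCategory.id_tensorHom_id K X).symm
  · apply HomologicalComplex.hom_ext
    intro n
    apply mapBifunctor.hom_ext
    intro i j hij
    rw [ι_mapBifunctorMap]
    simp

lemma Contractible.of_iso {K L : DgQ} (hK : Contractible K) (e : K ≅ L) : Contractible L := by
  obtain ⟨H⟩ := hK
  exact ⟨(Homotopy.ofEq (by simp)).trans (((H.compLeft e.inv).compRight e.hom).trans
    (Homotopy.ofEq (by simp)))⟩

lemma Contractible.tensor_right {K : DgQ} (hK : Contractible K) (X : DgQ) :
    Contractible (X ⊗ K) :=
  (hK.tensor_left X).of_iso (β_ K X)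

lemma contractible_disc (n : ℤ) (M : VectQ) : Contractible ((disc n).obj M) := by
  apply contractible_of_exact
  intro i j hij x hx
  have hd : IsIso (((disc n).obj M).d n (n - 1)) := by
    change IsIso ((double (𝟙 M) (down_rel n)).d n (n - 1))
    rw [double_d _ _ (ne_sub_one n)]
    infer_instance
  by_cases h₀ : j = n
  · subst h₀
    refine ⟨0, ?_⟩
    have : Function.Injective (((disc j).obj M).d j (j - 1)) :=
      (ModuleCat.mono_iff_injective _).1 inferInstance
    rw [map_zero]
    exact this ((map_zero _).trans (hx _).symm)
  · by_cases h₁ : j = n - 1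
    · subst h₁
      obtain rfl : i = n := by lia
      exact (ModuleCat.epi_iff_surjective _).1 (inferInstance : Epi (((disc i).obj M).d i (i - 1))) x
    · have hz : IsZero (((disc n).obj M).X j) := isZero_double_X (𝟙 M) (down_rel n) j h₀ h₁
      have := ModuleCat.subsingleton_of_isZero hz
      exact ⟨0, Subsingleton.elim _ _⟩

lemma mono_sphereToDisc (n : ℤ) (M : VectQ) : Mono ((sphereToDisc n).app M) := by
  apply mono_of_mono_f
  intro i
  by_cases hi : i = n - 1
  · subst hi
    change Mono ((sphereToDiscApp n M).f (n - 1))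
    rw [sphereToDiscApp, mkHomFromSingle_f]
    infer_instance
  · have : IsZero (((sphere (n - 1)).obj M).X i) := isZero_single_obj_X _ _ _ _ hi
    exact ⟨fun _ _ _ ↦ this.eq_of_tgt _ _⟩

/-- A contractible complex containing the unit. -/
abbrev unitCone : DgQ := (disc 1).obj (ModuleCat.of ℚ ℚ)

/-- The unit, as a subcomplex of a contractible complex. -/
def unitToCone : 𝟙_ DgQ ⟶ unitCone := (sphereToDisc 1).app (ModuleCat.of ℚ ℚ)

instance : Mono unitToCone := mono_sphereToDisc 1 _

/-- A contractible complex that maps onto the unit. -/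
abbrev unitPath : DgQ := (disc 0).obj (ModuleCat.of ℚ ℚ)

/-- The unit, as a quotient of a contractible complex. -/
def pathToUnit : unitPath ⟶ 𝟙_ DgQ :=
  mkHomFromDouble (down_rel 0) (ne_sub_one 0)
    (singleObjXSelf (ComplexShape.down ℤ) 0 (ModuleCat.of ℚ ℚ)).inv 0
    (by
      have : ((single VectQ (ComplexShape.down ℤ) 0).obj (ModuleCat.of ℚ ℚ)).d 0 (0 - 1) = 0 := rfl
      rw [comp_zero]
      exact (congrArg (_ ≫ ·) this).trans comp_zero)
    (fun _ _ ↦ zero_comp)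

instance : Epi pathToUnit := by
  apply epi_of_epi_f
  intro i
  by_cases hi : i = 0
  · subst hi
    rw [pathToUnit, mkHomFromDouble_f₀]
    exact IsIso.epi_of_iso (doubleXIso₀ (𝟙 (ModuleCat.of ℚ ℚ)) (down_rel 0) ≪≫
      (singleObjXSelf (ComplexShape.down ℤ) 0 (ModuleCat.of ℚ ℚ)).symm).hom
  · have : IsZero ((𝟙_ DgQ : DgQ).X i) := isZero_single_obj_X _ _ _ _ hi
    exact ⟨fun _ _ _ ↦ this.eq_of_src _ _⟩

end DgQ

end DihedralModel

end

/-! ### Tensor products of injections, cones and path objects -/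

open CategoryTheory Limits
open scoped MonoidalCategory

noncomputable section

namespace DihedralModel

namespace DgQ

open HomologicalComplex

variable {A B K L X Y : DgQ}

/-- Injections of complexes have retractions as maps of graded vector spaces. -/
lemma exists_graded_retraction (f : A ⟶ B) [Mono f] :
    ∃ r : (B.X : GradedObject ℤ VectQ) ⟶ A.X, (f.f : (A.X : GradedObject ℤ VectQ) ⟶ B.X) ≫ r = 𝟙 _ := by
  have hf := mono_iff.1 (inferInstance : Mono f)
  have (n : ℤ) : ∃ r : B.X n ⟶ A.X n, f.f n ≫ r = 𝟙 _ := by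
    obtain ⟨g, hg⟩ := (f.f n).hom.exists_leftInverse_of_injective (LinearMap.ker_eq_bot.2 (hf n))
    exact ⟨ModuleCat.ofHom g, ModuleCat.hom_ext hg⟩
  choose r hr using this
  exact ⟨r, funext hr⟩

/-- The tensor product of maps of graded vector spaces, in degree `n`. -/
def gradedTensorHom (φ : (A.X : GradedObject ℤ VectQ) ⟶ B.X)
    (ψ : (X.X : GradedObject ℤ VectQ) ⟶ Y.X) (n : ℤ) : (A ⊗ X).X n ⟶ (B ⊗ Y).X n :=
  GradedObject.Monoidal.tensorHom φ ψ n

lemma gradedTensorHom_comp {C Z : DgQ} (φ : (A.X : GradedObject ℤ VectQ) ⟶ B.X)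
    (ψ : (X.X : GradedObject ℤ VectQ) ⟶ Y.X) (φ' : (B.X : GradedObject ℤ VectQ) ⟶ C.X)
    (ψ' : (Y.X : GradedObject ℤ VectQ) ⟶ Z.X) (n : ℤ) :
    gradedTensorHom φ ψ n ≫ gradedTensorHom φ' ψ' n = gradedTensorHom (φ ≫ φ') (ψ ≫ ψ') n :=
  (congrFun (GradedObject.Monoidal.tensorHom_comp_tensorHom φ φ' ψ ψ') n)

lemma gradedTensorHom_id (n : ℤ) :
    gradedTensorHom (𝟙 A.X : (A.X : GradedObject ℤ VectQ) ⟶ A.X)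
      (𝟙 X.X : (X.X : GradedObject ℤ VectQ) ⟶ X.X) n = 𝟙 _ :=
  congrFun (GradedObject.Monoidal.id_tensorHom_id A.X X.X) n

lemma whiskerRight_f (f : A ⟶ B) (X : DgQ) (n : ℤ) :
    (f ▷ X).f n = gradedTensorHom f.f (𝟙 X.X : (X.X : GradedObject ℤ VectQ) ⟶ X.X) n := rfl

lemma whiskerLeft_f (X : DgQ) (f : A ⟶ B) (n : ℤ) :
    (X ◁ f).f n = gradedTensorHom (𝟙 X.X : (X.X : GradedObject ℤ VectQ) ⟶ X.X) f.f n := rfl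

instance mono_whiskerRight (f : A ⟶ B) [Mono f] (X : DgQ) : Mono (f ▷ X) := by
  obtain ⟨r, hr⟩ := exists_graded_retraction f
  refine mono_of_mono_f _ fun n ↦ ?_
  have : (f ▷ X).f n ≫ gradedTensorHom r (𝟙 _) n = 𝟙 _ := by
    rw [whiskerRight_f, gradedTensorHom_comp, hr, Category.comp_id, gradedTensorHom_id]
  exact mono_of_mono_fac this

instance mono_whiskerLeft (f : A ⟶ B) [Mono f] (X : DgQ) : Mono (X ◁ f) := by
  obtain ⟨r, hr⟩ := exists_graded_retraction f
  refine mono_of_mono_f _ fun n ↦ ?_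
  have : (X ◁ f).f n ≫ gradedTensorHom (𝟙 _) r n = 𝟙 _ := by
    rw [whiskerLeft_f, gradedTensorHom_comp, hr, Category.comp_id, gradedTensorHom_id]
  exact mono_of_mono_fac this

/-- The pushout-product of two injections is an injection. -/
lemma mono_pushoutProduct {f : A ⟶ B} {g : X ⟶ Y} [Mono f] [Mono g] {P : DgQ}
    {inl : B ⊗ X ⟶ P} {inr : A ⊗ Y ⟶ P} (sq : IsPushout (f ▷ X) (A ◁ g) inl inr)
    (ι : P ⟶ B ⊗ Y) (hl : inl ≫ ι = B ◁ g) (hr : inr ≫ ι = f ▷ Y) : Mono ι := by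
  obtain ⟨r, hr'⟩ := exists_graded_retraction f
  obtain ⟨s, hs'⟩ := exists_graded_retraction g
  refine mono_of_mono_f _ fun n ↦ ?_
  have sq' := sq.map (eval VectQ (ComplexShape.down ℤ) n)
  -- A degreewise retraction of `ι` by inclusion-exclusion: retract `Y` onto `X`, plus retract `B`
  -- onto `A`, minus both. It need not commute with differentials.
  let ρ : (B ⊗ Y).X n ⟶ P.X n := gradedTensorHom (𝟙 _) s n ≫ inl.f n +
    gradedTensorHom r (𝟙 _) n ≫ inr.f n - gradedTensorHom r s n ≫ (f ▷ X).f n ≫ inl.f n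
  have hw : (A ◁ g).f n ≫ inr.f n = (f ▷ X).f n ≫ inl.f n := sq'.w.symm
  have : ι.f n ≫ ρ = 𝟙 _ := by
    apply sq'.hom_ext
    · change inl.f n ≫ ι.f n ≫ ρ = inl.f n ≫ 𝟙 _
      have h : inl.f n ≫ ι.f n = (B ◁ g).f n := by rw [← hl]; rfl
      rw [reassoc_of% h]
      simp only [ρ, Preadditive.comp_add, Preadditive.comp_sub, whiskerLeft_f]
      rw [← Category.assoc, ← Category.assoc, ← Category.assoc, gradedTensorHom_comp,
        gradedTensorHom_comp, gradedTensorHom_comp, hs']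
      simp only [Category.comp_id, Category.id_comp, gradedTensorHom_id]
      have e : gradedTensorHom r g.f n = gradedTensorHom r (𝟙 X.X : (X.X : GradedObject ℤ VectQ) ⟶ X.X) n ≫ (A ◁ g).f n := by
        rw [whiskerLeft_f, gradedTensorHom_comp, Category.id_comp, Category.comp_id]
      rw [e, Category.assoc, hw, add_sub_cancel_right]
    · change inr.f n ≫ ι.f n ≫ ρ = inr.f n ≫ 𝟙 _
      have h : inr.f n ≫ ι.f n = (f ▷ Y).f n := by rw [← hr]; rfl
      rw [reassoc_of% h]
      simp only [ρ, Preadditive.comp_add, Preadditive.comp_sub, whiskerRight_f f Y]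
      rw [← Category.assoc, ← Category.assoc, ← Category.assoc, gradedTensorHom_comp,
        gradedTensorHom_comp, gradedTensorHom_comp, hr']
      simp only [Category.comp_id, Category.id_comp, gradedTensorHom_id]
      have e : gradedTensorHom f.f s n = gradedTensorHom (𝟙 A.X : (A.X : GradedObject ℤ VectQ) ⟶ A.X) s n ≫ (f ▷ X).f n := by
        rw [whiskerRight_f, gradedTensorHom_comp, Category.id_comp, Category.comp_id]
      rw [e, Category.assoc, add_sub_assoc, add_comm, sub_add_cancel]
  exact mono_of_mono_fac this

section Cones

/-- The embedding of `K` into a contractible complex. -/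
def toCone (K : DgQ) : K ⟶ K ⊗ unitCone := (ρ_ K).inv ≫ K ◁ unitToCone

instance (K : DgQ) : Mono (toCone K) := mono_comp _ _

lemma contractible_cone (K : DgQ) : Contractible (K ⊗ unitCone) :=
  (contractible_disc _ _).tensor_right K

/-- The map from a contractible complex onto `K`. -/
def fromPath (K : DgQ) : K ⊗ unitPath ⟶ K := K ◁ pathToUnit ≫ (ρ_ K).hom

instance (K : DgQ) : Epi (fromPath K) := by
  have : Epi (K ◁ pathToUnit) := inferInstanceAs (Epi ((MonoidalCategory.tensorLeft K).map _))
  exact epi_comp _ _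

lemma contractible_path (K : DgQ) : Contractible (K ⊗ unitPath) :=
  (contractible_disc _ _).tensor_right K

end Cones

/-- The map `s ≫ j` factors through a contractible complex and is null-homotopic, so `q ≫ i` is
homotopic to the identity. Thus `i` is a homotopy equivalence, and tensoring preserves homotopies.
-/
lemma Contractible.weqQ_of_retraction {P : DgQ} (hP : Contractible P) {i : A ⟶ B} {q : B ⟶ A}
    {s : B ⟶ P} {j : P ⟶ B} (hi : i ≫ q = 𝟙 A) (hB : q ≫ i + s ≫ j = 𝟙 B) (X : DgQ) :
    weqQ (i ▷ X) := by
  obtain ⟨H⟩ := hP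
  have h₁ : Homotopy (s ≫ j) 0 := (Homotopy.ofEq (by simp)).trans
    (((H.compLeft s).compRight j).trans (Homotopy.ofEq (by simp)))
  have h₂ : Homotopy (q ≫ i) (𝟙 B) := ((Homotopy.ofEq (by simp)).trans
    ((Homotopy.refl (q ≫ i)).add h₁.symm)).trans (Homotopy.ofEq hB)
  have h₃ := mapBifunctorMapHomotopy₁ h₂ (𝟙 X) (MonoidalCategory.curriedTensor VectQ)
    (ComplexShape.down ℤ)
  let e : HomotopyEquiv (A ⊗ X) (B ⊗ X) :=
    { hom := i ▷ X
      inv := q ▷ X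
      homotopyHomInvId := Homotopy.ofEq (by
        rw [← MonoidalCategory.comp_whiskerRight, hi, MonoidalCategory.id_whiskerRight])
      homotopyInvHomId := (Homotopy.ofEq (by
        rw [← MonoidalCategory.comp_whiskerRight]; rfl)).trans
        (h₃.trans (Homotopy.ofEq (MonoidalCategory.id_whiskerRight B X))) }
  exact homotopyEquivalences_le_quasiIso _ _ _ ⟨e, rfl⟩

end DgQ

end DihedralModel

end

/-! ### Acyclic cofibrations and flatness for complexes -/

open CategoryTheory Limits
open scoped MonoidalCategory

noncomputable section

namespace DihedralModel

instance : weqQ.HasTwoOutOfThreeProperty :=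
  inferInstanceAs (HomologicalComplex.quasiIso VectQ (ComplexShape.down ℤ)).HasTwoOutOfThreeProperty

instance : weqQ.IsStableUnderRetracts :=
  inferInstanceAs (HomologicalComplex.quasiIso VectQ (ComplexShape.down ℤ)).IsStableUnderRetracts

instance : weqQ.RespectsIso :=
  inferInstanceAs (HomologicalComplex.quasiIso VectQ (ComplexShape.down ℤ)).RespectsIso

lemma weqQ_of_isIso {K L : DgQ} (f : K ⟶ L) [IsIso f] : weqQ f :=
  inferInstanceAs (QuasiIso f)

namespace DgQ

open HomologicalComplex

variable {A B K L X Y : DgQ}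

lemma Contractible.weqQ_inl {P : DgQ} (hP : Contractible P) {i : A ⟶ B} {q : B ⟶ A}
    {s : B ⟶ P} {j : P ⟶ B} (hi : i ≫ q = 𝟙 A) (hB : q ≫ i + s ≫ j = 𝟙 B) : weqQ i := by
  refine (weqQ.arrow_mk_iso_iff ?_).1 (hP.weqQ_of_retraction hi hB (𝟙_ _))
  exact Arrow.isoMk (ρ_ A) (ρ_ B) (by simp)

/-- The contracting homotopy sends a cycle to a chain that it bounds. -/
lemma Contractible.hasElementLifts (hK : Contractible K) (hL : IsZero L) (p : K ⟶ L) :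
    HasElementLifts p := by
  obtain ⟨H⟩ := hK
  intro i j hij x y hx _
  have hL' : IsZero (L.X i) := (eval VectQ (ComplexShape.down ℤ) i).map_isZero hL
  have : Subsingleton (L.X i) := ModuleCat.subsingleton_of_isZero hL'
  refine ⟨H.hom j i x, ?_, Subsingleton.elim _ _⟩
  have h := H.comm j
  rw [dNext_eq H.hom (show (ComplexShape.down ℤ).Rel j (j - 1) by simp),
    prevD_eq H.hom (show (ComplexShape.down ℤ).Rel i j from hij)] at h
  have h' := congr($h x)
  simp only [id_f, ModuleCat.id_apply, zero_f, add_zero, ModuleCat.hom_add,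
    LinearMap.add_apply, ModuleCat.hom_comp, LinearMap.comp_apply] at h'
  have h'' := hx (j - 1)
  rw [show (ModuleCat.Hom.hom (K.d j (j - 1))) x = 0 from h'', map_zero, zero_add] at h'
  exact h'.symm

end DgQ

end DihedralModel

namespace CategoryTheory

variable {C : Type*} [Category* C] [Preadditive C] [HasBinaryBiproducts C]

/-- A map with the lifting property against `(f, q) : A ⊞ P ⟶ B` is a retract of `A ⟶ A ⊞ P`. -/
def RetractArrow.ofBiprodDesc {A B P : C} (f : A ⟶ B) (q : P ⟶ B)
    [HasLiftingProperty f (biprod.desc f q)] : RetractArrow f (biprod.inl : A ⟶ A ⊞ P) :=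
  RetractArrow.ofLeftLiftingProperty (p := biprod.desc f q) (by simp)

end CategoryTheory

namespace DihedralModel

open scoped ZeroObject

namespace DgQ

variable {A B K L X Y : DgQ}

lemma fibQ_biprodDesc (f : A ⟶ B) (q : K ⟶ B) [Epi q] : fibQ (biprod.desc f q) :=
  epi_iff.1 (epi_of_epi_fac (biprod.inr_desc f q))

lemma Contractible.weqQ_biprodInl (hK : Contractible K) : weqQ (biprod.inl : A ⟶ A ⊞ K) :=
  hK.weqQ_inl (q := biprod.fst) (s := biprod.snd) (j := biprod.inr) (by simp) (by simp)

/-- On the summand `A` the lift is given, and on the contractible summand it exists along any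
surjection. -/
lemma Contractible.llp_biprodInl (hK : Contractible K) :
    fibQ.llp (biprod.inl : A ⟶ A ⊞ K) := by
  intro U V p hp
  refine ⟨fun {u v} sq ↦ ?_⟩
  obtain ⟨h, hh⟩ := hK.exists_lift p hp (biprod.inr ≫ v)
  exact ⟨⟨⟨biprod.desc u h, by simp, biprod.hom_ext' _ _ (by simp [sq.w]) (by simp [hh])⟩⟩⟩

/-- An injective quasi-isomorphism is a retract of a map `A ⟶ A ⊞ P` with `P` contractible. -/
def retractArrowPath (f : A ⟶ B) [Mono f] (hf : weqQ f) :
    RetractArrow f (biprod.inl : A ⟶ A ⊞ (B ⊗ unitPath)) := by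
  have h : weqQ (biprod.desc f (fromPath B)) :=
    weqQ.of_precomp (biprod.inl : A ⟶ _) _ (contractible_path B).weqQ_biprodInl (by simpa)
  have := hasLiftingProperty_of_mono f _ (hasElementLifts_of (fibQ_biprodDesc f (fromPath B)) h)
  exact RetractArrow.ofBiprodDesc f (fromPath B)

lemma llp_fibQ_of_mono (f : A ⟶ B) [Mono f] (hf : weqQ f) : fibQ.llp f :=
  fibQ.llp.of_retract (retractArrowPath f hf) (contractible_path B).llp_biprodInl

/-- Lifting against the surjection `A ⊞ (B ⊗ unitPath) ⟶ B` exhibits `f` as a retract of the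
inclusion of `A`, whose complement is contractible. -/
lemma weqQ_of_llp {f : A ⟶ B} (hf : fibQ.llp f) : weqQ f := by
  have := hf _ (fibQ_biprodDesc f (fromPath B))
  exact weqQ.of_retract (RetractArrow.ofBiprodDesc f (fromPath B))
    (contractible_path B).weqQ_biprodInl

/-- The map from the cone of `A` to `0` is an acyclic fibration, so the embedding of `A` into its
cone extends along `f`. -/
lemma mono_of_llp {f : A ⟶ B} (hf : (fibQ ⊓ weqQ).llp f) : Mono f := by
  have h := (contractible_cone A).hasElementLifts (isZero_zero DgQ) 0
  have := hf _ ⟨h.fibQ, h.weqQ⟩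
  have sq : CommSq (toCone A) f (0 : A ⊗ unitCone ⟶ 0) 0 := ⟨by simp⟩
  exact mono_of_mono_fac sq.fac_left

lemma weqQ_whiskerRight_of_mono (f : A ⟶ B) [Mono f] (hf : weqQ f) (X : DgQ) : weqQ (f ▷ X) :=
  weqQ.of_retract ((retractArrowPath f hf).map (MonoidalCategory.tensorRight X))
    ((contractible_path B).weqQ_of_retraction (q := biprod.fst) (s := biprod.snd)
      (j := biprod.inr) (by simp) (by simp) X)

/-- Factor `f` as an injection into `B ⊞ (A ⊗ unitCone)` followed by the projection to `B`. The
projection has the injective quasi-isomorphism `biprod.inl` as a section, so both factors reduce to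
the injective case. -/
lemma weqQ_whiskerRight (f : A ⟶ B) (hf : weqQ f) (X : DgQ) : weqQ (f ▷ X) := by
  let a : A ⟶ B ⊞ (A ⊗ unitCone) := biprod.lift f (toCone A)
  have ha : Mono a := mono_of_mono_fac (biprod.lift_snd f (toCone A))
  have h₁ : weqQ (biprod.inl : B ⟶ B ⊞ (A ⊗ unitCone)) := (contractible_cone A).weqQ_biprodInl
  have h₂ : weqQ (biprod.fst : B ⊞ (A ⊗ unitCone) ⟶ B) :=
    weqQ.of_precomp (biprod.inl : B ⟶ _) _ h₁ (by rw [biprod.inl_fst]; exact weqQ_of_isIso _)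
  have h₃ : weqQ ((biprod.inl : B ⟶ B ⊞ (A ⊗ unitCone)) ▷ X) :=
    weqQ_whiskerRight_of_mono _ h₁ X
  have h₄ : weqQ ((biprod.fst : B ⊞ (A ⊗ unitCone) ⟶ B) ▷ X) :=
    weqQ.of_precomp ((biprod.inl : B ⟶ B ⊞ (A ⊗ unitCone)) ▷ X) _ h₃
      (by rw [← MonoidalCategory.comp_whiskerRight, biprod.inl_fst]; exact weqQ_of_isIso _)
  have h₅ : weqQ a := weqQ.of_postcomp a biprod.fst h₂ (by simpa [a] using hf)
  have e : f ▷ X = a ▷ X ≫ biprod.fst ▷ X := by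
    rw [← MonoidalCategory.comp_whiskerRight, biprod.lift_fst]
  rw [e]
  exact weqQ.comp_mem _ _ (weqQ_whiskerRight_of_mono a h₅ X) h₄

lemma weqQ_whiskerLeft (f : A ⟶ B) (hf : weqQ f) (X : DgQ) : weqQ (X ◁ f) :=
  (weqQ.arrow_mk_iso_iff (Arrow.isoMk (β_ X A) (β_ X B) (by simp))).2 (weqQ_whiskerRight f hf X)

/-- The pushout-product of two injections, one of which is a quasi-isomorphism, is a
quasi-isomorphism. -/
lemma weqQ_pushoutProduct {f : A ⟶ B} {g : X ⟶ Y} [Mono f] [Mono g] (h : weqQ f ∨ weqQ g) {P : DgQ}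
    {inl : B ⊗ X ⟶ P} {inr : A ⊗ Y ⟶ P} (sq : IsPushout (f ▷ X) (A ◁ g) inl inr)
    (ι : P ⟶ B ⊗ Y) (hl : inl ≫ ι = B ◁ g) (hr : inr ≫ ι = f ▷ Y) : weqQ ι := by
  obtain h | h := h
  · have h₁ := llp_fibQ_of_mono (f ▷ X) (weqQ_whiskerRight f h X)
    have h₂ := weqQ_of_llp (fibQ.llp.of_isPushout sq.flip h₁)
    -- The leg `inr` is a cobase change of the acyclic injection `f ▷ X`, and `inr ≫ ι` is `f ▷ Y`.
    exact weqQ.of_precomp inr ι h₂ (hr ▸ weqQ_whiskerRight f h Y)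
  · have h₁ := llp_fibQ_of_mono (A ◁ g) (weqQ_whiskerLeft g h A)
    have h₂ := weqQ_of_llp (fibQ.llp.of_isPushout sq h₁)
    exact weqQ.of_precomp inl ι h₂ (hl ▸ weqQ_whiskerLeft g h B)

end DgQ

namespace DgQ

lemma fromPath_naturality {K L : DgQ} (f : K ⟶ L) :
    f ▷ unitPath ≫ fromPath L = fromPath K ≫ f := by
  rw [fromPath, ← MonoidalCategory.whisker_exchange_assoc,
    MonoidalCategory.rightUnitor_naturality, fromPath, Category.assoc]

lemma toCone_naturality {K L : DgQ} (f : K ⟶ L) :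
    f ≫ toCone L = toCone K ≫ f ▷ unitCone := by
  simp only [toCone, Category.assoc, MonoidalCategory.whisker_exchange,
    MonoidalCategory.rightUnitor_inv_naturality_assoc]

end DgQ

/-! ### Equivariant cones and path objects -/

namespace DgQW

open DgQ (unitPath unitCone)

/-- `K ⊗ P` with `P` contractible and mapping onto the unit. -/
abbrev path (K : DgQW) : DgQW := ((MonoidalCategory.tensorRight unitPath).mapAction W₂).obj K

/-- The projection of `path K` onto `K`. -/
def fromPath (K : DgQW) : path K ⟶ K where
  hom := DgQ.fromPath K.V
  comm g := DgQ.fromPath_naturality (K.ρ g)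

/-- `K ⊗ D` with `D` contractible and containing the unit. -/
abbrev cone (K : DgQW) : DgQW := ((MonoidalCategory.tensorRight unitCone).mapAction W₂).obj K

/-- The inclusion of `K` into `cone K`. -/
def toCone (K : DgQW) : K ⟶ cone K where
  hom := DgQ.toCone K.V
  comm g := DgQ.toCone_naturality (K.ρ g)

instance (K : DgQW) : Mono (toCone K) :=
  mono_iff.2 (inferInstanceAs (Mono (DgQ.toCone K.V)))

instance (K : DgQW) : Epi (fromPath K) :=
  epi_iff.2 (DgQ.epi_iff.1 (inferInstanceAs (Epi (DgQ.fromPath K.V))))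

variable {A B : DgQW}

/-- The retract argument is equivariant; the contraction of `path B` is only needed on the
underlying complexes, where weak equivalences are defined. -/
lemma weqQ_of_llp {f : A ⟶ B} (hf : fibQW.llp f) : weqQW f := by
  have := hf (biprod.desc f (fromPath B)) (epi_iff.1 (epi_of_epi_fac (biprod.inr_desc f _)))
  refine weqQ.of_retract ((RetractArrow.ofBiprodDesc f (fromPath B)).map (Action.forget DgQ W₂)) ?_
  have h : (biprod.fst ≫ biprod.inl + biprod.snd ≫ biprod.inr : A ⊞ path B ⟶ _) = 𝟙 _ :=
    biprod.total
  have h' : (biprod.inl ≫ biprod.fst : A ⟶ A) = 𝟙 A := biprod.inl_fst (Y := path B)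
  exact (DgQ.contractible_path B.V).weqQ_inl
    (i := (biprod.inl : A ⟶ A ⊞ path B).hom) (q := (biprod.fst : A ⊞ path B ⟶ A).hom)
    (s := (biprod.snd : A ⊞ path B ⟶ path B).hom) (j := (biprod.inr : path B ⟶ A ⊞ path B).hom)
    (congrArg Action.Hom.hom h') (congrArg Action.Hom.hom h)

lemma mono_of_llp {f : A ⟶ B} (hf : (fibQW ⊓ weqQW).llp f) : Mono f := by
  have h := (DgQ.contractible_cone A.V).hasElementLifts
    ((Action.forget DgQ W₂).map_isZero (isZero_zero DgQW)) (0 : cone A ⟶ 0).hom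
  have := hf (0 : cone A ⟶ 0) ⟨h.fibQ, h.weqQ⟩
  have sq : CommSq (toCone A) f (0 : cone A ⟶ 0) 0 := ⟨by simp⟩
  exact mono_of_mono_fac sq.fac_left

end DgQW

end DihedralModel

/-! ### Five lemma and properness for complexes -/

namespace HomologicalComplex.HomologySequence

open ComposableArrows Abelian

variable {C ι : Type*} [Category* C] [Abelian C] {c : ComplexShape ι}
  {S₁ S₂ : ShortComplex (HomologicalComplex C c)} (φ : S₁ ⟶ S₂)

/-- Four lemma on the last four terms of the six-term homology sequence. The companion for
epimorphisms uses the first four. -/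
lemma mono_homologyMap_τ₂ (hS₁ : S₁.ShortExact) (hS₂ : S₂.ShortExact) (i j : ι)
    (hij : c.Rel i j) (h₁ : QuasiIso φ.τ₁) (h₃ : QuasiIso φ.τ₃) :
    Mono (homologyMap φ.τ₂ j) := by
  apply mono_of_epi_of_mono_of_mono
    ((δ₀Functor ⋙ δ₀Functor).map (mapComposableArrows₅ φ hS₁ hS₂ i j hij))
  · exact (composableArrows₅_exact hS₁ i j hij).δ₀.δ₀
  · exact (composableArrows₅_exact hS₂ i j hij).δ₀.δ₀
  · exact inferInstanceAs (Epi (homologyMap φ.τ₃ i))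
  · exact inferInstanceAs (Mono (homologyMap φ.τ₁ j))
  · exact inferInstanceAs (Mono (homologyMap φ.τ₃ j))

lemma epi_homologyMap_τ₂ (hS₁ : S₁.ShortExact) (hS₂ : S₂.ShortExact) (i j : ι)
    (hij : c.Rel i j) (h₁ : QuasiIso φ.τ₁) (h₃ : QuasiIso φ.τ₃) :
    Epi (homologyMap φ.τ₂ i) := by
  apply epi_of_epi_of_epi_of_mono
    ((δlastFunctor ⋙ δlastFunctor).map (mapComposableArrows₅ φ hS₁ hS₂ i j hij))
  · exact (composableArrows₅_exact hS₁ i j hij).δlast.δlast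
  · exact (composableArrows₅_exact hS₂ i j hij).δlast.δlast
  · exact inferInstanceAs (Epi (homologyMap φ.τ₁ i))
  · exact inferInstanceAs (Epi (homologyMap φ.τ₃ i))
  · exact inferInstanceAs (Mono (homologyMap φ.τ₁ j))

end HomologicalComplex.HomologySequence

namespace DihedralModel.DgQ

open HomologicalComplex

/-- Each integer `j` is both the target of `j + 1` and the source of `j - 1`, so both four lemmas
apply in degree `j`. -/
lemma weqQ_τ₂ {S₁ S₂ : ShortComplex DgQ} (φ : S₁ ⟶ S₂) (hS₁ : S₁.ShortExact) (hS₂ : S₂.ShortExact)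
    (h₁ : weqQ φ.τ₁) (h₃ : weqQ φ.τ₃) : weqQ φ.τ₂ := by
  refine ⟨fun j ↦ ?_⟩
  rw [quasiIsoAt_iff_isIso_homologyMap]
  have := HomologySequence.mono_homologyMap_τ₂ φ hS₁ hS₂ (j + 1) j rfl h₁ h₃
  have := HomologySequence.epi_homologyMap_τ₂ φ hS₁ hS₂ j (j - 1) (by simp) h₁ h₃
  exact isIso_of_mono_of_epi _

/-- Quasi-isomorphisms are stable under pushouts along injections. -/
lemma weqQ_of_isPushout {X Y X' Y' : DgQ} {f : X ⟶ Y} {i : X ⟶ X'} {i' : Y ⟶ Y'} {f' : X' ⟶ Y'}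
    (sq : IsPushout f i i' f') [Mono i] (hf : weqQ f) : weqQ f' := by
  have : Mono i' := (MorphismProperty.monomorphisms DgQ).of_isPushout sq ‹Mono i›
  -- The cokernels of `i` and `i'` agree, so `f'` is the middle term of a map of short exact
  -- sequences.
  have := isIso_cokernel_map_of_isPushout sq.flip
  let φ : ShortComplex.mk i (cokernel.π i) (by simp) ⟶ ShortComplex.mk i' (cokernel.π i') (by simp) :=
    { τ₁ := f, τ₂ := f', τ₃ := cokernel.map _ _ _ _ sq.flip.w, comm₁₂ := sq.w }
  have h {A B : DgQ} (a : A ⟶ B) [Mono a] :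
      (ShortComplex.mk a (cokernel.π a) (by simp)).ShortExact :=
    ShortComplex.ShortExact.mk' (ShortComplex.exact_cokernel a) ‹_› inferInstance
  exact weqQ_τ₂ φ (h i) (h i') hf (weqQ_of_isIso (cokernel.map _ _ _ _ sq.flip.w))

/-- Quasi-isomorphisms are stable under pullbacks along surjections. -/
lemma weqQ_of_isPullback {X Y X' Y' : DgQ} {f' : X' ⟶ Y'} {p' : X' ⟶ X} {p : Y' ⟶ Y} {f : X ⟶ Y}
    (sq : IsPullback f' p' p f) [Epi p] (hf : weqQ f) : weqQ f' := by
  have : Epi p' := (MorphismProperty.epimorphisms DgQ).of_isPullback sq ‹Epi p›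
  have := isIso_kernel_map_of_isPullback sq.flip
  let φ : ShortComplex.mk (kernel.ι p') p' (by simp) ⟶ ShortComplex.mk (kernel.ι p) p (by simp) :=
    { τ₁ := kernel.map _ _ _ _ sq.flip.w, τ₂ := f', τ₃ := f, comm₂₃ := sq.w }
  have h {A B : DgQ} (a : A ⟶ B) [Epi a] :
      (ShortComplex.mk (kernel.ι a) a (by simp)).ShortExact :=
    ShortComplex.ShortExact.mk' (ShortComplex.exact_kernel a) inferInstance ‹_›
  exact weqQ_τ₂ φ (h p') (h p) (weqQ_of_isIso (kernel.map _ _ _ _ sq.flip.w)) hf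

end DihedralModel.DgQ

end

/-! ### Limits and colimits of families and of `AD` -/

open CategoryTheory Limits
open scoped MonoidalCategory

noncomputable section

namespace CategoryTheory.pi

variable {I : Type} {C : I → Type*} [∀ i, Category.{0} (C i)] {J : Type} [SmallCategory J]

instance hasLimitsOfShape [∀ i, HasLimitsOfShape J (C i)] : HasLimitsOfShape J (∀ i, C i) where
  has_limit _ := hasLimit_of_hasLimit_comp_eval

instance hasColimitsOfShape [∀ i, HasColimitsOfShape J (C i)] : HasColimitsOfShape J (∀ i, C i) where
  has_colimit _ := hasColimit_of_hasColimit_comp_eval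

instance preservesLimitsOfShape_eval [∀ i, HasLimitsOfShape J (C i)] (i : I) :
    PreservesLimitsOfShape J (Pi.eval C i) where
  preservesLimit := preservesLimit_of_preserves_limit_cone
    (coneOfConeEvalIsLimit fun _ ↦ limit.isLimit _) (limit.isLimit _)

instance preservesColimitsOfShape_eval [∀ i, HasColimitsOfShape J (C i)] (i : I) :
    PreservesColimitsOfShape J (Pi.eval C i) where
  preservesColimit := preservesColimit_of_preserves_colimit_cocone
    (coconeOfCoconeEvalIsColimit fun _ ↦ colimit.isColimit _) (colimit.isColimit _)

end CategoryTheory.pi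

namespace CategoryTheory.Comma

variable {A B T J : Type*} [Category* A] [Category* B] [Category* T] [Category* J]
  {L : A ⥤ T} {R : B ⥤ T}

instance preservesLimitsOfShape_fst [HasLimitsOfShape J A] [HasLimitsOfShape J B]
    [PreservesLimitsOfShape J R] : PreservesLimitsOfShape J (Comma.fst L R) where
  preservesLimit := preservesLimit_of_preserves_limit_cone
    (coneOfPreservesIsLimit _ (limit.isLimit _) (limit.isLimit _)) (limit.isLimit _)

instance preservesLimitsOfShape_snd [HasLimitsOfShape J A] [HasLimitsOfShape J B]
    [PreservesLimitsOfShape J R] : PreservesLimitsOfShape J (Comma.snd L R) where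
  preservesLimit := preservesLimit_of_preserves_limit_cone
    (coneOfPreservesIsLimit _ (limit.isLimit _) (limit.isLimit _)) (limit.isLimit _)

end CategoryTheory.Comma

namespace DihedralModel

section

variable {J : Type*} [Category* J]

instance preservesColimitsOfShape_trivW : PreservesColimitsOfShape J trivW :=
  Action.preservesColimitsOfShape_of_preserves _
    (inferInstanceAs (PreservesColimitsOfShape J (𝟭 DgQ)))

instance preservesLimitsOfShape_trivW : PreservesLimitsOfShape J trivW :=
  Action.preservesLimitsOfShape_of_preserves _
    (inferInstanceAs (PreservesLimitsOfShape J (𝟭 DgQ)))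

end

/-- Colimits over `ℕ+` of dg `ℚ[W]`-modules are exact. -/
instance hasExactColimits_DgQW : HasExactColimitsOfShape ℕ+ DgQW := by
  have : ReflectsFiniteLimits (Action.forget DgQ W₂) := inferInstance
  have : HasExactColimitsOfShape ℕ+ DgQ := inferInstance
  exact HasExactColimitsOfShape.domain_of_functor ℕ+ (Action.forget DgQ W₂)

section Tails

variable {D : Type*} [Category.{0} D] [HasCountableProducts D] {J : Type} [SmallCategory J]

instance preservesLimitsOfShape_tails [HasLimitsOfShape J D] :
    PreservesLimitsOfShape J (tails D) := by
  refine preservesLimitsOfShape_of_evaluation _ _ fun n ↦ ⟨fun {F} ↦ ⟨fun {c} hc ↦ ⟨?_⟩⟩⟩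
  have hc' (k : ℕ+) := isLimitOfPreserves (Pi.eval (fun _ : ℕ+ ↦ D) k) hc
  let t (s : Cone (F ⋙ tails D ⋙ (evaluation ℕ+ D).obj n)) (k : {k : ℕ+ // n ≤ k}) :
      Cone (F ⋙ Pi.eval (fun _ : ℕ+ ↦ D) k.1) :=
    ⟨s.pt, { app a := s.π.app a ≫ tailπ (F.obj a) n k
             naturality a b f := by
               have h := s.w f
               have h' := tailMap_π (F.map f) n k
               change 𝟙 _ ≫ s.π.app b ≫ _ = (s.π.app a ≫ _) ≫ (F.map f) k.1
               refine (Category.id_comp _).trans ((congrArg (· ≫ _) h.symm).trans ?_)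
               exact (Category.assoc _ _ _).trans ((congrArg (_ ≫ ·) h').trans
                 (Category.assoc _ _ _).symm) }⟩
  exact
    { lift s := tailLift fun k ↦ (hc' k.1).lift (t s k)
      fac s a := tail_ext fun k ↦ by
        change (tailLift _ ≫ tailMap (c.π.app a) n) ≫ _ = _
        refine (Category.assoc _ _ _).trans ((congrArg (_ ≫ ·) (tailMap_π _ n k)).trans ?_)
        refine (Category.assoc _ _ _).symm.trans ((congrArg (· ≫ _) (tailLift_π _ k)).trans ?_)
        exact (hc' k.1).fac (t s k) a
      uniq s m hm := tail_ext fun k ↦ by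
        refine Eq.trans ?_ (tailLift_π _ k).symm
        refine (hc' k.1).uniq (t s k) _ fun a ↦ ?_
        change (m ≫ tailπ c.pt n k) ≫ c.π.app a k.1 = s.π.app a ≫ _
        refine (Category.assoc _ _ _).trans ((congrArg (_ ≫ ·) (tailMap_π _ n k).symm).trans ?_)
        exact (Category.assoc _ _ _).symm.trans (congrArg (· ≫ _) (hm a)) }

end Tails

/-- Products commute with limits, and colimits over `ℕ+` are exact; hence pullbacks in `AD` are
computed on stalks. Infinite products are not preserved: the product of skyscrapers at all `k` has
germs although each factor has none. -/
instance preservesPullbacks_germs : PreservesLimitsOfShape WalkingCospan germs :=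
  inferInstanceAs (PreservesLimitsOfShape WalkingCospan (tails DgQW ⋙ colim))

section Stalks

/-- The functor `V ↦ V_∞`. -/
abbrev stalkInf : AD ⥤ DgQ := Comma.fst trivW germs

/-- The functor `V ↦ V_k`. -/
abbrev stalk (k : ℕ+) : AD ⥤ DgQW := Comma.snd trivW germs ⋙ Pi.eval (fun _ : ℕ+ ↦ DgQW) k

variable {J : Type} [SmallCategory J]

/-- Colimits in a comma category only require the left functor, here `trivW`, to preserve them. -/
instance : HasColimitsOfSize.{0, 0} AD where
  has_colimits_of_shape _ _ := inferInstance

instance : HasPullbacks AD := inferInstanceAs (HasPullbacks (Comma trivW germs))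

end Stalks


end DihedralModel

end

/-! ### Finite presentability of spheres and discs -/

open CategoryTheory Limits
open scoped MonoidalCategory

noncomputable section

namespace CategoryTheory

universe w

variable {C : Type*} [Category.{w} C]

/-- A criterion for presentability: maps to filtered colimits factor, essentially uniquely. -/
lemma isCardinalPresentable_of_factors (X : C) (κ : Cardinal.{w}) [Fact κ.IsRegular]
    (h₁ : ∀ (J : Type w) [SmallCategory J] [IsCardinalFiltered J κ] (F : J ⥤ C) (c : Cocone F)
      (_ : IsColimit c) (f : X ⟶ c.pt), ∃ (j : J) (g : X ⟶ F.obj j), g ≫ c.ι.app j = f)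
    (h₂ : ∀ (J : Type w) [SmallCategory J] [IsCardinalFiltered J κ] (F : J ⥤ C) (c : Cocone F)
      (_ : IsColimit c) (j : J) (f g : X ⟶ F.obj j), f ≫ c.ι.app j = g ≫ c.ι.app j →
        ∃ (k : J) (u : j ⟶ k), f ≫ F.map u = g ≫ F.map u) :
    IsCardinalPresentable X κ where
  preservesColimitOfShape J _ _ := ⟨fun {F} ↦ ⟨fun {c} hc ↦ ⟨by
    have := isFiltered_of_isCardinalFiltered J κ
    refine Types.FilteredColimit.isColimitOf' _ _ (fun f ↦ ?_) fun j f g h ↦ h₂ J F c hc j f g h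
    obtain ⟨j, g, hg⟩ := h₁ J F c hc f
    exact ⟨j, g, hg.symm⟩⟩⟩⟩

end CategoryTheory

namespace DihedralModel

open Cardinal HomologicalComplex

open scoped ZeroObject

attribute [local instance] Cardinal.fact_isRegular_aleph0

instance isFinitelyPresentable_free (T : Type) [Finite T] :
    IsFinitelyPresentable.{0} ((ModuleCat.free ℚ).obj T) := by
  have : IsFinitelyPresentable.{0} T :=
    (Types.isCardinalPresentable_iff _).2 (hasCardinalLT_aleph0_iff _ |>.2 inferInstance)
  have : (CategoryTheory.forget VectQ).IsCardinalAccessible ℵ₀ :=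
    Functor.isFinitelyAccessible_iff_preservesFilteredColimits.2 inferInstance
  exact (ModuleCat.adj ℚ).isCardinalPresentable_leftAdjoint_obj ℵ₀ T

instance isFinitelyPresentable_rat : IsFinitelyPresentable.{0} (ModuleCat.of ℚ ℚ) :=
  isCardinalPresentable_of_iso (X := (ModuleCat.free ℚ).obj PUnit)
    (Finsupp.uniqueLinearEquiv ℚ ℚ PUnit.unit).toModuleIso ℵ₀

/-- Maps out of the disc are maps from `M` to the degree `n` part, and evaluation preserves
colimits. -/
instance isFinitelyPresentable_disc (n : ℤ) (M : VectQ) [IsFinitelyPresentable.{0} M] :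
    IsFinitelyPresentable.{0} ((disc n).obj M) := by
  have : (eval VectQ (ComplexShape.down ℤ) n ⋙ coyoneda.obj (Opposite.op M)).IsCardinalAccessible
    ℵ₀ := by
    have : (coyoneda.obj (Opposite.op M)).IsCardinalAccessible ℵ₀ := ‹_›
    have : (eval VectQ (ComplexShape.down ℤ) n).IsCardinalAccessible ℵ₀ := ⟨fun J _ _ ↦ inferInstance⟩
    infer_instance
  exact Functor.isCardinalAccessible_of_natIso
    (evalCompCoyonedaCorepresentableByDoubleId (down_rel n) (ne_sub_one n) M).toIso.symm ℵ₀

/-- A map out of the sphere is a map from `M` in degree `n` subject to one equation in degree `n -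
1`; both the map and the equation are reached at a finite stage. -/
instance isFinitelyPresentable_sphere (n : ℤ) (M : VectQ) [IsFinitelyPresentable.{0} M] :
    IsFinitelyPresentable.{0} ((sphere n).obj M) := by
  apply isCardinalPresentable_of_factors
  · intro J _ _ F c hc f
    have := isFiltered_of_isCardinalFiltered J ℵ₀
    have hc' (i : ℤ) := isColimitOfPreserves (eval VectQ (ComplexShape.down ℤ) i) hc
    obtain ⟨j, g, hg⟩ : ∃ (j : J) (g : M ⟶ (F.obj j).X n), g ≫ (c.ι.app j).f n =
        (singleObjXSelf _ n M).inv ≫ f.f n :=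
      IsCardinalPresentable.exists_hom_of_isColimit ℵ₀ (hc' n) ((singleObjXSelf _ n M).inv ≫ f.f n)
    have h : (g ≫ (F.obj j).d n (n - 1)) ≫ (c.ι.app j).f (n - 1) =
        0 ≫ (c.ι.app j).f (n - 1) := by
      have hd : f.f n ≫ c.pt.d n (n - 1) = 0 := by rw [Hom.comm]; simp
      rw [Category.assoc, ← Hom.comm, reassoc_of% hg]
      exact (congrArg (_ ≫ ·) hd).trans (comp_zero.trans zero_comp.symm)
    obtain ⟨k, u, hu⟩ : ∃ (k : J) (u : j ⟶ k), (g ≫ (F.obj j).d n (n - 1)) ≫ (F.map u).f (n - 1) =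
        0 ≫ (F.map u).f (n - 1) := IsCardinalPresentable.exists_eq_of_isColimit' ℵ₀ (hc' (n - 1)) _ _ h
    refine ⟨k, mkHomFromSingle (g ≫ (F.map u).f n) fun m hm ↦ ?_, ?_⟩
    · obtain rfl : m = n - 1 := by
        have : m + 1 = n := hm
        lia
      rw [Category.assoc, Hom.comm, ← Category.assoc]
      exact hu.trans zero_comp
    · apply from_single_hom_ext
      rw [comp_f, mkHomFromSingle_f, Category.assoc, Category.assoc, ← comp_f, c.w]
      exact (Iso.eq_inv_comp _).1 hg
  · intro J _ _ F c hc j f g h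
    have := isFiltered_of_isCardinalFiltered J ℵ₀
    have hc' := isColimitOfPreserves (eval VectQ (ComplexShape.down ℤ) n) hc
    have h' : ((singleObjXSelf _ n M).inv ≫ f.f n) ≫ (c.ι.app j).f n =
        ((singleObjXSelf _ n M).inv ≫ g.f n) ≫ (c.ι.app j).f n := by
      rw [Category.assoc, Category.assoc, ← comp_f, ← comp_f, h]
    obtain ⟨k, u, hu⟩ := IsCardinalPresentable.exists_eq_of_isColimit' ℵ₀ hc' _ _ h'
    refine ⟨k, u, from_single_hom_ext ?_⟩
    have hu' : ((singleObjXSelf _ n M).inv ≫ f.f n) ≫ (F.map u).f n =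
      ((singleObjXSelf _ n M).inv ≫ g.f n) ≫ (F.map u).f n := hu
    rwa [Category.assoc, Category.assoc, Iso.cancel_iso_inv_left, ← comp_f, ← comp_f] at hu'

instance isFinitelyPresentable_zero : IsFinitelyPresentable.{0} (0 : DgQ) :=
  isCardinalPresentable_of_factors _ _
    (fun J _ _ _ _ _ _ ↦ ⟨(isFiltered_of_isCardinalFiltered J ℵ₀).nonempty.some, 0,
      (isZero_zero DgQ).eq_of_src _ _⟩)
    (fun _ _ _ _ _ _ j _ _ _ ↦ ⟨j, 𝟙 j, (isZero_zero DgQ).eq_of_src _ _⟩)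

/-- An action of `W` on a finitely presentable complex is finitely presentable. -/
lemma DgQW.isFinitelyPresentable (X : DgQW) [IsFinitelyPresentable.{0} X.V] :
    IsFinitelyPresentable.{0} X := by
  apply isCardinalPresentable_of_factors
  · intro J _ _ F c hc f
    have := isFiltered_of_isCardinalFiltered J ℵ₀
    obtain ⟨j, g, hg⟩ : ∃ (j : J) (g : X.V ⟶ (F.obj j).V), g ≫ (c.ι.app j).hom = f.hom :=
      IsCardinalPresentable.exists_hom_of_isColimit ℵ₀ (isColimitOfPreserves (Action.forget DgQ W₂) hc) f.hom
    refine ⟨j, average g, ?_⟩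
    rw [average_comp, hg, average_hom]
  · intro J _ _ F c hc j f g h
    have := isFiltered_of_isCardinalFiltered J ℵ₀
    obtain ⟨k, u, hu⟩ := IsCardinalPresentable.exists_eq_of_isColimit' ℵ₀
      (isColimitOfPreserves (Action.forget DgQ W₂) hc) f.hom g.hom (congrArg Action.Hom.hom h)
    exact ⟨k, u, Action.Hom.ext hu⟩

instance (M : DgQ) [h : IsFinitelyPresentable.{0} M] : IsFinitelyPresentable.{0} (trivW.obj M) :=
  haveI : IsFinitelyPresentable.{0} (trivW.obj M).V := h
  DgQW.isFinitelyPresentable _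

section Germs

variable {M : DgQW} [IsFinitelyPresentable.{0} M]

/-- Germs are a filtered colimit of tails, so finite presentability turns statements about germs
into statements about all large `k`. -/
lemma exists_tail_lift {V : ℕ+ → DgQW} (f : M ⟶ germs.obj V) :
    ∃ (m : ℕ+) (g : M ⟶ tailProd V m), g ≫ toGerms V m = f :=
  IsFinitelyPresentable.exists_hom_of_isColimit
    (colimit.isColimit ((tails DgQW).obj V)) f

lemma exists_tailRes_eq {V : ℕ+ → DgQW} {m m' : ℕ+} (f : M ⟶ tailProd V m) (g : M ⟶ tailProd V m')
    (h : f ≫ toGerms V m = g ≫ toGerms V m') : ∃ (k : ℕ+) (u : m ≤ k) (v : m' ≤ k),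
      f ≫ tailRes V u = g ≫ tailRes V v := by
  obtain ⟨k, u, v, huv⟩ := IsFinitelyPresentable.exists_eq_of_isColimit
    (colimit.isColimit ((tails DgQW).obj V)) f g h
  exact ⟨k, leOfHom u, leOfHom v, huv⟩

end Germs

end DihedralModel

end

/-! ### Skyscrapers and the adjoints of the stalk functors -/

open CategoryTheory Limits
open scoped MonoidalCategory

noncomputable section

namespace DihedralModel

open scoped ZeroObject
open GradedObject

lemma isZero_single {k l : ℕ+} (R : DgQW) (h : l ≠ k) : IsZero ((single k).obj R l) :=
  (IsZero.iff_id_eq_zero _).2 ((isInitialSingleObjApply k R l h).hom_ext _ _)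

lemma isZero_tailProd {V : ℕ+ → DgQW} {m : ℕ+} (h : ∀ l, m ≤ l → IsZero (V l)) :
    IsZero (tailProd V m) :=
  (IsZero.iff_id_eq_zero _).2 (tail_ext fun k ↦ (h k.1 k.2).eq_of_tgt _ _)

lemma tailRes_toGerms (V : ℕ+ → DgQW) {n m : ℕ+} (h : n ≤ m) :
    tailRes V h ≫ toGerms V m = toGerms V n :=
  colimit.w ((tails DgQW).obj V) (homOfLE h)

/-- Germs only depend on the terms of large index. -/
lemma isZero_germs {V : ℕ+ → DgQW} (m : ℕ+) (h : ∀ l, m ≤ l → IsZero (V l)) :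
    IsZero (germs.obj V) := by
  refine (IsZero.iff_id_eq_zero _).2 (colimit.hom_ext fun n ↦ ?_)
  have e : colimit.ι ((tails DgQW).obj V) n =
      tailRes V (le_max_left n m) ≫ toGerms V (max n m) := (tailRes_toGerms V _).symm
  have hz : toGerms V (max n m) = 0 :=
    (isZero_tailProd fun l hl ↦ h l ((le_max_right n m).trans hl)).eq_of_src _ _
  have hz' : colimit.ι ((tails DgQW).obj V) n = 0 := by rw [e, hz, comp_zero]; rfl
  exact (congrArg (· ≫ _) hz').trans (zero_comp.trans (comp_zero (X := tailProd V n)).symm)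

/-- The tail from `k + 1` on vanishes. Hence maps into a skyscraper satisfy no condition on germs,
which makes `i_k` a right adjoint as well as a left adjoint of the stalk. -/
lemma isZero_germs_single (k : ℕ+) (R : DgQW) : IsZero (germs.obj ((single k).obj R)) :=
  isZero_germs (k + 1) fun l hl ↦ isZero_single R (by
    rintro rfl
    exact absurd hl (not_le.2 (PNat.lt_add_right l 1)))

section Single

variable {V : ℕ+ → DgQW} {k : ℕ+} {R : DgQW}

/-- A family of maps out of a family concentrated at `k`. -/
def singleDesc (h : R ⟶ V k) (l : ℕ+) : (single k).obj R l ⟶ V l :=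
  if hl : l = k then (singleObjApplyIsoOfEq k R l hl).hom ≫ h ≫ eqToHom (by rw [hl]) else 0

lemma singleDesc_self (h : R ⟶ V k) :
    singleDesc (V := V) h k = (singleObjApplyIso k R).hom ≫ h := by
  simp [singleDesc]

/-- A family of maps to a family concentrated at `k`. -/
def singleLift (h : V k ⟶ R) (l : ℕ+) : V l ⟶ (single k).obj R l :=
  if hl : l = k then eqToHom (by rw [hl]) ≫ h ≫ (singleObjApplyIsoOfEq k R l hl).inv else 0

lemma singleLift_self (h : V k ⟶ R) :
    singleLift (V := V) h k = h ≫ (singleObjApplyIso k R).inv := by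
  simp [singleLift]

lemma single_hom_ext {f g : ∀ l, (single k).obj R l ⟶ V l} (h : f k = g k) : f = g := by
  funext l
  by_cases hl : l = k
  · subst hl
    exact h
  · exact (isZero_single R hl).eq_of_src _ _

lemma to_single_hom_ext {f g : ∀ l, V l ⟶ (single k).obj R l} (h : f k = g k) : f = g := by
  funext l
  by_cases hl : l = k
  · subst hl
    exact h
  · exact (isZero_single R hl).eq_of_tgt _ _

end Single

/-- `i_k` is left adjoint to the stalk at `k`. -/
def skyStalkAdj (k : ℕ+) : skyAD k ⊣ stalk k :=
  Adjunction.mkOfHomEquiv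
    { homEquiv R X :=
        { toFun f := (singleObjApplyIso k R).inv ≫ f.right k
          invFun h :=
            { left := 0
              right := singleDesc h
              w := (trivW.map_isZero (isZero_zero DgQ)).eq_of_src _ _ }
          left_inv f := by
            refine CommaMorphism.ext ((isZero_zero DgQ).eq_of_src _ _) (single_hom_ext ?_)
            refine (singleDesc_self (V := X.right) _).trans ?_
            exact (singleObjApplyIso k R).hom_inv_id_assoc _
          right_inv h := by
            refine (congrArg (_ ≫ ·) (singleDesc_self (V := X.right) h)).trans ?_
            exact (singleObjApplyIso k R).inv_hom_id_assoc _ }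
      homEquiv_naturality_left_symm {R R' X} f g := by
        refine CommaMorphism.ext ((isZero_zero DgQ).eq_of_src _ _) (single_hom_ext ?_)
        refine (singleDesc_self (V := X.right) _).trans ?_
        refine Eq.trans ?_ (congrArg ((single k).map f k ≫ ·)
          (singleDesc_self (V := X.right) g).symm)
        exact (single_map_singleObjApplyIso_hom_assoc k f g).symm
      homEquiv_naturality_right {R _ _} f g :=
        (Category.assoc (singleObjApplyIso k R).inv (f.right k) (g.right k)).symm }

/-- `i_k` is right adjoint to the stalk at `k`. -/
def stalkSkyAdj (k : ℕ+) : stalk k ⊣ skyAD k :=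
  Adjunction.mkOfHomEquiv
    { homEquiv X R :=
        { toFun h :=
            { left := 0
              right := singleLift h
              w := (isZero_germs_single k R).eq_of_tgt _ _ }
          invFun f := f.right k ≫ (singleObjApplyIso k R).hom
          left_inv h := by
            refine (congrArg (· ≫ _) (singleLift_self (V := X.right) h)).trans ?_
            exact (Category.assoc _ _ _).trans
              ((congrArg (h ≫ ·) (singleObjApplyIso k R).inv_hom_id).trans (Category.comp_id h))
          right_inv f := by
            refine CommaMorphism.ext ((isZero_zero DgQ).eq_of_tgt _ _) (to_single_hom_ext ?_)
            refine (singleLift_self (V := X.right) _).trans ?_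
            exact (Category.assoc _ _ _).trans
              ((congrArg (f.right k ≫ ·) (singleObjApplyIso k R).hom_inv_id).trans
                (Category.comp_id _)) }
      homEquiv_naturality_left_symm {_ _ R} f g :=
        Category.assoc (f.right k) (g.right k) (singleObjApplyIso k R).hom
      homEquiv_naturality_right {X R R'} f g := by
        refine CommaMorphism.ext ((isZero_zero DgQ).eq_of_tgt _ _) (to_single_hom_ext ?_)
        refine (singleLift_self (V := X.right) _).trans ?_
        refine Eq.trans ?_ (congrArg (· ≫ (single k).map g k)
          (singleLift_self (V := X.right) f).symm)
        refine (Category.assoc _ _ _).trans (Eq.trans ?_ (Category.assoc _ _ _).symm)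
        exact congrArg (f ≫ ·) (singleObjApplyIso_inv_single_map k g).symm }

/-- The functor `M ↦ (M, 0)`, with `M` placed at `∞`. -/
def infAD : DgQ ⥤ AD where
  obj M :=
    { left := M
      right := fun _ ↦ 0
      hom := 0 }
  map f :=
    { left := f
      right := fun _ ↦ 0
      w := by simp }

lemma isZero_germs_zero : IsZero (germs.obj (fun _ ↦ (0 : DgQW))) :=
  isZero_germs 1 fun _ _ ↦ isZero_zero _

/-- The stalk at `∞` is left adjoint to `M ↦ (M, 0)`. -/
def stalkInfAdj : stalkInf ⊣ infAD :=
  Adjunction.mkOfHomEquiv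
    { homEquiv _ _ :=
        { toFun h :=
            { left := h
              right := fun _ ↦ 0
              w := isZero_germs_zero.eq_of_tgt _ _ }
          invFun f := f.left
          left_inv _ := rfl
          right_inv _ := CommaMorphism.ext rfl (funext fun _ ↦ (isZero_zero DgQW).eq_of_tgt _ _) }
      homEquiv_naturality_left_symm _ _ := rfl
      homEquiv_naturality_right _ _ :=
        CommaMorphism.ext rfl (funext fun _ ↦ (isZero_zero DgQW).eq_of_tgt _ _) }

instance (k : ℕ+) : (stalk k).IsLeftAdjoint := (stalkSkyAdj k).isLeftAdjoint

section FibWeq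

lemma fibQ_of_isZero {K L : DgQ} (f : K ⟶ L) (hL : IsZero L) : fibQ f :=
  DgQ.epi_iff.1 ⟨fun _ _ _ ↦ hL.eq_of_src _ _⟩

lemma weqQ_of_isZero {K L : DgQ} (f : K ⟶ L) (hK : IsZero K) (hL : IsZero L) : weqQ f := by
  have : IsIso f := ⟨0, hK.eq_of_src _ _, hL.eq_of_src _ _⟩
  exact weqQ_of_isIso f

lemma isZero_V {K : DgQW} (h : IsZero K) : IsZero K.V := (Action.forget DgQ W₂).map_isZero h

instance : fibQ.RespectsIso := by
  have : fibQ = MorphismProperty.epimorphisms DgQ := by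
    ext
    exact DgQ.epi_iff.symm
  rw [this]
  infer_instance

instance : fibQW.RespectsIso :=
  inferInstanceAs (fibQ.inverseImage (Action.forget DgQ W₂)).RespectsIso

instance : weqQW.RespectsIso :=
  inferInstanceAs (weqQ.inverseImage (Action.forget DgQ W₂)).RespectsIso

lemma stalkFib_infAD {K L : DgQ} {f : K ⟶ L} (hf : fibQ f) : stalkFib (infAD.map f) :=
  ⟨hf, fun _ ↦ fibQ_of_isZero _ (isZero_V (isZero_zero DgQW))⟩

lemma stalkWeq_infAD {K L : DgQ} {f : K ⟶ L} (hf : weqQ f) : stalkWeq (infAD.map f) :=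
  ⟨hf, fun _ ↦ weqQ_of_isZero _ (isZero_V (isZero_zero DgQW)) (isZero_V (isZero_zero DgQW))⟩

/-- The value at `k` of a map concentrated at `k`. -/
def singleMapIso {K L : DgQW} (f : K ⟶ L) (k : ℕ+) :
    Arrow.mk ((single k).map f k) ≅ Arrow.mk f :=
  Arrow.isoMk (singleObjApplyIso k K) (singleObjApplyIso k L) (by simp)

lemma stalkFib_skyAD {K L : DgQW} {f : K ⟶ L} (hf : fibQW f) (k : ℕ+) :
    stalkFib ((skyAD k).map f) := by
  refine ⟨fibQ_of_isZero _ (isZero_zero DgQ), fun l ↦ ?_⟩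
  by_cases hl : l = k
  · subst hl
    exact (fibQW.arrow_mk_iso_iff (singleMapIso f l)).2 hf
  · exact fibQ_of_isZero _ (isZero_V (isZero_single L hl))

lemma stalkWeq_skyAD {K L : DgQW} {f : K ⟶ L} (hf : weqQW f) (k : ℕ+) :
    stalkWeq ((skyAD k).map f) := by
  refine ⟨weqQ_of_isZero _ (isZero_zero DgQ) (isZero_zero DgQ), fun l ↦ ?_⟩
  by_cases hl : l = k
  · subst hl
    exact (weqQW.arrow_mk_iso_iff (singleMapIso f l)).2 hf
  · exact weqQ_of_isZero _ (isZero_V (isZero_single K hl)) (isZero_V (isZero_single L hl))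

variable {X Y : AD} {f : X ⟶ Y}

/-- The right adjoint `infAD` of the stalk at `∞` preserves fibrations, so the left lifting property
passes to the stalk. The next three lemmas vary the stalk and the class of fibrations. -/
lemma llp_left_of_llp_stalkFib (hf : stalkFib.llp f) : fibQ.llp f.left := fun _ _ p hp ↦
  (stalkInfAdj.hasLiftingProperty_iff f p).2 (hf _ (stalkFib_infAD hp))

lemma llp_right_of_llp_stalkFib (hf : stalkFib.llp f) (k : ℕ+) : fibQW.llp (f.right k) :=
  fun _ _ p hp ↦ ((stalkSkyAdj k).hasLiftingProperty_iff f p).2 (hf _ (stalkFib_skyAD hp k))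

lemma mono_left_of_llp (hf : (stalkFib ⊓ stalkWeq).llp f) : Mono f.left :=
  DgQ.mono_of_llp fun _ _ p hp ↦
    (stalkInfAdj.hasLiftingProperty_iff f p).2 (hf _ ⟨stalkFib_infAD hp.1, stalkWeq_infAD hp.2⟩)

lemma mono_right_of_llp (hf : (stalkFib ⊓ stalkWeq).llp f) (k : ℕ+) : Mono (f.right k) :=
  DgQW.mono_of_llp fun _ _ p hp ↦ ((stalkSkyAdj k).hasLiftingProperty_iff f p).2
    (hf _ ⟨stalkFib_skyAD hp.1 k, stalkWeq_skyAD hp.2 k⟩)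

end FibWeq

end DihedralModel

end

/-! ### Lifting problems for constant objects -/

open CategoryTheory Limits
open scoped MonoidalCategory

noncomputable section

namespace DihedralModel

open scoped ZeroObject
open Cardinal

attribute [local instance] Cardinal.fact_isRegular_aleph0

section Const

lemma tailLift_tailRes {V : ℕ+ → DgQW} {K : DgQW} (φ : ∀ k, K ⟶ V k) {n m : ℕ+} (h : n ≤ m) :
    tailLift (n := n) (fun k ↦ φ k.1) ≫ tailRes V h = tailLift fun k ↦ φ k.1 :=
  tail_ext fun k ↦ by simp only [Category.assoc, tailRes_π, tailLift_π]

/-- The germ of a family of maps is computed by any tail. -/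
lemma diagGerm_map {V : ℕ+ → DgQW} {M : DgQ} (φ : ∀ k, trivW.obj M ⟶ V k) (m : ℕ+) :
    diagGerm M ≫ germs.map (X := fun _ ↦ trivW.obj M) (Y := V) φ =
      tailLift (n := m) (fun k ↦ φ k.1) ≫ toGerms V m := by
  have h : tailLift (V := fun _ ↦ trivW.obj M) (n := 1) (fun _ ↦ 𝟙 (trivW.obj M)) ≫
      tailMap φ 1 = tailLift fun k ↦ φ k.1 :=
    tail_ext fun k ↦ by
      simp only [Category.assoc, tailMap_π, tailLift_π, tailLift_π_assoc, Category.id_comp]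
  rw [← tailLift_tailRes φ (one_le (a := m)), Category.assoc, tailRes_toGerms, ← h, Category.assoc,
    diagGerm, Category.assoc]
  exact congrArg (_ ≫ ·) (toGerms_naturality (V := fun _ ↦ trivW.obj M) (V' := V) φ 1).symm

/-- Constructor for maps out of a constant object. -/
def constHom {M : DgQ} {X : AD} (a : M ⟶ X.left) (φ : ∀ k, trivW.obj M ⟶ X.right k) (m : ℕ+)
    (h : trivW.map a ≫ X.hom = tailLift (n := m) (fun k ↦ φ k.1) ≫ toGerms X.right m) :
    constAD.obj M ⟶ X where
  left := a
  right := φ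
  w := h.trans (diagGerm_map φ m).symm

/-- The component at `∞` of a map out of a constant object. -/
def constLeft {M : DgQ} {X : AD} (u : constAD.obj M ⟶ X) : M ⟶ X.left := u.left

/-- The component at `k` of a map out of a constant object. -/
def constRight {M : DgQ} {X : AD} (u : constAD.obj M ⟶ X) (k : ℕ+) : trivW.obj M ⟶ X.right k :=
  u.right k

lemma constHom_condition {M : DgQ} {X : AD} (u : constAD.obj M ⟶ X) (m : ℕ+) :
    trivW.map (constLeft u) ≫ X.hom =
      tailLift (n := m) (fun k ↦ constRight u k.1) ≫ toGerms X.right m :=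
  u.w.trans (diagGerm_map (V := X.right) (constRight u) m)

/-- Two families with the same germ agree at every sufficiently large index. -/
lemma exists_forall_tailπ_eq {V : ℕ+ → DgQW} {K : DgQW} [IsFinitelyPresentable.{0} K] {m m' : ℕ+}
    {f : K ⟶ tailProd V m} {g : K ⟶ tailProd V m'} (h : f ≫ toGerms V m = g ≫ toGerms V m') :
    ∃ n : ℕ+, ∀ k (_ : n ≤ k) (hm : m ≤ k) (hm' : m' ≤ k),
      f ≫ tailπ V m ⟨k, hm⟩ = g ≫ tailπ V m' ⟨k, hm'⟩ := by
  obtain ⟨n, u, v, huv⟩ := exists_tailRes_eq f g h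
  refine ⟨n, fun k hk _ _ ↦ ?_⟩
  have := congrArg (· ≫ tailπ V n ⟨k, hk⟩) huv
  simpa only [Category.assoc, tailRes_π] using this

variable {M N : DgQ} [IsFinitelyPresentable.{0} M] [IsFinitelyPresentable.{0} N] (i : M ⟶ N)
  {X Y : AD} (f : X ⟶ Y)

lemma toGerms_map_right (m : ℕ+) :
    toGerms X.right m ≫ germs.map f.right = tailMap f.right m ≫ toGerms Y.right m :=
  (toGerms_naturality f.right m).symm

/-- A map of constant objects lifts against `f` if it does so stalkwise. -/
lemma hasLiftingProperty_constAD (h₁ : HasLiftingProperty i f.left)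
    (h₂ : ∀ k, HasLiftingProperty (trivW.map i) (f.right k)) :
    HasLiftingProperty (constAD.map i) f where
  sq_hasLift {u v} sq := by
    have sq₁ : CommSq (constLeft u) i f.left (constLeft v) := ⟨congrArg CommaMorphism.left sq.w⟩
    have sq₂ (k : ℕ+) : CommSq (constRight u k) (trivW.map i) (f.right k) (constRight v k) :=
      ⟨congrFun (congrArg CommaMorphism.right sq.w) k⟩
    -- The lift at `∞` determines a germ in `X`, represented by `g` from index `m` on. From `n₁` on
    -- it agrees with `u` on the source, and from `n₂` on it lies over `v`.
    obtain ⟨m, g, hg⟩ := exists_tail_lift (trivW.map sq₁.lift ≫ X.hom)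
    obtain ⟨n₁, hn₁⟩ := exists_forall_tailπ_eq
      (f := tailLift (n := m) (fun k ↦ constRight u k.1)) (g := trivW.map i ≫ g) (by
        rw [Category.assoc, hg, ← Functor.map_comp_assoc, sq₁.fac_left, constHom_condition u m])
    obtain ⟨n₂, hn₂⟩ := exists_forall_tailπ_eq
      (f := tailLift (n := m) (fun k ↦ constRight v k.1)) (g := g ≫ tailMap f.right m) (by
        have hf : trivW.map f.left ≫ Y.hom = X.hom ≫ germs.map f.right := f.w
        rw [← constHom_condition v m, Category.assoc, ← toGerms_map_right, reassoc_of% hg, ← hf,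
          ← Functor.map_comp_assoc, sq₁.fac_right])
    let n := max m (max n₁ n₂)
    have hmn : m ≤ n := le_max_left _ _
    have hn₁n : n₁ ≤ n := (le_max_left _ _).trans (le_max_right _ _)
    have hn₂n : n₂ ≤ n := (le_max_right _ _).trans (le_max_right _ _)
    -- For large `k` the lift must follow the germ `g`; the finitely many remaining stalks do not
    -- affect germs and are lifted independently.
    let φ (k : ℕ+) : trivW.obj N ⟶ X.right k :=
      if hk : n ≤ k then g ≫ tailπ X.right m ⟨k, hmn.trans hk⟩ else (sq₂ k).lift
    have hφ (k : ℕ+) (hk : n ≤ k) : φ k = g ≫ tailπ X.right m ⟨k, hmn.trans hk⟩ := dif_pos hk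
    have hφ' (k : ℕ+) (hk : ¬ n ≤ k) : φ k = (sq₂ k).lift := dif_neg hk
    let l : constAD.obj N ⟶ X := constHom sq₁.lift φ n (by
      rw [← hg, ← tailRes_toGerms X.right hmn, ← Category.assoc]
      congr 1
      exact tail_ext fun k ↦ by rw [Category.assoc, tailRes_π, tailLift_π, hφ k.1 k.2])
    refine ⟨⟨⟨l, CommaMorphism.ext sq₁.fac_left (funext fun k ↦ ?_),
      CommaMorphism.ext sq₁.fac_right (funext fun k ↦ ?_)⟩⟩⟩
    · change trivW.map i ≫ φ k = constRight u k
      by_cases hk : n ≤ k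
      · have := hn₁ k (hn₁n.trans hk) (hmn.trans hk) (hmn.trans hk)
        rw [tailLift_π, Category.assoc] at this
        rw [hφ k hk, this]
      · rw [hφ' k hk, (sq₂ k).fac_left]
    · change φ k ≫ f.right k = constRight v k
      by_cases hk : n ≤ k
      · have := hn₂ k (hn₂n.trans hk) (hmn.trans hk) (hmn.trans hk)
        rw [tailLift_π, Category.assoc, tailMap_π] at this
        rw [hφ k hk, Category.assoc, this]
      · rw [hφ' k hk, (sq₂ k).fac_right]

/-- If a map of constant objects lifts against `f`, then so does it at `∞`. -/
lemma hasLiftingProperty_left (h : HasLiftingProperty (constAD.map i) f) :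
    HasLiftingProperty i f.left where
  sq_hasLift {a b} sq := by
    obtain ⟨m, g, hg⟩ := exists_tail_lift (trivW.map a ≫ X.hom)
    obtain ⟨m', g', hg'⟩ := exists_tail_lift (trivW.map b ≫ Y.hom)
    obtain ⟨n₀, hn₀⟩ := exists_forall_tailπ_eq
      (f := trivW.map i ≫ g') (g := g ≫ tailMap f.right m) (by
        have hf : trivW.map f.left ≫ Y.hom = X.hom ≫ germs.map f.right := f.w
        rw [Category.assoc, hg', Category.assoc, ← toGerms_map_right, reassoc_of% hg, ← hf,
          ← Functor.map_comp_assoc, ← Functor.map_comp_assoc, sq.w])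
    let n := max n₀ (max m m')
    have hn₀n : n₀ ≤ n := le_max_left _ _
    have hmn : m ≤ n := (le_max_left _ _).trans (le_max_right _ _)
    have hmn' : m' ≤ n := (le_max_right _ _).trans (le_max_right _ _)
    -- A square at `∞` is extended to constant objects: representatives of the germs where they form
    -- commuting squares, and zero at the finitely many small indices.
    let φ (k : ℕ+) : trivW.obj M ⟶ X.right k :=
      if hk : n ≤ k then g ≫ tailπ X.right m ⟨k, hmn.trans hk⟩ else 0
    have hφ (k : ℕ+) (hk : n ≤ k) : φ k = g ≫ tailπ X.right m ⟨k, hmn.trans hk⟩ := dif_pos hk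
    let ψ (k : ℕ+) : trivW.obj N ⟶ Y.right k :=
      if hk : n ≤ k then g' ≫ tailπ Y.right m' ⟨k, hmn'.trans hk⟩ else 0
    have hψ (k : ℕ+) (hk : n ≤ k) : ψ k = g' ≫ tailπ Y.right m' ⟨k, hmn'.trans hk⟩ := dif_pos hk
    let u : constAD.obj M ⟶ X := constHom a φ n (by
      rw [← hg, ← tailRes_toGerms X.right hmn, ← Category.assoc]
      congr 1
      exact tail_ext fun k ↦ by rw [Category.assoc, tailRes_π, tailLift_π, hφ k.1 k.2])
    let v : constAD.obj N ⟶ Y := constHom b ψ n (by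
      rw [← hg', ← tailRes_toGerms Y.right hmn', ← Category.assoc]
      congr 1
      exact tail_ext fun k ↦ by rw [Category.assoc, tailRes_π, tailLift_π, hψ k.1 k.2])
    have sq' : CommSq u (constAD.map i) f v := ⟨CommaMorphism.ext sq.w (funext fun k ↦ by
      change φ k ≫ f.right k = trivW.map i ≫ ψ k
      by_cases hk : n ≤ k
      · have := hn₀ k (hn₀n.trans hk) (hmn'.trans hk) (hmn.trans hk)
        rw [Category.assoc, Category.assoc, tailMap_π] at this
        rw [hφ k hk, hψ k hk, Category.assoc, this]
      · simp only [φ, ψ, dif_neg hk, zero_comp, comp_zero])⟩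
    exact ⟨⟨⟨sq'.lift.left, congrArg CommaMorphism.left sq'.fac_left,
      congrArg CommaMorphism.left sq'.fac_right⟩⟩⟩

end Const

end DihedralModel

end

/-! ### The maps with the right lifting property against the generators -/

open CategoryTheory Limits
open scoped MonoidalCategory

noncomputable section

namespace DihedralModel

open scoped ZeroObject
open Cardinal HomologicalComplex

attribute [local instance] Cardinal.fact_isRegular_aleph0

namespace DgQ

variable {K L : DgQ} (p : K ⟶ L)

/-- The map from a disc classified by an element. -/
def discHom {n : ℤ} (y : L.X n) : (disc n).obj (ModuleCat.of ℚ ℚ) ⟶ L :=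
  mkHomFromDouble (down_rel n) (ne_sub_one n) (vec y) (vec y ≫ L.d n (n - 1)) (by simp) (by simp)

/-- The element of degree `n` of the disc. -/
def discGen (n : ℤ) : ((disc n).obj (ModuleCat.of ℚ ℚ)).X n :=
  (doubleXIso₀ (𝟙 (ModuleCat.of ℚ ℚ)) (down_rel n)).inv (1 : ℚ)

lemma discHom_discGen {n : ℤ} (y : L.X n) : (discHom y).f n (discGen n) = y := by
  have h : (doubleXIso₀ (𝟙 (ModuleCat.of ℚ ℚ)) (down_rel n)).inv ≫
      (mkHomFromDouble (f := 𝟙 _) (down_rel n) (ne_sub_one n) (vec y) (vec y ≫ L.d n (n - 1))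
        (by simp) (by simp)).f n = vec y := by
    rw [mkHomFromDouble_f₀, Iso.inv_hom_id_assoc]
  exact congr($h (1 : ℚ)).trans (vec_one y)

/-- The map from a sphere classified by a cycle. -/
def sphereHom {n : ℤ} (x : K.X n) (hx : ∀ k, K.d n k x = 0) :
    (sphere n).obj (ModuleCat.of ℚ ℚ) ⟶ K :=
  mkHomFromSingle (vec x) fun k _ ↦ vec_ext (by
    rw [ModuleCat.comp_apply, vec_one, hx]
    rfl)

/-- The element of degree `n` of the sphere. -/
def sphereGen (n : ℤ) : ((sphere n).obj (ModuleCat.of ℚ ℚ)).X n :=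
  (singleObjXSelf (ComplexShape.down ℤ) n (ModuleCat.of ℚ ℚ)).inv (1 : ℚ)

lemma sphereHom_sphereGen {n : ℤ} (x : K.X n) (hx : ∀ k, K.d n k x = 0) :
    (sphereHom x hx).f n (sphereGen n) = x := by
  rw [sphereHom, mkHomFromSingle_f, sphereGen, ModuleCat.comp_apply]
  refine (congrArg (vec x) ?_).trans (vec_one x)
  exact (singleObjXSelf (ComplexShape.down ℤ) n (ModuleCat.of ℚ ℚ)).inv_hom_id_apply (1 : ℚ)

lemma sphereHom_ext {n : ℤ} {f g : (sphere n).obj (ModuleCat.of ℚ ℚ) ⟶ L}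
    (h : f.f n (sphereGen n) = g.f n (sphereGen n)) : f = g := by
  apply from_single_hom_ext
  rw [← cancel_epi (singleObjXSelf (ComplexShape.down ℤ) n (ModuleCat.of ℚ ℚ)).inv]
  exact vec_ext h

lemma genCofQ_sphereGen (n : ℤ) :
    (genCofQ n).f (n - 1) (sphereGen (n - 1)) =
      ((disc n).obj (ModuleCat.of ℚ ℚ)).d n (n - 1) (discGen n) := by
  have h₁ : (singleObjXSelf (ComplexShape.down ℤ) (n - 1) (ModuleCat.of ℚ ℚ)).inv ≫
      (sphereToDiscApp n (ModuleCat.of ℚ ℚ)).f (n - 1) =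
        (doubleXIso₀ (𝟙 (ModuleCat.of ℚ ℚ)) (down_rel n)).inv ≫
          (double (𝟙 (ModuleCat.of ℚ ℚ)) (down_rel n)).d n (n - 1) := by
    rw [sphereToDiscApp, mkHomFromSingle_f, double_d _ _ (ne_sub_one n), Iso.inv_hom_id_assoc,
      Iso.inv_hom_id_assoc, Category.id_comp]
  exact congr($h₁ (1 : ℚ))

/-- A square from `S^{i-1} ⟶ D^i` to `p` is a cycle `x` and a chain `y` with `p x = d y`; the
generator of the disc maps to the required element. -/
lemma hasElementLifts_of_genCofQ (h : ∀ n, HasLiftingProperty (genCofQ n) p) :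
    HasElementLifts p := by
  intro i j hij x y hx hxy
  obtain rfl : j = i - 1 := by lia
  have sq : CommSq (sphereHom x hx) (genCofQ i) p (discHom y) := ⟨sphereHom_ext (by
    rw [comp_f, comp_f, ModuleCat.comp_apply, ModuleCat.comp_apply, sphereHom_sphereGen,
      genCofQ_sphereGen, f_d_apply, discHom_discGen, hxy])⟩
  refine ⟨sq.lift.f i (discGen i), ?_, ?_⟩
  · rw [← f_d_apply, ← genCofQ_sphereGen, ← ModuleCat.comp_apply, ← comp_f, sq.fac_left,
      sphereHom_sphereGen]
  · rw [← ModuleCat.comp_apply, ← comp_f, sq.fac_right, discHom_discGen]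

lemma fibQ_of_genTrivCofQ (h : ∀ n, HasLiftingProperty (genTrivCofQ n) p) :
    fibQ p := by
  intro n y
  have sq : CommSq 0 (genTrivCofQ n) p (discHom y) := ⟨(isZero_zero DgQ).eq_of_src _ _⟩
  exact ⟨sq.lift.f n (discGen n), by
    rw [← ModuleCat.comp_apply, ← comp_f, sq.fac_right, discHom_discGen]⟩

lemma Contractible.hasLiftingProperty {A B : DgQ} (i : A ⟶ B) (hA : IsZero A)
    (hB : Contractible B) (hp : fibQ p) : HasLiftingProperty i p where
  sq_hasLift {u v} sq := by
    obtain ⟨h, hh⟩ := hB.exists_lift p hp v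
    exact ⟨⟨⟨h, hA.eq_of_src _ _, hh⟩⟩⟩

instance (n : ℤ) : Mono (genCofQ n) := mono_sphereToDisc n _

end DgQ

namespace DgQW

instance mono_genCofQW (n : ℤ) : Mono (genCofQW n) := mono_iff.2 (DgQ.mono_sphereToDisc n _)

/-- The coefficient of `g` of an element of the group ring. -/
def coeff (g : W₂) : groupRingQW.V ⟶ ModuleCat.of ℚ ℚ :=
  ModuleCat.ofHom (Finsupp.lapply g)

/-- The unit of the group ring. -/
def groupRingOne : ModuleCat.of ℚ ℚ ⟶ groupRingQW.V :=
  ModuleCat.ofHom (Finsupp.lsingle (1 : W₂))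

lemma groupRingOne_coeff (g : W₂) : groupRingOne ≫ coeff g = if g = 1 then 𝟙 _ else 0 := by
  apply DgQ.vec_ext
  change Finsupp.single (1 : W₂) (1 : ℚ) g = _
  split_ifs with h
  · subst h
    simp
  · rw [Finsupp.single_eq_of_ne h]
    rfl

lemma ρ_coeff (k g : W₂) : groupRingQW.ρ k ≫ coeff g = coeff (k⁻¹ * g) := by
  apply ModuleCat.hom_ext
  refine Finsupp.lhom_ext fun (a : W₂) b ↦ ?_
  change Finsupp.mapDomain (fun x : W₂ ↦ k * x) (Finsupp.single a b) g =
    Finsupp.single a b (k⁻¹ * g)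
  rw [Finsupp.mapDomain_single]
  simp only [Finsupp.single_apply]
  congr 1
  rw [eq_inv_mul_iff_mul_eq]

variable {F : VectQ ⥤ DgQ} {X Y : DgQW}

/-- The equivariant extension of a map to a free object. -/
def freeHom (h : F.obj (ModuleCat.of ℚ ℚ) ⟶ X.V) : (F.mapAction W₂).obj groupRingQW ⟶ X where
  hom := ∑ g : W₂, F.map (coeff g) ≫ h ≫ X.ρ g
  comm k := by
    rw [Preadditive.comp_sum, Preadditive.sum_comp]
    refine Fintype.sum_equiv (Equiv.mulLeft k⁻¹) _ _ fun g ↦ ?_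
    change F.map (groupRingQW.ρ k) ≫ F.map (coeff g) ≫ h ≫ X.ρ g =
      (F.map (coeff (k⁻¹ * g)) ≫ h ≫ X.ρ (k⁻¹ * g)) ≫ X.ρ k
    rw [← ρ_coeff, F.map_comp]
    simp only [Category.assoc]
    congr 3
    rw [← End.mul_def, ← map_mul, mul_inv_cancel_left]

/-- At the unit of the group ring only the summand `g = 1` survives. So restriction along the unit
undoes the equivariant extension. -/
lemma one_freeHom [F.PreservesZeroMorphisms] (h : F.obj (ModuleCat.of ℚ ℚ) ⟶ X.V) :
    F.map groupRingOne ≫ (freeHom h).hom = h := by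
  change F.map groupRingOne ≫ ∑ g : W₂, F.map (coeff g) ≫ h ≫ X.ρ g = h
  rw [Preadditive.comp_sum, Finset.sum_eq_single 1]
  · rw [← F.map_comp_assoc, groupRingOne_coeff, if_pos rfl, F.map_id, Category.id_comp, map_one]
    exact Category.comp_id h
  · intro g _ hg
    rw [← F.map_comp_assoc, groupRingOne_coeff, if_neg hg, F.map_zero, zero_comp]
  · simp

lemma freeHom_comp (h : F.obj (ModuleCat.of ℚ ℚ) ⟶ X.V) (f : X ⟶ Y) :
    freeHom h ≫ f = freeHom (h ≫ f.hom) := by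
  ext : 1
  change (∑ g : W₂, F.map (coeff g) ≫ h ≫ X.ρ g) ≫ f.hom =
    ∑ g : W₂, F.map (coeff g) ≫ (h ≫ f.hom) ≫ Y.ρ g
  rw [Preadditive.sum_comp]
  refine Finset.sum_congr rfl fun g _ ↦ ?_
  simp only [Category.assoc, f.comm]

lemma app_freeHom {G : VectQ ⥤ DgQ} (τ : F ⟶ G) (h : G.obj (ModuleCat.of ℚ ℚ) ⟶ X.V) :
    τ.app groupRingQW.V ≫ (freeHom h).hom = (freeHom (τ.app _ ≫ h)).hom := by
  change τ.app _ ≫ ∑ g : W₂, G.map (coeff g) ≫ h ≫ X.ρ g =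
    ∑ g : W₂, F.map (coeff g) ≫ (τ.app _ ≫ h) ≫ X.ρ g
  rw [Preadditive.comp_sum]
  refine Finset.sum_congr rfl fun g _ ↦ ?_
  simp

instance (n : ℤ) : (disc n).PreservesZeroMorphisms where
  map_zero M N := by
    apply (evalCompCoyonedaCorepresentableByDoubleId (down_rel n) (ne_sub_one n) M).homEquiv.injective
    have h : (mkHomFromDouble (f := 𝟙 M) (K := double (𝟙 N) (down_rel n)) (down_rel n)
        (ne_sub_one n) 0 0 (by simp) (by simp)).f n = 0 := by
      rw [mkHomFromDouble_f₀, comp_zero]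
    have h' : (disc n).map (0 : M ⟶ N) = mkHomFromDouble (down_rel n)
        (ne_sub_one n) 0 0 (by simp) (by simp) := by
      simp [disc]
      rfl
    rw [h']
    change (doubleXIso₀ (𝟙 M) (down_rel n)).inv ≫ HomologicalComplex.Hom.f _ n =
      (doubleXIso₀ (𝟙 M) (down_rel n)).inv ≫ HomologicalComplex.Hom.f (0 : (disc n).obj M ⟶ (disc n).obj N) n
    exact congrArg (_ ≫ ·) h

/-- Extend the square equivariantly to the free objects, lift there, and restrict the lift along the
unit of the group ring. -/
lemma hasLiftingProperty_genCofQ {p : X ⟶ Y} {n : ℤ} (h : HasLiftingProperty (genCofQW n) p) :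
    HasLiftingProperty (genCofQ n) p.hom where
  sq_hasLift {u v} sq := by
    have sq' : CommSq (freeHom u) (genCofQW n) p (freeHom v) := ⟨by
      rw [freeHom_comp, sq.w]
      exact Action.Hom.ext (app_freeHom (sphereToDisc n) v).symm⟩
    obtain ⟨l, h₁, h₂⟩ : ∃ l : (disc n).obj groupRingQW.V ⟶ X.V,
        (sphereToDisc n).app groupRingQW.V ≫ l = (freeHom (F := sphere (n - 1)) u).hom ∧
          l ≫ p.hom = (freeHom (F := disc n) v).hom :=
      ⟨sq'.lift.hom, congrArg Action.Hom.hom sq'.fac_left, congrArg Action.Hom.hom sq'.fac_right⟩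
    refine ⟨⟨⟨(disc n).map groupRingOne ≫ l, ?_, ?_⟩⟩⟩
    · refine ((sphereToDisc n).naturality_assoc groupRingOne l).symm.trans ?_
      exact (congrArg (_ ≫ ·) h₁).trans (one_freeHom u)
    · rw [Category.assoc]
      exact (congrArg (_ ≫ ·) h₂).trans (one_freeHom v)

lemma hasLiftingProperty_genTrivCofQ {p : X ⟶ Y} {n : ℤ}
    (h : HasLiftingProperty (genTrivCofQW n) p) : HasLiftingProperty (genTrivCofQ n) p.hom where
  sq_hasLift {u v} sq := by
    have sq' : CommSq 0 (genTrivCofQW n) p (freeHom v) := ⟨(isZero_zero DgQW).eq_of_src _ _⟩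
    obtain ⟨l, h₂⟩ : ∃ l : (disc n).obj groupRingQW.V ⟶ X.V,
        l ≫ p.hom = (freeHom (F := disc n) v).hom :=
      ⟨sq'.lift.hom, congrArg Action.Hom.hom sq'.fac_right⟩
    refine ⟨⟨⟨(disc n).map groupRingOne ≫ l, (isZero_zero DgQ).eq_of_src _ _, ?_⟩⟩⟩
    rw [Category.assoc]
    exact (congrArg (_ ≫ ·) h₂).trans (one_freeHom v)

lemma hasElementLifts_of_genCofQW {p : X ⟶ Y} (h : ∀ n, HasLiftingProperty (genCofQW n) p) :
    DgQ.HasElementLifts p.hom :=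
  DgQ.hasElementLifts_of_genCofQ _ fun n ↦ hasLiftingProperty_genCofQ (h n)

lemma fibQW_of_genTrivCofQW {p : X ⟶ Y} (h : ∀ n, HasLiftingProperty (genTrivCofQW n) p) :
    fibQW p :=
  DgQ.fibQ_of_genTrivCofQ _ fun n ↦ hasLiftingProperty_genTrivCofQ (h n)

end DgQW

section Generation

instance (n : ℤ) : Mono (trivW.map (genCofQ n)) :=
  DgQW.mono_iff.2 (inferInstanceAs (Mono (genCofQ n)))

/-- The disc is contractible, so a lift of complexes exists, and averaging makes it equivariant. -/
lemma genTrivCofQW_llp (n : ℤ) : fibQW.llp (genTrivCofQW n) := fun _ _ p hp ↦ by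
  have := DgQ.Contractible.hasLiftingProperty p.hom (genTrivCofQW n).hom
    (isZero_V (isZero_zero DgQW)) (DgQ.contractible_disc n _) hp
  exact DgQW.hasLiftingProperty_of_hom _ _

lemma trivW_genTrivCofQ_llp (n : ℤ) : fibQW.llp (trivW.map (genTrivCofQ n)) := fun _ _ p hp ↦ by
  have := DgQ.Contractible.hasLiftingProperty p.hom (trivW.map (genTrivCofQ n)).hom
    (isZero_zero DgQ) (DgQ.contractible_disc n _) hp
  exact DgQW.hasLiftingProperty_of_hom _ _

lemma genCof_rlp_iff {X Y : AD} (p : X ⟶ Y) : genCof.rlp p ↔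
    (∀ n, HasLiftingProperty (constAD.map (genCofQ n)) p) ∧
      ∀ k n, HasLiftingProperty (genCofQW n) (p.right k) := by
  constructor
  · exact fun h ↦ ⟨fun n ↦ h _ (Or.inl ⟨n⟩), fun k n ↦
      ((skyStalkAdj k).hasLiftingProperty_iff _ p).1 (h _ (Or.inr ⟨(k, n)⟩))⟩
  · rintro ⟨h₁, h₂⟩ A B i (⟨⟨n⟩⟩ | ⟨⟨⟨k, n⟩⟩⟩)
    · exact h₁ n
    · exact ((skyStalkAdj k).hasLiftingProperty_iff _ p).2 (h₂ k n)

lemma genTrivCof_rlp_iff {X Y : AD} (p : X ⟶ Y) : genTrivCof.rlp p ↔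
    (∀ n, HasLiftingProperty (constAD.map (genTrivCofQ n)) p) ∧
      ∀ k n, HasLiftingProperty (genTrivCofQW n) (p.right k) := by
  constructor
  · exact fun h ↦ ⟨fun n ↦ h _ (Or.inl ⟨n⟩), fun k n ↦
      ((skyStalkAdj k).hasLiftingProperty_iff _ p).1 (h _ (Or.inr ⟨(k, n)⟩))⟩
  · rintro ⟨h₁, h₂⟩ A B i (⟨⟨n⟩⟩ | ⟨⟨⟨k, n⟩⟩⟩)
    · exact h₁ n
    · exact ((skyStalkAdj k).hasLiftingProperty_iff _ p).2 (h₂ k n)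

/-- The maps with the right lifting property against `I` are the stalkwise acyclic fibrations. -/
lemma genCof_rlp : genCof.rlp = stalkFib ⊓ stalkWeq := by
  ext X Y p
  rw [genCof_rlp_iff]
  constructor
  · rintro ⟨h₁, h₂⟩
    have h₁' : DgQ.HasElementLifts p.left :=
      DgQ.hasElementLifts_of_genCofQ _ fun n ↦ hasLiftingProperty_left _ _ (h₁ n)
    have h₂' (k : ℕ+) := DgQW.hasElementLifts_of_genCofQW (h₂ k)
    exact ⟨⟨h₁'.fibQ, fun k ↦ (h₂' k).fibQ⟩, ⟨h₁'.weqQ, fun k ↦ (h₂' k).weqQ⟩⟩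
  · rintro ⟨hf, hw⟩
    have h₁ := DgQ.hasElementLifts_of hf.1 hw.1
    have h₂ (k : ℕ+) : DgQ.HasElementLifts (p.right k).hom :=
      DgQ.hasElementLifts_of (hf.2 k) (hw.2 k)
    exact ⟨fun n ↦ hasLiftingProperty_constAD _ _ (DgQ.hasLiftingProperty_of_mono _ _ h₁)
      fun k ↦ DgQW.hasLiftingProperty_of_mono _ _ (h₂ k),
      fun k n ↦ DgQW.hasLiftingProperty_of_mono _ _ (h₂ k)⟩

/-- The maps with the right lifting property against `J` are the stalkwise fibrations. -/
lemma genTrivCof_rlp : genTrivCof.rlp = stalkFib := by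
  ext X Y p
  rw [genTrivCof_rlp_iff]
  constructor
  · rintro ⟨h₁, h₂⟩
    exact ⟨DgQ.fibQ_of_genTrivCofQ _ fun n ↦ hasLiftingProperty_left _ _ (h₁ n),
      fun k ↦ DgQW.fibQW_of_genTrivCofQW (h₂ k)⟩
  · intro h
    exact ⟨fun n ↦ hasLiftingProperty_constAD _ _
      (DgQ.Contractible.hasLiftingProperty _ _ (isZero_zero DgQ) (DgQ.contractible_disc n _) h.1)
      fun k ↦ trivW_genTrivCofQ_llp n _ (h.2 k),
      fun k n ↦ genTrivCofQW_llp n _ (h.2 k)⟩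

end Generation

end DihedralModel

end

/-! ### Presentability of the generators and the small object argument -/

open CategoryTheory Limits
open scoped MonoidalCategory

noncomputable section

namespace DihedralModel

open scoped ZeroObject
open Cardinal

attribute [local instance] Cardinal.fact_isRegular_aleph0

instance fact_isRegular_aleph_one : Fact (Cardinal.IsRegular.{0} ℵ₁) := ⟨isRegular_aleph_one⟩

lemma hasCardinalLT_aleph_one (T : Type) [Countable T] : HasCardinalLT T (ℵ₁ : Cardinal.{0}) :=
  (hasCardinalLT_iff_cardinal_mk_lt _ _).2 (Cardinal.mk_le_aleph0.trans_lt aleph0_lt_aleph_one)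

section Presentable

variable {J : Type} [SmallCategory J] [IsCardinalFiltered J (ℵ₁ : Cardinal.{0})] {F : J ⥤ AD}
  {c : Cocone F} {K : DgQ} {R : DgQW} [IsFinitelyPresentable.{0} K] [IsFinitelyPresentable.{0} R]

lemma exists_hom_left (hc : IsColimit c) (f : K ⟶ c.pt.left) :
    ∃ (j : J) (g : K ⟶ (F.obj j).left), g ≫ (c.ι.app j).left = f :=
  have := isFiltered_of_isCardinalFiltered J ℵ₁
  IsFinitelyPresentable.exists_hom_of_isColimit (isColimitOfPreserves stalkInf hc) f

lemma exists_hom_right (hc : IsColimit c) (k : ℕ+) (f : R ⟶ c.pt.right k) :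
    ∃ (j : J) (g : R ⟶ (F.obj j).right k), g ≫ (c.ι.app j).right k = f :=
  have := isFiltered_of_isCardinalFiltered J ℵ₁
  IsFinitelyPresentable.exists_hom_of_isColimit (isColimitOfPreserves (stalk k) hc) f

lemma exists_eq_left (hc : IsColimit c) {j : J} (f g : K ⟶ (F.obj j).left)
    (h : f ≫ (c.ι.app j).left = g ≫ (c.ι.app j).left) :
    ∃ (j' : J) (u : j ⟶ j'), f ≫ (F.map u).left = g ≫ (F.map u).left :=
  have := isFiltered_of_isCardinalFiltered J ℵ₁
  have := (isCardinalFiltered_aleph0_iff.{0} J).2 this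
  IsCardinalPresentable.exists_eq_of_isColimit' ℵ₀ (isColimitOfPreserves stalkInf hc) f g h

lemma exists_eq_right (hc : IsColimit c) {k : ℕ+} {j : J} (f g : R ⟶ (F.obj j).right k)
    (h : f ≫ (c.ι.app j).right k = g ≫ (c.ι.app j).right k) :
    ∃ (j' : J) (u : j ⟶ j'), f ≫ (F.map u).right k = g ≫ (F.map u).right k :=
  have := isFiltered_of_isCardinalFiltered J ℵ₁
  have := (isCardinalFiltered_aleph0_iff.{0} J).2 this
  IsCardinalPresentable.exists_eq_of_isColimit' ℵ₀ (isColimitOfPreserves (stalk k) hc) f g h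

/-- Countably many coincidences of maps to the stalks of a colimit occur at a common stage. -/
lemma exists_forall_eq_right (hc : IsColimit c) {j : J} (T : Type) [Countable T] (k : T → ℕ+)
    (f g : ∀ t, R ⟶ (F.obj j).right (k t))
    (h : ∀ t, f t ≫ (c.ι.app j).right (k t) = g t ≫ (c.ι.app j).right (k t)) :
    ∃ (j' : J) (u : j ⟶ j'), ∀ t, f t ≫ (F.map u).right (k t) = g t ≫ (F.map u).right (k t) := by
  -- Each coincidence has its own stage; an `ℵ₁`-filtered category dominates countably many stages
  -- compatibly.
  choose l u hu using fun t ↦ exists_eq_right hc (f t) (g t) (h t)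
  obtain ⟨m, a, b, hab⟩ := IsCardinalFiltered.wideSpan u (hasCardinalLT_aleph_one T)
  refine ⟨m, b, fun t ↦ ?_⟩
  have e : (F.map b).right (k t) = (F.map (u t)).right (k t) ≫ (F.map (a t)).right (k t) := by
    rw [← hab t, F.map_comp]
    rfl
  rw [e, reassoc_of% (hu t)]

end Presentable

lemma constHom_ext {M : DgQ} {X : AD} {u v : constAD.obj M ⟶ X} (h₁ : constLeft u = constLeft v)
    (h₂ : ∀ k, constRight u k = constRight v k) : u = v :=
  CommaMorphism.ext h₁ (funext h₂)

/-- If the component at `∞` of a map out of a constant object lifts along `γ`, then so do almost all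
components. -/
lemma exists_tail_factor {M : DgQ} [IsFinitelyPresentable.{0} M] {X Y : AD} (γ : X ⟶ Y)
    (a : M ⟶ X.left) (v : constAD.obj M ⟶ Y) (ha : a ≫ γ.left = constLeft v) :
    ∃ (m : ℕ+) (g : ∀ k : {k : ℕ+ // m ≤ k}, trivW.obj M ⟶ X.right k.1),
      trivW.map a ≫ X.hom = tailLift g ≫ toGerms X.right m ∧
        ∀ k, g k ≫ γ.right k.1 = constRight v k.1 := by
  obtain ⟨m, g, hg⟩ := exists_tail_lift (trivW.map a ≫ X.hom)
  obtain ⟨n, hn⟩ := exists_forall_tailπ_eq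
    (f := tailLift (n := m) (fun k ↦ constRight v k.1)) (g := g ≫ tailMap γ.right m) (by
      have hγ : trivW.map γ.left ≫ Y.hom = X.hom ≫ germs.map γ.right := γ.w
      rw [← constHom_condition v m, Category.assoc, ← toGerms_map_right, reassoc_of% hg, ← hγ,
        ← Functor.map_comp_assoc, ha])
  have hm : m ≤ max m n := le_max_left _ _
  refine ⟨max m n, fun k ↦ g ≫ tailπ X.right m ⟨k.1, hm.trans k.2⟩, ?_, fun k ↦ ?_⟩
  · rw [← hg, ← tailRes_toGerms X.right hm, ← Category.assoc]
    congr 1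
    exact tail_ext fun k ↦ by rw [Category.assoc, tailRes_π, tailLift_π]
  · have := hn k.1 ((le_max_right _ _).trans k.2) (hm.trans k.2) (hm.trans k.2)
    rw [tailLift_π, Category.assoc, tailMap_π] at this
    rw [this, Category.assoc]

/-- A map out of `c M` consists of countably many maps from finitely presentable objects, with a
condition that holds as soon as countably many equations do; hence `ℵ₁`. -/
instance isCardinalPresentable_constAD (M : DgQ) [IsFinitelyPresentable.{0} M] :
    IsCardinalPresentable (constAD.obj M) (ℵ₁ : Cardinal.{0}) := by
  apply isCardinalPresentable_of_factors
  · intro J _ _ F c hc f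
    obtain ⟨j₀, a₀, ha₀⟩ := exists_hom_left hc (constLeft f)
    choose j φ hφ using fun k ↦ exists_hom_right hc k (constRight f k)
    -- A common stage for the component at `∞` (`none`) and all components at `k` (`some k`).
    let j₁ := IsCardinalFiltered.max (κ := (ℵ₁ : Cardinal.{0})) (fun o : Option ℕ+ ↦ o.elim j₀ j)
      (hasCardinalLT_aleph_one _)
    let t₀ : j₀ ⟶ j₁ := IsCardinalFiltered.toMax (κ := (ℵ₁ : Cardinal.{0}))
      (fun o : Option ℕ+ ↦ o.elim j₀ j) (hasCardinalLT_aleph_one _) none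
    let t (k : ℕ+) : j k ⟶ j₁ := IsCardinalFiltered.toMax (κ := (ℵ₁ : Cardinal.{0}))
      (fun o : Option ℕ+ ↦ o.elim j₀ j) (hasCardinalLT_aleph_one _) (some k)
    obtain ⟨a, ha⟩ : ∃ a : M ⟶ (F.obj j₁).left, a ≫ (c.ι.app j₁).left = constLeft f :=
      ⟨a₀ ≫ (F.map t₀).left, by
        rw [← ha₀, Category.assoc, ← c.w t₀]
        rfl⟩
    obtain ⟨ψ, hψ⟩ : ∃ ψ : ∀ k, trivW.obj M ⟶ (F.obj j₁).right k,
        ∀ k, ψ k ≫ (c.ι.app j₁).right k = constRight f k :=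
      ⟨fun k ↦ φ k ≫ (F.map (t k)).right k, fun k ↦ by
        rw [← hφ, Category.assoc, ← c.w (t k)]
        rfl⟩
    -- At stage `j₁` the components `ψ` need not represent the germ of `a`. That germ is represented
    -- by `g`, which has the same image as `ψ` in the colimit, so the two agree at a later stage
    -- `j₂`.
    obtain ⟨m, g, hg, hg'⟩ := exists_tail_factor (c.ι.app j₁) a f ha
    obtain ⟨j₂, u, hu⟩ := exists_forall_eq_right hc {k : ℕ+ // m ≤ k} (fun k ↦ k.1)
      g (fun k ↦ ψ k.1) (fun k ↦ (hg' k).trans (hψ k.1).symm)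
    refine ⟨j₂, constHom (a ≫ (F.map u).left) (fun k ↦ ψ k ≫ (F.map u).right k) m ?_, ?_⟩
    · have hw : trivW.map (F.map u).left ≫ (F.obj j₂).hom =
        (F.obj j₁).hom ≫ germs.map (F.map u).right := (F.map u).w
      rw [Functor.map_comp_assoc, hw, reassoc_of% hg, toGerms_map_right, ← Category.assoc]
      congr 1
      exact tail_ext fun k ↦ by
        rw [Category.assoc, tailMap_π, tailLift_π, tailLift_π_assoc, hu k]
    · refine constHom_ext ?_ fun k ↦ ?_
      · change (a ≫ (F.map u).left) ≫ (c.ι.app j₂).left = _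
        rw [← ha, Category.assoc, ← c.w u]
        rfl
      · change (ψ k ≫ (F.map u).right k) ≫ (c.ι.app j₂).right k = _
        rw [← hψ, Category.assoc, ← c.w u]
        rfl
  · intro J _ _ F c hc j f g h
    obtain ⟨j₁, u₁, hu₁⟩ := exists_eq_left hc (constLeft f) (constLeft g)
      (congrArg constLeft h)
    obtain ⟨j₂, u₂, hu₂⟩ := exists_forall_eq_right hc ℕ+ id (constRight f) (constRight g)
      (fun k ↦ congrArg (fun u ↦ constRight u k) h)
    have := isFiltered_of_isCardinalFiltered J ℵ₁
    obtain ⟨j', v₁, v₂, hv⟩ := IsFiltered.span u₁ u₂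
    refine ⟨j', u₁ ≫ v₁, constHom_ext ?_ fun k ↦ ?_⟩
    · rw [F.map_comp]
      change constLeft f ≫ (F.map u₁).left ≫ _ = constLeft g ≫ (F.map u₁).left ≫ _
      rw [reassoc_of% hu₁]
    · rw [hv, F.map_comp]
      change constRight f k ≫ (F.map u₂).right k ≫ _ = constRight g k ≫ (F.map u₂).right k ≫ _
      exact (Category.assoc _ _ _).symm.trans ((congrArg (· ≫ _) (hu₂ k)).trans (Category.assoc _ _ _))

instance isCardinalPresentable_skyAD (k : ℕ+) (R : DgQW) [IsFinitelyPresentable.{0} R] :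
    IsCardinalPresentable ((skyAD k).obj R) (ℵ₁ : Cardinal.{0}) := by
  have : IsCardinalPresentable R (ℵ₁ : Cardinal.{0}) :=
    isCardinalPresentable_of_le (κ := ℵ₀) R aleph0_lt_aleph_one.le
  have : (stalk k).IsCardinalAccessible (ℵ₁ : Cardinal.{0}) := ⟨fun J _ _ ↦ inferInstance⟩
  exact (skyStalkAdj k).isCardinalPresentable_leftAdjoint_obj ℵ₁ R

instance : IsFinitelyPresentable.{0} groupRingQW.V :=
  inferInstanceAs (IsFinitelyPresentable.{0} ((ModuleCat.free ℚ).obj (Multiplicative (ZMod 2))))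

instance (n : ℤ) : IsFinitelyPresentable.{0} (((sphere n).mapAction W₂).obj groupRingQW) :=
  haveI : IsFinitelyPresentable.{0} (((sphere n).mapAction W₂).obj groupRingQW).V :=
    inferInstanceAs (IsFinitelyPresentable.{0} ((sphere n).obj groupRingQW.V))
  DgQW.isFinitelyPresentable _

instance : IsFinitelyPresentable.{0} (0 : DgQW) :=
  haveI : IsFinitelyPresentable.{0} (0 : DgQW).V :=
    isCardinalPresentable_of_iso (isZero_V (isZero_zero DgQW)).isoZero.symm ℵ₀
  DgQW.isFinitelyPresentable _

lemma isCardinalPresentable_of_genCof {A B : AD} (f : A ⟶ B) (hf : genCof f) :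
    IsCardinalPresentable A (ℵ₁ : Cardinal.{0}) := by
  obtain ⟨⟨n⟩⟩ | ⟨⟨k, n⟩⟩ := hf
  · infer_instance
  · infer_instance

lemma isCardinalPresentable_of_genTrivCof {A B : AD} (f : A ⟶ B) (hf : genTrivCof f) :
    IsCardinalPresentable A (ℵ₁ : Cardinal.{0}) := by
  obtain ⟨⟨n⟩⟩ | ⟨⟨k, n⟩⟩ := hf
  · infer_instance
  · infer_instance

lemma isSmallRel_of_isCardinalPresentable (A : AD) [IsCardinalPresentable A (ℵ₁ : Cardinal.{0})]
    (P : MorphismProperty AD) : IsSmallRel A P := by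
  -- Bounds for all subsets of size at most `ℵ₀` say that `J` is `ℵ₁`-filtered.
  refine ⟨ℵ₀, fun J _ _ _ _ _ hJ X Y f h ↦ ?_⟩
  have : IsCardinalFiltered J (ℵ₁ : Cardinal.{0}) := isCardinalFiltered_preorder _ _ fun K s hK ↦ by
    obtain ⟨j, hj⟩ := hJ (Set.range s) (mk_range_le.trans (by
      rwa [← succ_aleph0, Order.lt_succ_iff] at hK))
    exact ⟨j, fun k ↦ hj ⟨k, rfl⟩⟩
  have := preservesColimitsOfShape_of_isCardinalPresentable A ℵ₁ J
  infer_instance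

lemma isSmall_sup {C : Type*} [Category* C] (I I' : MorphismProperty C)
    [MorphismProperty.IsSmall.{0} I] [MorphismProperty.IsSmall.{0} I'] :
    MorphismProperty.IsSmall.{0} (I ⊔ I') where
  small_toSet := inferInstanceAs (Small.{0} (I.toSet ∪ I'.toSet :))

instance isSmall_genCof : MorphismProperty.IsSmall.{0} genCof := isSmall_sup _ _

instance isSmall_genTrivCof : MorphismProperty.IsSmall.{0} genTrivCof := isSmall_sup _ _

lemma hasSmallObjectArgument (I : MorphismProperty AD) [MorphismProperty.IsSmall.{0} I]
    (hI : ∀ ⦃A B : AD⦄ (f : A ⟶ B), I f → IsCardinalPresentable A (ℵ₁ : Cardinal.{0})) :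
    MorphismProperty.HasSmallObjectArgument.{0} I where
  exists_cardinal := by
    have : Nonempty (ℵ₁ : Cardinal.{0}).ord.ToType := by
      simpa using (isRegular_aleph_one.{0}).ord_pos.ne'
    have := WellFoundedLT.toOrderBot (ℵ₁ : Cardinal.{0}).ord.ToType
    refine ⟨ℵ₁, inferInstance, inferInstance, { preservesColimit {A _ _ _} i hi f hf := ?_ }⟩
    have := hI i hi
    have := preservesColimitsOfShape_of_isCardinalPresentable A ℵ₁
      (ℵ₁ : Cardinal.{0}).ord.ToType
    infer_instance

instance : MorphismProperty.HasSmallObjectArgument.{0} genCof :=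
  hasSmallObjectArgument _ fun _ _ ↦ isCardinalPresentable_of_genCof

instance : MorphismProperty.HasSmallObjectArgument.{0} genTrivCof :=
  hasSmallObjectArgument _ fun _ _ ↦ isCardinalPresentable_of_genTrivCof

end DihedralModel

end

/-! ### Limits and internal homs -/

open CategoryTheory Limits
open scoped MonoidalCategory

noncomputable section

namespace DihedralModel

open scoped ZeroObject
open Cardinal

attribute [local instance] Cardinal.fact_isRegular_aleph0

section Separating

/-- Represent the germ of `a` on a tail and take zero before it; thus constant objects see every map
into the stalk at `∞`. -/
lemma exists_constLeft_eq {M : DgQ} [IsFinitelyPresentable.{0} M] {X : AD} (a : M ⟶ X.left) :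
    ∃ u : constAD.obj M ⟶ X, constLeft u = a := by
  obtain ⟨m, g, hg⟩ := exists_tail_lift (trivW.map a ≫ X.hom)
  let φ (k : ℕ+) : trivW.obj M ⟶ X.right k :=
    if hk : m ≤ k then g ≫ tailπ X.right m ⟨k, hk⟩ else 0
  have hφ (k : ℕ+) (hk : m ≤ k) : φ k = g ≫ tailπ X.right m ⟨k, hk⟩ := dif_pos hk
  refine ⟨constHom a φ m ?_, rfl⟩
  rw [← hg]
  congr 1
  exact tail_ext fun k ↦ by rw [tailLift_π, hφ k.1 k.2]

/-- A small separating set of `𝒜(𝒟)`. -/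
def separatingSet : ObjectProperty AD :=
  ObjectProperty.ofObj (Sum.elim (fun n : ℤ ↦ constAD.obj ((disc n).obj (ModuleCat.of ℚ ℚ)))
    fun p : ℕ+ × ℤ ↦ (skyAD p.1).obj (((disc p.2).mapAction W₂).obj groupRingQW))

instance : ObjectProperty.Small.{0} separatingSet := by
  unfold separatingSet
  infer_instance

lemma DgQ.hom_ext_of_disc {K L : DgQ} {f g : K ⟶ L}
    (h : ∀ n (u : (disc n).obj (ModuleCat.of ℚ ℚ) ⟶ K), u ≫ f = u ≫ g) : f = g := by
  ext n x
  have := congr(HomologicalComplex.Hom.f $(h n (DgQ.discHom x)) n (DgQ.discGen n))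
  rwa [HomologicalComplex.comp_f, HomologicalComplex.comp_f, ModuleCat.comp_apply,
    ModuleCat.comp_apply, DgQ.discHom_discGen] at this

lemma DgQW.hom_ext_of_disc {K L : DgQW} {f g : K ⟶ L}
    (h : ∀ n (u : ((disc n).mapAction W₂).obj groupRingQW ⟶ K), u ≫ f = u ≫ g) : f = g := by
  refine Action.Hom.ext (DgQ.hom_ext_of_disc fun n u ↦ ?_)
  have h' := congrArg Action.Hom.hom (h n (DgQW.freeHom u))
  rw [DgQW.freeHom_comp, DgQW.freeHom_comp] at h'
  rw [← DgQW.one_freeHom (F := disc n) (u ≫ f.hom), h', DgQW.one_freeHom]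

lemma isSeparating_separatingSet : separatingSet.IsSeparating := by
  intro X Y f g h
  refine CommaMorphism.ext (DgQ.hom_ext_of_disc fun n u ↦ ?_) (funext fun k ↦
    DgQW.hom_ext_of_disc fun n u ↦ ?_)
  · obtain ⟨v, rfl⟩ := exists_constLeft_eq u
    exact congrArg CommaMorphism.left (h _ ⟨Sum.inl n⟩ v)
  · have := h _ ⟨Sum.inr (k, n)⟩ (((skyStalkAdj k).homEquiv _ _).symm u)
    have e (p : X ⟶ Y) := (skyStalkAdj k).homEquiv_naturality_right_symm u p
    exact ((skyStalkAdj k).homEquiv _ _).symm.injective (((e f).trans this).trans (e g).symm)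

end Separating

section Codetecting

instance isLeftAdjoint_forget : (Action.forget DgQ W₂).IsLeftAdjoint :=
  Functor.isLeftAdjoint_of_iso (Action.functorCategoryEquivalenceCompEvaluation DgQ W₂)

lemma existsUnique_of_adjunction {C D : Type*} [Category* C] [Category* D] {L : C ⥤ D} {R : D ⥤ C}
    (adj : L ⊣ R) {X Y : C} (f : X ⟶ Y) (G : D)
    (h : ∀ u : X ⟶ R.obj G, ∃! v : Y ⟶ R.obj G, f ≫ v = u) (u : L.obj X ⟶ G) :
    ∃! v : L.obj Y ⟶ G, L.map f ≫ v = u := by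
  obtain ⟨v, hv, hv'⟩ := h (adj.homEquiv _ _ u)
  refine ⟨(adj.homEquiv _ _).symm v, ?_, fun w hw ↦ ?_⟩
  · change L.map f ≫ (adj.homEquiv _ _).symm v = u
    rw [← adj.homEquiv_naturality_left_symm, hv, Equiv.symm_apply_apply]
  · rw [← hv' (adj.homEquiv _ _ w) (by
      change f ≫ _ = _
      rw [← adj.homEquiv_naturality_left, hw]), Equiv.symm_apply_apply]

lemma isIso_of_stalks {X Y : AD} (f : X ⟶ Y) [IsIso f.left] [∀ k, IsIso (f.right k)] :
    IsIso f := by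
  have : IsIso f.right := (isIso_pi_iff _).2 inferInstance
  exact (Comma.isoMk (asIso f.left) (asIso f.right) f.w).isIso_hom

/-- The underlying complex of the stalk at `k` has a right adjoint. -/
def stalkForgetAdj (k : ℕ+) : stalk k ⋙ Action.forget DgQ W₂ ⊣
    (Action.forget DgQ W₂).rightAdjoint ⋙ skyAD k :=
  (stalkSkyAdj k).comp (Adjunction.ofIsLeftAdjoint (Action.forget DgQ W₂))

/-- A small codetecting set of `𝒜(𝒟)`. -/
def codetectingSet : ObjectProperty AD :=
  ObjectProperty.ofObj fun o : Option ℕ+ ↦ o.elim (infAD.obj (coseparator DgQ))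
    fun k ↦ (skyAD k).obj ((Action.forget DgQ W₂).rightAdjoint.obj (coseparator DgQ))

instance : ObjectProperty.Small.{0} codetectingSet := by
  unfold codetectingSet
  infer_instance

/-- Isomorphisms are detected on underlying complexes of stalks. These are values of left adjoints,
so unique extension of maps to a coseparator of `DgQ` transposes to maps into the objects of the
set. -/
lemma isCodetecting_codetectingSet : codetectingSet.IsCodetecting := by
  have hG : IsCodetector (coseparator DgQ) := (isCoseparator_coseparator DgQ).isCodetector
  have hG' {K L : DgQ} (f : K ⟶ L)
      (h : ∀ u : K ⟶ coseparator DgQ, ∃! v : L ⟶ coseparator DgQ, f ≫ v = u) : IsIso f :=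
    hG _ fun Z hZ ↦ by
      obtain rfl : coseparator DgQ = Z := by simpa using hZ
      exact h
  intro X Y f h
  have h₁ : IsIso f.left :=
    hG' _ (existsUnique_of_adjunction stalkInfAdj f _ (h _ ⟨none⟩))
  have h₂ (k : ℕ+) : IsIso (f.right k) := by
    have : IsIso ((Action.forget DgQ W₂).map (f.right k)) :=
      hG' _ (existsUnique_of_adjunction (stalkForgetAdj k) f _ (h _ ⟨some k⟩))
    exact isIso_of_reflects_iso _ (Action.forget DgQ W₂)
  exact isIso_of_stalks f

instance : WellPowered.{0} ADᵒᵖ :=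
  wellPowered_of_isDetecting ((ObjectProperty.isDetecting_op_iff _).2 isCodetecting_codetectingSet)

/-- A cocomplete, well-copowered category with a small separating set is complete; this avoids any
continuity of germs. -/
instance : HasLimitsOfSize.{0, 0} AD :=
  hasLimits_of_hasColimits_of_isSeparating isSeparating_separatingSet

lemma isLeftAdjoint_of_preservesColimits {D : Type 1} [Category.{0} D] (F : AD ⥤ D)
    [PreservesColimits F] : F.IsLeftAdjoint :=
  isLeftAdjoint_of_preservesColimits_of_isSeparating isSeparating_separatingSet F

end Codetecting

section PreservesColimits

variable {J : Type} [SmallCategory J] {D : Type*} [Category* D]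

/-- Colimits in `𝒜(𝒟)` are detected on the stalks. -/
def isColimitOfStalks {F : J ⥤ AD} {c : Cocone F} (h₁ : IsColimit (stalkInf.mapCocone c))
    (h₂ : ∀ k, IsColimit ((stalk k).mapCocone c)) : IsColimit c := by
  let φ : colimit.cocone F ⟶ c := (colimit.isColimit F).descCoconeMorphism c
  have hφ {E : Type 1} [Category.{0} E] (G : AD ⥤ E) [PreservesColimitsOfShape J G]
      (h : IsColimit (G.mapCocone c)) : IsIso (G.map φ.hom) := by
    have := IsColimit.hom_isIso (isColimitOfPreserves G (colimit.isColimit F)) h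
      ((Cocone.functoriality F G).map φ)
    exact inferInstanceAs (IsIso ((Cocone.forget _).map ((Cocone.functoriality F G).map φ)))
  have : IsIso φ.hom.left := hφ stalkInf h₁
  have (k : ℕ+) : IsIso (φ.hom.right k) := hφ (stalk k) (h₂ k)
  have : IsIso ((colimit.isColimit F).desc c) := isIso_of_stalks φ.hom
  exact IsColimit.ofPointIso (colimit.isColimit F)

lemma preservesColimitsOfShape_of_stalks (H : D ⥤ AD)
    [PreservesColimitsOfShape J (H ⋙ stalkInf)]
    [∀ k, PreservesColimitsOfShape J (H ⋙ stalk k)] : PreservesColimitsOfShape J H where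
  preservesColimit := ⟨fun hc ↦ ⟨isColimitOfStalks
    (isColimitOfPreserves (H ⋙ stalkInf) hc) fun k ↦ isColimitOfPreserves (H ⋙ stalk k) hc⟩⟩

instance (X : AD) : PreservesColimitsOfShape J (MonoidalCategory.tensorLeft X) := by
  have : PreservesColimitsOfShape J (MonoidalCategory.tensorLeft X ⋙ stalkInf) :=
    inferInstanceAs (PreservesColimitsOfShape J (stalkInf ⋙ MonoidalCategory.tensorLeft X.left))
  have (k : ℕ+) : PreservesColimitsOfShape J (MonoidalCategory.tensorLeft X ⋙ stalk k) :=
    inferInstanceAs (PreservesColimitsOfShape J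
      (stalk k ⋙ MonoidalCategory.tensorLeft (C := DgQW) (X.right k)))
  exact preservesColimitsOfShape_of_stalks _

instance : PreservesColimitsOfShape J constAD := by
  have : PreservesColimitsOfShape J (constAD ⋙ stalkInf) :=
    inferInstanceAs (PreservesColimitsOfShape J (𝟭 DgQ))
  have (k : ℕ+) : PreservesColimitsOfShape J (constAD ⋙ stalk k) :=
    inferInstanceAs (PreservesColimitsOfShape J trivW)
  exact preservesColimitsOfShape_of_stalks _

/-- Colimits and tensor products are both stalkwise, so tensoring is cocontinuous and the special
adjoint functor theorem gives the internal hom. -/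
instance (X : AD) : (MonoidalCategory.tensorLeft X).IsLeftAdjoint :=
  haveI : PreservesColimits (MonoidalCategory.tensorLeft X) := ⟨inferInstance⟩
  isLeftAdjoint_of_preservesColimits _

instance monoidalClosed_AD : MonoidalClosed AD where
  closed X :=
    { rightAdj := (MonoidalCategory.tensorLeft X).rightAdjoint
      adj := Adjunction.ofIsLeftAdjoint _ }

end PreservesColimits

end DihedralModel

end

/-! ### The pushout-product of cofibrations -/

open CategoryTheory Limits
open scoped MonoidalCategory

noncomputable section

section PushoutProduct

open MonoidalCategory

variable {C : Type*} [Category* C] [MonoidalCategory C] [MonoidalClosed C] [HasPullbacks C]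
  {I P : MorphismProperty C}

/-- By the two-variable adjunction, lifting the pushout-product with `g` against `p` means lifting
`g` against the pullback-hom of `i` and `p`. If this works for all of `I`, the pullback-hom lies in
`I.rlp`. -/
lemma CategoryTheory.pushoutProduct_llp_right {X₁ X₂ : C} {i : X₁ ⟶ X₂}
    (h : ∀ ⦃Y₁ Y₂ : C⦄ (g : Y₁ ⟶ Y₂), I g →
      ∃ sq : (curriedTensor C).PushoutObjObj i g, P.llp sq.ι)
    {Y₁ Y₂ : C} {j : Y₁ ⟶ Y₂} (hj : I.rlp.llp j) (sq : (curriedTensor C).PushoutObjObj i j) :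
    P.llp sq.ι := by
  intro U V p hp
  let sq₁₃ := Functor.PullbackObjObj.ofHasPullback MonoidalClosed.internalHom i p
  refine (MonoidalClosed.internalHomAdjunction₂.hasLiftingProperty_iff sq sq₁₃).2 (hj _ ?_)
  intro Y₁' Y₂' g hg
  obtain ⟨sq', hsq'⟩ := h g hg
  exact (MonoidalClosed.internalHomAdjunction₂.hasLiftingProperty_iff sq' sq₁₃).1 (hsq' p hp)

/-- The pushout-product axiom may be checked on generators. -/
lemma CategoryTheory.pushoutProduct_llp [BraidedCategory C] [HasPushouts C]
    (h : ∀ ⦃X₁ X₂ Y₁ Y₂ : C⦄ (f : X₁ ⟶ X₂) (g : Y₁ ⟶ Y₂), I f → I g →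
      ∃ sq : (curriedTensor C).PushoutObjObj f g, P.llp sq.ι)
    {X₁ X₂ Y₁ Y₂ : C} {i : X₁ ⟶ X₂} {j : Y₁ ⟶ Y₂} (hi : I.rlp.llp i) (hj : I.rlp.llp j)
    (sq : (curriedTensor C).PushoutObjObj i j) : P.llp sq.ι := by
  -- The braiding swaps the factors, so the one-variable statement can be used once in each
  -- variable.
  have comm {A B A' B' : C} {a : A ⟶ B} {a' : A' ⟶ B'} (s : (curriedTensor C).PushoutObjObj a a')
      (hs : P.llp s.ι) : ∃ s' : (curriedTensor C).PushoutObjObj a' a, P.llp s'.ι :=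
    ⟨s.flipTensor,
      P.llp.comp_mem _ _ hs (MorphismProperty.of_isIso P.llp _)⟩
  refine pushoutProduct_llp_right (fun Z₁ Z₂ g hg ↦ ?_) hj sq
  exact comm _ (pushoutProduct_llp_right (fun _ _ f hf ↦ h g f hg hf) hi
    (Functor.PushoutObjObj.ofHasPushout _ _ _))

end PushoutProduct

namespace DihedralModel

open scoped ZeroObject
open MonoidalCategory HomotopicalAlgebra

lemma DgQ.isZero_tensor {K : DgQ} (h : IsZero K) (L : DgQ) : IsZero (K ⊗ L) :=
  (IsInitial.isInitialObj (tensorRight L) K h.isInitial).isZero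

lemma DgQW.isZero_tensor {K : DgQW} (h : IsZero K) (L : DgQW) : IsZero (K ⊗ L) :=
  (IsInitial.isInitialObj (tensorRight L) K h.isInitial).isZero

lemma isZero_of_isPushout {C : Type*} [Category* C] [HasZeroMorphisms C] {A X Y Z : C} {f : A ⟶ X}
    {g : A ⟶ Y} {inl : X ⟶ Z} {inr : Y ⟶ Z} (sq : IsPushout f g inl inr) (hX : IsZero X)
    (hY : IsZero Y) : IsZero Z :=
  (IsZero.iff_id_eq_zero _).2 (sq.hom_ext (hX.eq_of_src _ _) (hY.eq_of_src _ _))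

section Skyscraper

/-- An object of `𝒜(𝒟)` is concentrated at `k` if all the other stalks vanish. -/
structure IsConcentrated (k : ℕ+) (X : AD) : Prop where
  left : IsZero X.left
  right : ∀ l, l ≠ k → IsZero (X.right l)

lemma isConcentrated_skyAD (k : ℕ+) (R : DgQW) : IsConcentrated k ((skyAD k).obj R) :=
  ⟨isZero_zero _, fun _ hl ↦ isZero_single R hl⟩

lemma IsConcentrated.tensor {k : ℕ+} {X : AD} (h : IsConcentrated k X) (Y : AD) :
    IsConcentrated k (X ⊗ Y) :=
  ⟨DgQ.isZero_tensor h.left _, fun l hl ↦ DgQW.isZero_tensor (h.right l hl) _⟩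

lemma IsConcentrated.of_isPushout {k : ℕ+} {A X Y Z : AD} {f : A ⟶ X}
    {g : A ⟶ Y} {inl : X ⟶ Z} {inr : Y ⟶ Z} (sq : IsPushout f g inl inr) (hX : IsConcentrated k X)
    (hY : IsConcentrated k Y) : IsConcentrated k Z :=
  ⟨isZero_of_isPushout (sq.map stalkInf) hX.left hY.left,
    fun l hl ↦ isZero_of_isPushout (sq.map (stalk l)) (hX.right l hl) (hY.right l hl)⟩

lemma isIso_of_isZero {C : Type*} [Category* C] [HasZeroMorphisms C] {X Y : C} (f : X ⟶ Y)
    (hX : IsZero X) (hY : IsZero Y) : IsIso f := ⟨0, hX.eq_of_src _ _, hY.eq_of_src _ _⟩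

/-- An object concentrated at `k` is the skyscraper on its stalk, so its lifting problems take place
at that stalk. -/
lemma IsConcentrated.isIso_counit {k : ℕ+} {X : AD} (h : IsConcentrated k X) :
    IsIso ((skyStalkAdj k).counit.app X) := by
  have h₁ : IsIso ((skyStalkAdj k).counit.app X).left := isIso_of_isZero _ (isZero_zero _) h.left
  have h₂ (l : ℕ+) : IsIso (((skyStalkAdj k).counit.app X).right l) := by
    by_cases hl : l = k
    · subst hl
      obtain ⟨u, hu, e⟩ : ∃ u : X.right l ⟶ (GradedObject.single l).obj (X.right l) l,
          IsIso u ∧ u ≫ ((skyStalkAdj l).counit.app X).right l = 𝟙 _ :=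
        ⟨(skyStalkAdj l).unit.app (X.right l),
          inferInstanceAs (IsIso ((GradedObject.singleObjApplyIso l (X.right l)).inv ≫
            𝟙 ((GradedObject.single l).obj (X.right l) l))),
          (skyStalkAdj l).right_triangle_components X⟩
      exact @IsIso.of_isIso_fac_left DgQW _ _ _ _ _ _ _ hu inferInstance e
    · exact isIso_of_isZero _ (isZero_single _ hl) (h.right l hl)
  exact isIso_of_stalks _

lemma IsConcentrated.hasLiftingProperty {k : ℕ+} {A B X Y : AD} (hA : IsConcentrated k A)
    (hB : IsConcentrated k B) (i : A ⟶ B) (p : X ⟶ Y)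
    [HasLiftingProperty (i.right k) (p.right k)] : HasLiftingProperty i p := by
  have := hA.isIso_counit
  have := hB.isIso_counit
  have h : HasLiftingProperty ((skyAD k).map ((stalk k).map i)) p :=
    ((skyStalkAdj k).hasLiftingProperty_iff _ p).2 ‹_›
  exact HasLiftingProperty.of_arrow_iso_left (Arrow.isoMk (asIso ((skyStalkAdj k).counit.app A))
    (asIso ((skyStalkAdj k).counit.app B)) ((skyStalkAdj k).counit.naturality i).symm) p

end Skyscraper

section Stalks

variable {X₁ X₂ Y₁ Y₂ : AD} {i : X₁ ⟶ X₂} {j : Y₁ ⟶ Y₂}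
    (sq : (curriedTensor AD).PushoutObjObj i j)

/-- Taking the underlying complex of the stalk preserves pushouts and tensor products, which reduces
this to complexes. -/
lemma mono_right_pushoutProduct (k : ℕ+) [Mono (i.right k)] [Mono (j.right k)] :
    Mono (sq.ι.right k) := by
  have : Mono (i.right k).hom := DgQW.mono_iff.1 inferInstance
  have : Mono (j.right k).hom := DgQW.mono_iff.1 inferInstance
  exact DgQW.mono_iff.2 (DgQ.mono_pushoutProduct (f := (i.right k).hom) (g := (j.right k).hom)
    (sq.isPushout.map (stalk k ⋙ Action.forget DgQ W₂)) _
    (congrArg (fun u ↦ (stalk k ⋙ Action.forget DgQ W₂).map u) sq.inl_ι)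
    (congrArg (fun u ↦ (stalk k ⋙ Action.forget DgQ W₂).map u) sq.inr_ι))

lemma stalkWeq_pushoutProduct [Mono i.left] [Mono j.left] [∀ k, Mono (i.right k)]
    [∀ k, Mono (j.right k)] (h : stalkWeq i ∨ stalkWeq j) : stalkWeq sq.ι := by
  refine ⟨DgQ.weqQ_pushoutProduct (h.imp (fun h ↦ h.1) fun h ↦ h.1) (sq.isPushout.map stalkInf) _
    (congrArg CommaMorphism.left sq.inl_ι) (congrArg CommaMorphism.left sq.inr_ι), fun k ↦ ?_⟩
  have : Mono (i.right k).hom := DgQW.mono_iff.1 inferInstance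
  have : Mono (j.right k).hom := DgQW.mono_iff.1 inferInstance
  exact DgQ.weqQ_pushoutProduct (f := (i.right k).hom) (g := (j.right k).hom)
    (h.imp (fun h ↦ h.2 k) fun h ↦ h.2 k)
    (sq.isPushout.map (stalk k ⋙ Action.forget DgQ W₂)) _
    (congrArg (fun u ↦ (stalk k ⋙ Action.forget DgQ W₂).map u) sq.inl_ι)
    (congrArg (fun u ↦ (stalk k ⋙ Action.forget DgQ W₂).map u) sq.inr_ι)

end Stalks

section Const

lemma toGerms_μ (V V' : ℕ+ → DgQW) (n : ℕ+) :
    (toGerms V n ⊗ₘ toGerms V' n) ≫ Functor.LaxMonoidal.μ germs V V' =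
      tailMu V V' n ≫ toGerms (fun k ↦ V k ⊗ V' k) n :=
  (ι_colimMu_assoc _ _ n (colim.map (Functor.LaxMonoidal.μ (tails DgQW) V V'))).trans
    (ι_colimMap (Functor.LaxMonoidal.μ (tails DgQW) V V') n)

/-- The comparison `c (K ⊗ L) ⟶ c K ⊗ c L`. -/
def constTensor (K L : DgQ) : constAD.obj (K ⊗ L) ⟶ constAD.obj K ⊗ constAD.obj L :=
  constHom (X := constAD.obj K ⊗ constAD.obj L) (𝟙 _)
    (fun _ ↦ Functor.OplaxMonoidal.δ trivW K L) 1 (by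
    let t (M : DgQ) : trivW.obj M ⟶ tailProd (fun _ ↦ trivW.obj M) 1 := tailLift fun _ ↦ 𝟙 _
    have h : (t K ⊗ₘ t L) ≫ tailMu (fun _ ↦ trivW.obj K) (fun _ ↦ trivW.obj L) 1 =
        tailLift fun _ ↦ 𝟙 _ := tail_ext fun k ↦ by
      rw [Category.assoc, tailMu_π, tensorHom_comp_tensorHom, tailLift_π, tailLift_π, tailLift_π,
        id_tensorHom_id]
    have h' : (diagGerm K ⊗ₘ diagGerm L) ≫
        Functor.LaxMonoidal.μ germs (fun _ ↦ trivW.obj K) (fun _ ↦ trivW.obj L) =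
          tailLift (V := fun _ ↦ trivW.obj K ⊗ trivW.obj L) (fun _ ↦ 𝟙 _) ≫ toGerms _ 1 := by
      rw [← h, Category.assoc, ← toGerms_μ, tensorHom_comp_tensorHom_assoc]
      rfl
    refine (congrArg (· ≫ _) (trivW.map_id _)).trans ((Category.id_comp _).trans ?_)
    refine (congrArg (Functor.OplaxMonoidal.δ trivW K L ≫ ·) h').trans ?_
    refine (Category.assoc _ _ _).symm.trans (congrArg (· ≫ _) (tail_ext fun k ↦ ?_))
    rw [Category.assoc, tailLift_π, Category.comp_id]
    exact (tailLift_π (V := fun _ ↦ trivW.obj K ⊗ trivW.obj L)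
      (fun _ ↦ Functor.OplaxMonoidal.δ trivW K L) k).symm)

instance (K L : DgQ) : IsIso (constTensor K L) := by
  have : IsIso (constTensor K L).left := inferInstanceAs (IsIso (𝟙 (K ⊗ L)))
  have (k : ℕ+) : IsIso ((constTensor K L).right k) := by
    have : IsIso ((Action.forget DgQ W₂).map ((constTensor K L).right k)) :=
      inferInstanceAs (IsIso (𝟙 (K ⊗ L)))
    exact isIso_of_reflects_iso _ (Action.forget DgQ W₂)
  exact isIso_of_stalks _

lemma constTensor_naturality {K K' L L' : DgQ} (f : K ⟶ K') (g : L ⟶ L') :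
    constAD.map (f ⊗ₘ g) ≫ constTensor K' L' =
      constTensor K L ≫ (constAD.map f ⊗ₘ constAD.map g) :=
  constHom_ext ((Category.comp_id _).trans (Category.id_comp _).symm)
    fun _ ↦ Action.Hom.ext ((Category.comp_id _).trans (Category.id_comp _).symm)

instance : constAD.IsLeftAdjoint :=
  haveI : PreservesColimits constAD := ⟨inferInstance⟩
  isLeftAdjoint_of_preservesColimits_of_isSeparating (isSeparator_separator DgQ) constAD

/-- The image under `c` of an injection lifts against the maps against which the generating
cofibrations lift. -/
lemma hasLiftingProperty_constAD_of_mono {A B : DgQ} (i : A ⟶ B) [Mono i] {X Y : AD} (p : X ⟶ Y)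
    (hp : genCof.rlp p) : HasLiftingProperty (constAD.map i) p := by
  let adj := Adjunction.ofIsLeftAdjoint constAD
  -- Transposed to `DgQ`, the image of `p` under the right adjoint of `c` lifts against the
  -- generators `genCofQ`, hence against all injections.
  refine (adj.hasLiftingProperty_iff i p).2 (DgQ.hasLiftingProperty_of_mono _ _
    (DgQ.hasElementLifts_of_genCofQ _ fun n ↦ ?_))
  exact (adj.hasLiftingProperty_iff _ p).1 (((genCof_rlp_iff p).1 hp).1 n)

/-- The pushout-product of constant maps is constant. -/
def constPushoutObjObj {K K' L L' : DgQ} {f : K ⟶ K'} {g : L ⟶ L'}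
    (sq : (curriedTensor DgQ).PushoutObjObj f g) :
    (curriedTensor AD).PushoutObjObj (constAD.map f) (constAD.map g) where
  pt := constAD.obj sq.pt
  inl := inv (constTensor K' L) ≫ constAD.map sq.inl
  inr := inv (constTensor K L') ≫ constAD.map sq.inr
  isPushout := (sq.isPushout.map constAD).of_iso (asIso (constTensor K L))
    (asIso (constTensor K' L)) (asIso (constTensor K L')) (Iso.refl _)
    (by simpa using constTensor_naturality f (𝟙 L)) (by simpa using constTensor_naturality (𝟙 K) g)
    (by simp) (by simp)
  ι := constAD.map sq.ι ≫ constTensor K' L'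
  inl_ι := by
    rw [Category.assoc, ← Functor.map_comp_assoc, sq.inl_ι, IsIso.inv_comp_eq]
    simpa using constTensor_naturality (𝟙 K') g
  inr_ι := by
    rw [Category.assoc, ← Functor.map_comp_assoc, sq.inr_ι, IsIso.inv_comp_eq]
    simpa using constTensor_naturality f (𝟙 L')

end Const

section PushoutProduct

lemma mono_right_of_cof {X Y : AD} {f : X ⟶ Y} (hf : genCof.rlp.llp f) (k : ℕ+) :
    Mono (f.right k) :=
  mono_right_of_llp (genCof_rlp ▸ hf) k

lemma mono_left_of_cof {X Y : AD} {f : X ⟶ Y} (hf : genCof.rlp.llp f) : Mono f.left :=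
  mono_left_of_llp (genCof_rlp ▸ hf)

/-- Tensoring with a skyscraper yields objects concentrated at `k`, so the lifting problem is one
about an injection of stalks at `k`. -/
lemma pushoutProduct_skyAD_llp {k : ℕ+} {R R' : DgQW} {f : R ⟶ R'} [Mono f] {Y₁ Y₂ : AD}
    {g : Y₁ ⟶ Y₂} [Mono (g.right k)]
    (sq : (curriedTensor AD).PushoutObjObj ((skyAD k).map f) g) : genCof.rlp.llp sq.ι := by
  intro U V p hp
  have : Mono (((skyAD k).map f).right k) :=
    ((MorphismProperty.monomorphisms DgQW).arrow_mk_iso_iff (singleMapIso f k)).2 ‹Mono f›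
  have h₁ := isConcentrated_skyAD k R
  have h₂ := isConcentrated_skyAD k R'
  have := mono_right_pushoutProduct sq k
  have : HasLiftingProperty (sq.ι.right k) (p.right k) := DgQW.hasLiftingProperty_of_mono _ _
    (DgQW.hasElementLifts_of_genCofQW (((genCof_rlp_iff p).1 hp).2 k))
  exact (IsConcentrated.of_isPushout sq.isPushout (h₂.tensor _) (h₁.tensor _)).hasLiftingProperty
    (h₂.tensor _) sq.ι p

lemma genCof_le : genCof ≤ genCof.rlp.llp := MorphismProperty.le_llp_rlp _

/-- The pushout-product of two cofibrations is a cofibration. -/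
lemma pushoutProduct_cof {X₁ X₂ Y₁ Y₂ : AD} {i : X₁ ⟶ X₂} {j : Y₁ ⟶ Y₂} (hi : genCof.rlp.llp i)
    (hj : genCof.rlp.llp j) (sq : (curriedTensor AD).PushoutObjObj i j) :
    genCof.rlp.llp sq.ι := by
  refine pushoutProduct_llp (I := genCof) (fun A₁ A₂ B₁ B₂ f g hf hg ↦ ?_) hi hj sq
  have hf' := mono_right_of_cof (genCof_le _ hf)
  have hg' := mono_right_of_cof (genCof_le _ hg)
  obtain ⟨⟨n⟩⟩ | ⟨⟨k, n⟩⟩ := hf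
  · obtain ⟨⟨m⟩⟩ | ⟨⟨k, m⟩⟩ := hg
    · let sq₀ := Functor.PushoutObjObj.ofHasPushout (curriedTensor DgQ) (genCofQ n) (genCofQ m)
      have : Mono sq₀.ι := DgQ.mono_pushoutProduct sq₀.isPushout sq₀.ι sq₀.inl_ι sq₀.inr_ι
      -- For two constant generators the pushout-product is, up to isomorphism, `c` of an injection
      -- of complexes.
      refine ⟨constPushoutObjObj sq₀, MorphismProperty.comp_mem _ _ _ (fun _ _ p hp ↦
        hasLiftingProperty_constAD_of_mono _ p hp) (MorphismProperty.of_isIso _ _)⟩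
    · let sq₀ := Functor.PushoutObjObj.ofHasPushout (curriedTensor AD) ((skyAD k).map (genCofQW m))
        (constAD.map (genCofQ n))
      exact ⟨sq₀.flipTensor, MorphismProperty.comp_mem _ _ _ (pushoutProduct_skyAD_llp sq₀)
        (MorphismProperty.of_isIso _ _)⟩
  · exact ⟨Functor.PushoutObjObj.ofHasPushout _ _ _, pushoutProduct_skyAD_llp _⟩

end PushoutProduct

end DihedralModel

end

/-! ### The model structure -/

open CategoryTheory Limits
open scoped MonoidalCategory

noncomputable section

namespace DihedralModel

open MonoidalCategory HomotopicalAlgebra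

instance : weqQW.HasTwoOutOfThreeProperty :=
  inferInstanceAs (weqQ.inverseImage (Action.forget DgQ W₂)).HasTwoOutOfThreeProperty

instance : stalkWeq.HasTwoOutOfThreeProperty where
  comp_mem _ _ hf hg := ⟨weqQ.comp_mem _ _ hf.1 hg.1, fun k ↦ weqQW.comp_mem _ _ (hf.2 k) (hg.2 k)⟩
  of_postcomp f g hg hfg := ⟨weqQ.of_postcomp f.left g.left hg.1 hfg.1,
    fun k ↦ weqQW.of_postcomp (f.right k) (g.right k) (hg.2 k) (hfg.2 k)⟩
  of_precomp f g hf hfg := ⟨weqQ.of_precomp f.left g.left hf.1 hfg.1,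
    fun k ↦ weqQW.of_precomp (f.right k) (g.right k) (hf.2 k) (hfg.2 k)⟩

lemma stalkWeq_of_genTrivCof_rlp_llp {X Y : AD} {f : X ⟶ Y} (hf : genTrivCof.rlp.llp f) :
    stalkWeq f := by
  rw [genTrivCof_rlp] at hf
  exact ⟨DgQ.weqQ_of_llp (llp_left_of_llp_stalkFib hf),
    fun k ↦ DgQW.weqQ_of_llp (llp_right_of_llp_stalkFib hf k)⟩

/-- The maps generated by `J` are the acyclic cofibrations. -/
lemma genTrivCof_rlp_llp : genTrivCof.rlp.llp = genCof.rlp.llp ⊓ stalkWeq := by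
  apply le_antisymm
  · intro X Y f hf
    refine ⟨MorphismProperty.antitone_llp ?_ _ hf, stalkWeq_of_genTrivCof_rlp_llp hf⟩
    rw [genCof_rlp, genTrivCof_rlp]
    exact inf_le_left
  · intro X Y f hf
    obtain ⟨Z, i, p, fac, hi, hp⟩ : ∃ (Z : AD) (i : X ⟶ Z) (p : Z ⟶ Y), i ≫ p = f ∧
        genTrivCof.rlp.llp i ∧ stalkFib p := by
      have h := MorphismProperty.factorizationData genTrivCof.rlp.llp genTrivCof.rlp f
      exact ⟨_, h.i, h.p, h.fac, h.hi, (congrArg (fun P ↦ P h.p) genTrivCof_rlp).mp h.hp⟩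
    -- Retract argument: by two-out-of-three `p` is an acyclic fibration, so `f` lifts against it
    -- and is a retract of `i`.
    have hp' : stalkWeq p := stalkWeq.of_precomp i p (stalkWeq_of_genTrivCof_rlp_llp hi) (fac ▸ hf.2)
    have : HasLiftingProperty f p := hf.1 _ (by
      rw [genCof_rlp]
      exact ⟨hp, hp'⟩)
    exact MorphismProperty.of_retract (RetractArrow.ofLeftLiftingProperty fac) hi

/-- The projective model structure on `𝒜(𝒟)`. -/
abbrev modelCategoryAD : ModelCategory AD :=
  letI : CategoryWithFibrations AD := ⟨stalkFib⟩
  letI : CategoryWithCofibrations AD := ⟨genCof.rlp.llp⟩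
  letI : CategoryWithWeakEquivalences AD := ⟨stalkWeq⟩
  haveI h₁ : trivialCofibrations AD = genTrivCof.rlp.llp := genTrivCof_rlp_llp.symm
  haveI h₂ : trivialFibrations AD = genCof.rlp := genCof_rlp.symm
  haveI h₃ : fibrations AD = genTrivCof.rlp := genTrivCof_rlp.symm
  haveI h₄ : cofibrations AD = genCof.rlp.llp := rfl
  haveI : (weakEquivalences AD).HasTwoOutOfThreeProperty :=
    inferInstanceAs stalkWeq.HasTwoOutOfThreeProperty
  haveI : (cofibrations AD).IsWeakFactorizationSystem (trivialFibrations AD) := by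
    rw [h₂, h₄]
    exact .mk' _ _ fun i p hi hp ↦ hi p hp
  haveI : (trivialCofibrations AD).IsWeakFactorizationSystem (fibrations AD) := by
    rw [h₁, h₃]
    exact .mk' _ _ fun i p hi hp ↦ hi p hp
  ModelCategory.mk' AD

/-! ### The remaining axioms -/

section Axioms

attribute [local instance] modelCategoryAD

lemma trivialFibrations_AD : trivialFibrations AD = genCof.rlp := genCof_rlp.symm

lemma trivialCofibrations_AD : trivialCofibrations AD = genTrivCof.rlp.llp :=
  genTrivCof_rlp_llp.symm

lemma isCompleteFunctorial_AD : IsCompleteFunctorial AD where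
  hasLimits := inferInstance
  hasColimits := inferInstance
  factor_cof := by
    rw [trivialFibrations_AD]
    exact inferInstanceAs (MorphismProperty.HasFunctorialFactorization genCof.rlp.llp genCof.rlp)
  factor_trivCof := by
    rw [trivialCofibrations_AD, show fibrations AD = genTrivCof.rlp from genTrivCof_rlp.symm]
    infer_instance

lemma isCofibrantlyGeneratedBy_AD : IsCofibrantlyGeneratedBy genCof genTrivCof where
  isSmall_cof := inferInstance
  isSmall_trivCof := inferInstance
  small_cof A _ f hf :=
    haveI := isCardinalPresentable_of_genCof f hf
    isSmallRel_of_isCardinalPresentable A _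
  small_trivCof A _ f hf :=
    haveI := isCardinalPresentable_of_genTrivCof f hf
    isSmallRel_of_isCardinalPresentable A _
  fibrations_eq := genTrivCof_rlp.symm
  trivialFibrations_eq := trivialFibrations_AD

/-- Every complex of rational vector spaces is flat, and the tensor product is stalkwise; this
yields the unit axiom. -/
lemma stalkWeq_whiskerRight {X Y : AD} {f : X ⟶ Y} (hf : stalkWeq f) (Z : AD) :
    stalkWeq (f ▷ Z) :=
  ⟨DgQ.weqQ_whiskerRight _ hf.1 _, fun k ↦ DgQ.weqQ_whiskerRight _ (hf.2 k) _⟩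

lemma stalkWeq_whiskerLeft {X Y : AD} {f : X ⟶ Y} (hf : stalkWeq f) (Z : AD) :
    stalkWeq (Z ◁ f) :=
  ⟨DgQ.weqQ_whiskerLeft _ hf.1 _, fun k ↦ DgQ.weqQ_whiskerLeft _ (hf.2 k) _⟩

lemma isMonoidalModel_AD : IsMonoidalModel AD where
  closed := ⟨inferInstance⟩
  pushoutProduct_cof _ _ _ _ _ _ sq hi hj := ⟨pushoutProduct_cof hi.mem hj.mem sq⟩
  pushoutProduct_weq _ _ _ _ i j sq hi hj h := by
    have := mono_left_of_cof hi.mem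
    have := mono_left_of_cof hj.mem
    have := mono_right_of_cof hi.mem
    have := mono_right_of_cof hj.mem
    exact ⟨stalkWeq_pushoutProduct sq (h.imp (fun h ↦ h.mem) fun h ↦ h.mem)⟩
  unit_left _ _ X _ hq _ := ⟨stalkWeq_whiskerRight hq.mem X⟩
  unit_right _ _ X _ hq _ := ⟨stalkWeq_whiskerLeft hq.mem X⟩

/-- Stalks preserve pushouts and pullbacks, cofibrations are injective on stalks and fibrations
surjective, so the five lemma applies stalk by stalk. -/
lemma isProperModel_AD : IsProperModel AD where
  left _ _ _ _ f i i' f' sq hf hi := by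
    have : Mono (stalkInf.map i) := mono_left_of_cof hi.mem
    refine ⟨DgQ.weqQ_of_isPushout (sq.map stalkInf) hf.mem.1, fun k ↦ ?_⟩
    have := mono_right_of_cof hi.mem k
    have : Mono (i.right k).hom := DgQW.mono_iff.1 this
    exact DgQ.weqQ_of_isPushout (i := (i.right k).hom) (sq.map (stalk k ⋙ Action.forget DgQ W₂)) (hf.mem.2 k)
  right _ _ _ _ f' p' p f sq hf hp := by
    have : Epi (stalkInf.map p) := DgQ.epi_iff.2 hp.mem.1
    refine ⟨DgQ.weqQ_of_isPullback (sq.map stalkInf) hf.mem.1, fun k ↦ ?_⟩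
    have : Epi (p.right k).hom := DgQ.epi_iff.2 (hp.mem.2 k)
    exact DgQ.weqQ_of_isPullback (p := (p.right k).hom) (sq.map (stalk k ⋙ Action.forget DgQ W₂)) (hf.mem.2 k)

section MonoidAxiom

variable {D : Type*} [Category.{0} D] {P : MorphismProperty D} {I : MorphismProperty AD}

/-- If a functor sends the maps of `I` to maps having a left lifting property, it does so for the
transfinite compositions of pushouts of maps of `I`. -/
lemma relCell_map_llp (F : AD ⥤ D) [PreservesColimits F]
    (h : I ≤ P.llp.inverseImage F) : relCell I ≤ P.llp.inverseImage F := by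
  have h' : I.pushouts ≤ P.llp.inverseImage F := by
    rintro X Y f ⟨X', Y', g, u, v, hg, sq⟩
    exact P.llp.of_isPushout (sq.map F) (h _ hg)
  intro X Y f hf
  obtain ⟨J, _, _, _, _, ⟨hJ⟩⟩ := (MorphismProperty.transfiniteCompositions_iff _ _).1 hf
  have : PreservesWellOrderContinuousOfShape J F := ⟨fun _ _ ↦ inferInstance⟩
  exact MorphismProperty.transfiniteCompositionsOfShape_le P.llp J _
    ((hJ.ofLE h').map (W := P.llp) (F := F)).mem

/-- On each stalk `j ⊗ Z` is an injective quasi-isomorphism, hence lifts against surjections. This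
lifting property, unlike being a cofibration of `AD`, holds for arbitrary `Z`; it survives cell
constructions and implies being a quasi-isomorphism. -/
lemma monoidAxiom_AD : MonoidAxiom AD := by
  intro X Y f hf
  have h₁ : trivCofTensor AD ≤ fibQ.llp.inverseImage stalkInf := by
    rintro _ _ _ ⟨j, Z, hj⟩
    have := mono_left_of_cof hj.1
    exact DgQ.llp_fibQ_of_mono (j.left ▷ Z.left) (DgQ.weqQ_whiskerRight _ hj.2.1 _)
  have h₂ (k : ℕ+) : trivCofTensor AD ≤
      fibQ.llp.inverseImage (stalk k ⋙ Action.forget DgQ W₂) := by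
    rintro _ _ _ ⟨j, Z, hj⟩
    have := mono_right_of_cof hj.1 k
    have : Mono (j.right k).hom := DgQW.mono_iff.1 this
    exact DgQ.llp_fibQ_of_mono ((j.right k).hom ▷ (Z.right k).V)
      (DgQ.weqQ_whiskerRight _ (hj.2.2 k) _)
  have : PreservesColimits stalkInf := stalkInfAdj.leftAdjoint_preservesColimits
  exact ⟨DgQ.weqQ_of_llp (relCell_map_llp _ h₁ _ hf), fun k ↦
    DgQ.weqQ_of_llp (relCell_map_llp _ (h₂ k) _ hf)⟩

end MonoidAxiom

end Axioms

end DihedralModel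

end

open DihedralModel HomotopicalAlgebra

theorem mainTheorem4 :
    ∃ _ : ModelCategory AD,
      weakEquivalences AD = stalkWeq ∧
      fibrations AD = stalkFib ∧
      IsCompleteFunctorial AD ∧
      IsMonoidalModel AD ∧
      IsCofibrantlyGeneratedBy genCof genTrivCof ∧
      IsProperModel AD ∧
      MonoidAxiom AD := by
  exact ⟨modelCategoryAD, rfl, rfl, isCompleteFunctorial_AD, isMonoidalModel_AD,
    isCofibrantlyGeneratedBy_AD, isProperModel_AD, monoidAxiom_AD⟩
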